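/- Let $\Sigma$ be a closed oriented smooth surface and $I=[0,1]$. An oriented knot diagram on $\Sigma$ is a smooth immersion $S^1\to\Sigma$ whose only multiple points are finitely many transverse double points, together with over/under information at each of them. Let $\mathcal K(\Sigma)$ be the set of oriented knots in $\Sigma\times I$, described as the set of oriented knot diagrams on $\Sigma$ modulo the equivalence relation generated by ambient isotopy of $\Sigma$, orientation preserving reparametrization of the circle, and the three Reidemeister moves performed in discs of $\Sigma$; let $\mathbb Z[\mathcal K(\Sigma)]$ be the free abelian group on $\mathcal K(\Sigma)$. The Gauss diagram of a knot diagram $K$ is the circle, drawn counterclockwise as the boundary of a disc, with one arrow (chord) for every crossing, pointing from the preimage on the overpass to the preimage on the underpass and carrying the sign of the crossing. Two non-intersecting arrows divide the disc into three regions. The oriented smoothing of $K$ at the two corresponding crossings produces three closed oriented curves, one for each region, and each region is labelled by the class of its curve in $H_1(\Sigma;\mathbb Z)$. For $\alpha,\beta,\gamma\in H_1(\Sigma;\mathbb Z)$ denote by $\uparrow\uparrow(\alpha,\beta,\gamma)$, $\uparrow\downarrow(\alpha,\beta,\gamma)$ and $\downarrow\uparrow(\alpha,\beta,\gamma)$ the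 unsigned Gauss diagram, considered up to rotation of the circle, with two vertical arrows having the indicated directions (left arrow first) and with the regions labelled $\alpha,\beta,\gamma$ from left to right. Let $\mathscr A(\Sigma)$ be the abelian group generated by all these diagrams, subject to the relations * $\uparrow\uparrow(\alpha,\beta,\gamma)=\uparrow\downarrow(\alpha,\beta,\gamma)=\downarrow\uparrow(\alpha,\beta,\gamma)=0$ whenever $0\in\{\alpha,\beta,\gamma\}$; * $\uparrow\uparrow(\alpha,\beta,\gamma)+\uparrow\uparrow(\alpha,\gamma,\beta)-\downarrow\uparrow(\beta,\alpha,\gamma)=0$ for all $\alpha,\beta,\gamma$; * $\uparrow\uparrow(\alpha,\beta,\gamma)+\uparrow\uparrow(\beta,\alpha,\gamma)-\uparrow\downarrow(\alpha,\gamma,\beta)=0$ for all $\alpha,\beta,\gamma$. For a knot diagram $K$ on $\Sigma$ put $$\Phi[\Sigma](K)=\sum_{D'} \operatorname{sign}(D')\, D'\in\mathscr A(\Sigma),$$ where $D'$ runs over the subdiagrams of the Gauss diagram of $K$ that consist of two non-intersecting arrows, $\operatorname{sign}(D')$ is the product of the signs of the two arrows, and the summand $D'$ stands for the unsigned diagram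 with its regions labelled as above. Then $\Phi[\Sigma]$ is an invariant of knots in $\Sigma\times I$: there is a (unique) group homomorphism $\Phi[\Sigma]:\mathbb Z[\mathcal K(\Sigma)]\to\mathscr A(\Sigma)$ whose value on the class of every knot diagram $K$ is the sum above. -/

import Mathlib

open scoped Manifold ContDiff

universe u

noncomputable section

namespace SurfaceKnot

open CategoryTheory

/-! ### First singular homology and the classes of cycles made of paths -/

section Homology

open AlgebraicTopology Simplicial Opposite

variable (S : Type u) [TopologicalSpace S]

/-- The coefficient group `ℤ` (in the universe of the space). -/
abbrev Zcoeff : AddCommGrpCat.{u} := AddCommGrpCat.of (ULift.{u} ℤ)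

/-- The singular simplicial set of `S`. -/
abbrev sing : SSet.{u} := TopCat.toSSet.obj (TopCat.of S)

/-- The singular chain complex of `S` with integer coefficients. -/
abbrev chains : ChainComplex AddCommGrpCat.{u} ℕ :=
  ((singularChainComplexFunctor AddCommGrpCat.{u}).obj Zcoeff).obj (TopCat.of S)

/-- The first singular homology group `H₁(S; ℤ)`. -/
abbrev H1 : Type u :=
  ((singularHomologyFunctor AddCommGrpCat.{u} 1).obj Zcoeff).obj (TopCat.of S)

variable {S}

/-- A point of `S` as a singular `0`-chain; a singular `n`-chain is given as the homomorphism from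
`ℤ` that sends `1` to it. -/
def pointChain (p : S) : Zcoeff.{u} ⟶ (chains S).X 0 :=
  SSet.ιChainComplex (X := sing S)
    ((TopCat.toSSetObjEquiv (TopCat.of S) (op ⦋0⦌)).symm (ContinuousMap.const _ p))

/-- The path `s ↦ f s`, `0 ≤ s ≤ 1`, as a map from the standard `1`-simplex. -/
def pathSimplex (f : C(ℝ, S)) : C(stdSimplex ℝ (Fin 2), S) :=
  f.comp ⟨fun v => (v : Fin 2 → ℝ) 1, (continuous_apply 1).comp continuous_subtype_val⟩

/-- The singular `1`-simplex with underlying path `s ↦ f s`, `0 ≤ s ≤ 1`, as a `1`-chain. -/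
def pathChain (f : C(ℝ, S)) : Zcoeff.{u} ⟶ (chains S).X 1 :=
  SSet.ιChainComplex (X := sing S)
    ((TopCat.toSSetObjEquiv (TopCat.of S) (op ⦋1⦌)).symm (pathSimplex f))

theorem pathSimplex_face (f : C(ℝ, S)) (i j : Fin 2) (hij : i.succAbove 0 = j) :
    (sing S).δ i ((TopCat.toSSetObjEquiv (TopCat.of S) (op ⦋1⦌)).symm (pathSimplex f)) =
      (TopCat.toSSetObjEquiv (TopCat.of S) (op ⦋0⦌)).symm
        (ContinuousMap.const _ (f (Pi.single (M := fun _ : Fin 2 => ℝ) j 1 1))) := by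
  apply (TopCat.toSSetObjEquiv (TopCat.of S) (op ⦋0⦌)).injective
  rw [Equiv.apply_symm_apply]
  ext v
  have hv : v = stdSimplex.vertex (S := ℝ) (0 : Fin 1) := by
    exact Subsingleton.elim _ _
  change f ((stdSimplex.map (S := ℝ) (SimplexCategory.δ i) v : Fin 2 → ℝ) 1) = f _
  rw [hv, stdSimplex.map_vertex, stdSimplex.vertex_coe, ← hij]
  rfl

theorem pathChain_d (f : C(ℝ, S)) :
    pathChain f ≫ (chains S).d 1 0 = pointChain (f 1) - pointChain (f 0) := by
  have key := SSet.ιChainComplex_d (X := sing S) (R := Zcoeff.{u})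
    ((TopCat.toSSetObjEquiv (TopCat.of S) (op ⦋1⦌)).symm (pathSimplex f))
  refine key.trans ?_
  rw [Fin.sum_univ_two, pathSimplex_face f 0 1 rfl, pathSimplex_face f 1 0 rfl]
  simp [pointChain]
  exact (sub_eq_add_neg _ _).symm

/-- The homology class of a `1`-cycle. -/
def cycleClass (z : Zcoeff.{u} ⟶ (chains S).X 1) (hz : z ≫ (chains S).d 1 0 = 0) : H1 S :=
  ((chains S).liftCycles z 0 (by simp) hz ≫ (chains S).homologyπ 1).hom (ULift.up 1)

end Homology

/-! ### Oriented surfaces -/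

/-- The Euclidean plane. -/
abbrev Plane : Type := EuclideanSpace ℝ (Fin 2)

/-- The determinant of the pair `(v, w)` of plane vectors. -/
def wedge (v w : Plane) : ℝ := v 0 * w 1 - v 1 * w 0

section Surface

variable (S : Type u) [TopologicalSpace S] [ChartedSpace Plane S]

/-- The surface is oriented by its atlas: all coordinate changes have positive Jacobian. -/
class OrientedAtlas : Prop where
  jacobian_pos : ∀ e ∈ atlas Plane S, ∀ e' ∈ atlas Plane S, ∀ x ∈ (e.symm.trans e').source,
    0 < (fderiv ℝ (e.symm.trans e') x).det

variable {S}

/-- A smooth chart that is compatible with the orientation given by the atlas. -/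
def IsPositiveChart (e : OpenPartialHomeomorph S Plane) : Prop :=
  e ∈ IsManifold.maximalAtlas (𝓡 2) ∞ S ∧
    ∀ e' ∈ atlas Plane S, ∀ x ∈ (e.symm.trans e').source, 0 < (fderiv ℝ (e.symm.trans e') x).det

/-- The velocity of a closed curve at parameter `x`, in the preferred chart at the point
`γ x`. -/
def velocity (γ : UnitAddCircle → S) (x : UnitAddCircle) : Plane :=
  deriv (fun t : ℝ => chartAt Plane (γ x) (γ (x + (t : UnitAddCircle)))) 0

end Surface

/-! ### Knot diagrams on a surface -/

/-- An oriented knot diagram on the surface `S`: a smooth immersion of the circle `ℝ/ℤ` whose only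
multiple points are transverse double points, finite in number, with over/under information. A
crossing is recorded as the pair (parameter of the overpass, parameter of the underpass). -/
structure KnotDiagram (S : Type u) [TopologicalSpace S] [ChartedSpace Plane S] where
  curve : C(UnitAddCircle, S)
  smooth : ContMDiff 𝓘(ℝ, ℝ) (𝓡 2) ∞ (fun t : ℝ => curve (t : UnitAddCircle))
  immersed : ∀ x, velocity curve x ≠ 0
  crossings : Finset (UnitAddCircle × UnitAddCircle)
  double_point : ∀ c ∈ crossings, c.1 ≠ c.2 ∧ curve c.1 = curve c.2
  over_or_under : ∀ x y, x ≠ y → curve x = curve y →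
    ((x, y) ∈ crossings ↔ (y, x) ∉ crossings)
  no_triple : ∀ x y z, curve x = curve y → curve y = curve z → x = y ∨ y = z ∨ x = z
  transverse : ∀ c ∈ crossings, wedge (velocity curve c.1) (velocity curve c.2) ≠ 0

/-! ### Reidemeister equivalence of knot diagrams -/

section Moves

variable {S : Type u} [TopologicalSpace S] [ChartedSpace Plane S]

/-- `D'` is obtained from `D` by an ambient isotopy of the surface and an orientation preserving
reparametrization of the circle (the circle diffeomorphism is given by its lift `h`). -/
def IsotopyMove (D D' : KnotDiagram S) : Prop :=
  ∃ (F : ℝ → (S ≃ₘ^∞⟮𝓡 2, 𝓡 2⟯ S)) (h : ℝ → ℝ),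
    F 0 = Diffeomorph.refl (𝓡 2) S ∞ ∧
    ContMDiff (𝓘(ℝ, ℝ).prod (𝓡 2)) (𝓡 2) ∞ (fun p : ℝ × S => F p.1 p.2) ∧
    ContDiff ℝ ∞ h ∧ (∀ t, 0 < deriv h t) ∧ (∀ t, h (t + 1) = h t + 1) ∧
    (∀ t : ℝ, D'.curve (t : UnitAddCircle) = F 1 (D.curve (h t : UnitAddCircle))) ∧
    ∀ s t : ℝ, ((s : UnitAddCircle), (t : UnitAddCircle)) ∈ D'.crossings ↔
      ((h s : UnitAddCircle), (h t : UnitAddCircle)) ∈ D.crossings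

/-- The closed square `[-1,1]²`. -/
def closedBox : Set Plane := {p | |p 0| ≤ 1 ∧ |p 1| ≤ 1}

/-- The open square `(-1,1)²`. -/
def openBox : Set Plane := {p | |p 0| < 1 ∧ |p 1| < 1}

/-- The closed arc of the circle with centre `x` and radius `r`. -/
def circleArc (x : UnitAddCircle) (r : ℝ) : Set UnitAddCircle :=
  (fun t : ℝ => x + ((r * t : ℝ) : UnitAddCircle)) '' Set.Icc (-1) 1

/-- The two diagrams coincide, with their crossings, on the set `A` of parameters. -/
def AgreeOn (A : Set UnitAddCircle) (D D' : KnotDiagram S) : Prop :=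
  (∀ z ∈ A, D.curve z = D'.curve z) ∧
    ∀ z ∈ A, ∀ w ∈ A, ((z, w) ∈ D.crossings ↔ (z, w) ∈ D'.crossings)

/-- First Reidemeister move: inside some disc (the preimage of a closed square under a chart) the
diagram `D` is a single arc without crossings and `D'` is a single arc with exactly one crossing;
outside the disc both coincide. -/
def R1Move (D D' : KnotDiagram S) : Prop :=
  ∃ (e : OpenPartialHomeomorph S Plane) (x : UnitAddCircle) (r : ℝ),
    IsPositiveChart e ∧ closedBox ⊆ e.target ∧ 0 < r ∧ r < 1 / 2 ∧
    AgreeOn (circleArc x r)ᶜ D D' ∧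
    (∀ z ∉ circleArc x r, D.curve z ∉ e.symm '' closedBox) ∧
    (∀ t ∈ Set.Ioo (-1 : ℝ) 1,
      D.curve (x + ((r * t : ℝ) : UnitAddCircle)) ∈ e.symm '' openBox ∧
      D'.curve (x + ((r * t : ℝ) : UnitAddCircle)) ∈ e.symm '' openBox) ∧
    (∀ c ∈ D.crossings, ¬ (c.1 ∈ circleArc x r ∧ c.2 ∈ circleArc x r)) ∧
    ∃! c, c ∈ D'.crossings ∧ c.1 ∈ circleArc x r ∧ c.2 ∈ circleArc x r

/-- A local move of `k` layered strands: inside some disc (the preimage of the square `[-1,1]²`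
under a chart) the diagram `D` consists of `k` strands running along the graphs of the functions
`φ i`, and `D'` of `k` strands running along the graphs of `φ' i`. Strand `i` is traversed from
left to right if `dir i = 1` and from right to left if `dir i = -1`; both diagrams have strand `i`
above strand `j` whenever `height j < height i`. Outside the disc both diagrams coincide. -/
def StrandMove {k : ℕ} (φ φ' : Fin k → ℝ → ℝ) (D D' : KnotDiagram S) : Prop :=
  ∃ (e : OpenPartialHomeomorph S Plane) (x : Fin k → UnitAddCircle) (r dir : Fin k → ℝ)
    (height : Fin k → ℕ),
    IsPositiveChart e ∧ closedBox ⊆ e.target ∧ (∀ i, 0 < r i) ∧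
    (∀ i, dir i = 1 ∨ dir i = -1) ∧ Function.Injective height ∧
    (∀ i j, i ≠ j → Disjoint (circleArc (x i) (r i)) (circleArc (x j) (r j))) ∧
    AgreeOn (⋃ i, circleArc (x i) (r i))ᶜ D D' ∧
    (∀ z ∉ ⋃ i, circleArc (x i) (r i), D.curve z ∉ e.symm '' closedBox) ∧
    (∀ i, ∀ t ∈ Set.Icc (-1 : ℝ) 1,
      D.curve (x i + ((r i * t : ℝ) : UnitAddCircle)) =
        e.symm !₂[dir i * t, φ i (dir i * t)] ∧
      D'.curve (x i + ((r i * t : ℝ) : UnitAddCircle)) =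
        e.symm !₂[dir i * t, φ' i (dir i * t)]) ∧
    ∀ i j, height j < height i →
      ∀ z ∈ circleArc (x i) (r i), ∀ w ∈ circleArc (x j) (r j),
        (D.curve z = D.curve w → (z, w) ∈ D.crossings) ∧
        (D'.curve z = D'.curve w → (z, w) ∈ D'.crossings)

/-- Second Reidemeister move: one strand is the axis; the other one, of constant height above or
below it, dips across the axis between `p` and `q` in `D` and stays on one side of it in `D'`. -/
def R2Move (D D' : KnotDiagram S) : Prop :=
  ∃ (f g : ℝ → ℝ) (p q : ℝ), -1 < p ∧ p < q ∧ q < 1 ∧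
    (∀ t ∈ Set.Icc (-1 : ℝ) 1, |f t| < 1 ∧ (0 < f t ↔ t < p ∨ q < t) ∧ (f t < 0 ↔ p < t ∧ t < q)) ∧
    (∀ t ∈ Set.Icc (-1 : ℝ) 1, 0 < g t ∧ g t < 1) ∧
    StrandMove ![fun _ => 0, f] ![fun _ => 0, g] D D'

/-- Third Reidemeister move: two strands are the diagonals of the square, the third one is a graph
of slope less than one in absolute value (so it meets each diagonal exactly once); it runs on
either side of the crossing of the diagonals in the two diagrams. -/
def R3Move (D D' : KnotDiagram S) : Prop :=
  ∃ f g : ℝ → ℝ, f 0 < 0 ∧ 0 < g 0 ∧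
    (∀ t ∈ Set.Icc (-1 : ℝ) 1, |f t| < 1 ∧ |g t| < 1) ∧
    (∀ s ∈ Set.Icc (-1 : ℝ) 1, ∀ t ∈ Set.Icc (-1 : ℝ) 1, s < t →
      |f t - f s| < t - s ∧ |g t - g s| < t - s) ∧
    StrandMove ![fun t => t, fun t => -t, f] ![fun t => t, fun t => -t, g] D D'

/-- One of the moves generating the equivalence of knot diagrams. -/
inductive ReidemeisterStep : KnotDiagram S → KnotDiagram S → Prop where
  | isotopy {D D'} (h : IsotopyMove D D') : ReidemeisterStep D D'
  | one {D D'} (h : R1Move D D') : ReidemeisterStep D D'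
  | two {D D'} (h : R2Move D D') : ReidemeisterStep D D'
  | three {D D'} (h : R3Move D D') : ReidemeisterStep D D'

variable (S) in
/-- The set `𝒦(S)` of knot types in `S × I`: knot diagrams on `S` modulo the equivalence relation
generated by the Reidemeister moves. -/
def Knots : Type u := Quot (ReidemeisterStep (S := S))

/-- The knot type represented by a diagram. -/
def KnotDiagram.toKnot (D : KnotDiagram S) : Knots S := Quot.mk _ D

end Moves

/-! ### The group of labelled two-arrow diagrams -/

/-- Direction of an arrow, seen from the boundary arc that it cuts off from the circle: the arc,
with the orientation of the circle, leads from the tail (overpass) of the arrow to its head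
(underpass), or the other way round. -/
inductive ArrowDir where
  | tailToHead
  | headToTail

/-- Unsigned Gauss diagrams with two non-intersecting arrows and three regions labelled in `H`, up
to rotation of the circle. Each arrow cuts off one outer region; the diagram is determined by the
label of the region between the two arrows together with the unordered pair of the outer regions,
each with its label and the direction of its arrow. -/
structure LabelledDiagram (H : Type u) where
  middle : H
  outer : Sym2 (H × ArrowDir)

namespace LabelledDiagram

variable {H : Type u}

/-- Two vertical arrows `↑ ↑` in a circle oriented counterclockwise, regions labelled `α, β, γ` from
left to right. -/
def upUp (α β γ : H) : LabelledDiagram H :=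
  ⟨β, s((α, .headToTail), (γ, .tailToHead))⟩

/-- Two vertical arrows `↑ ↓`, regions labelled `α, β, γ` from left to right. -/
def upDown (α β γ : H) : LabelledDiagram H :=
  ⟨β, s((α, .headToTail), (γ, .headToTail))⟩

/-- Two vertical arrows `↓ ↑`, regions labelled `α, β, γ` from left to right. -/
def downUp (α β γ : H) : LabelledDiagram H :=
  ⟨β, s((α, .tailToHead), (γ, .tailToHead))⟩

/-- The defining relators of `𝒜`. -/
inductive Relator [AddCommGroup H] : FreeAbelianGroup (LabelledDiagram H) → Prop where
  | upUp_zero (α β γ : H) (h : α = 0 ∨ β = 0 ∨ γ = 0) : Relator (.of (upUp α β γ))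
  | upDown_zero (α β γ : H) (h : α = 0 ∨ β = 0 ∨ γ = 0) : Relator (.of (upDown α β γ))
  | downUp_zero (α β γ : H) (h : α = 0 ∨ β = 0 ∨ γ = 0) : Relator (.of (downUp α β γ))
  | triangle_left (α β γ : H) :
      Relator (.of (upUp α β γ) + .of (upUp α γ β) - .of (downUp β α γ))
  | triangle_right (α β γ : H) :
      Relator (.of (upUp α β γ) + .of (upUp β α γ) - .of (upDown α γ β))

end LabelledDiagram

/-- The abelian group `𝒜` generated by the labelled two-arrow diagrams, modulo the relators. -/
abbrev DiagramGroup (H : Type u) [AddCommGroup H] : Type u :=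
  FreeAbelianGroup (LabelledDiagram H) ⧸ AddSubgroup.closure {x | LabelledDiagram.Relator (H := H) x}

/-- The abelian group `𝒜(S)` of a surface `S`. -/
abbrev SurfaceGroup (S : Type u) [TopologicalSpace S] : Type u := DiagramGroup (H1 S)

/-! ### The map `Φ[S]` on diagrams -/

/-- The length, in `(0, 1]`, of the positively oriented arc from `x` to `y`. -/
def arcLen (x y : UnitAddCircle) : ℝ := (AddCircle.equivIoc (1 : ℝ) 0 (y - x) : ℝ)

theorem add_arcLen (x y : UnitAddCircle) : x + (arcLen x y : UnitAddCircle) = y := by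
  simp [arcLen]

/-- `z` lies in the open positively oriented arc from `x` to `y`. -/
def InArc (x y z : UnitAddCircle) : Prop := arcLen x z < arcLen x y

namespace KnotDiagram

variable {S : Type u} [TopologicalSpace S] [ChartedSpace Plane S] (D : KnotDiagram S)

/-- The part of the curve over the positively oriented arc of the circle from `x` to `y`, as a
singular `1`-chain. -/
def arcChain (x y : UnitAddCircle) : Zcoeff.{u} ⟶ (chains S).X 1 :=
  pathChain ⟨fun s : ℝ => D.curve (x + ((s * arcLen x y : ℝ) : UnitAddCircle)),
    D.curve.continuous.comp (continuous_const.add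
      ((AddCircle.continuous_mk' 1).comp (continuous_id.mul continuous_const)))⟩

theorem arcChain_d (x y : UnitAddCircle) :
    D.arcChain x y ≫ (chains S).d 1 0 = pointChain (D.curve y) - pointChain (D.curve x) := by
  rw [arcChain, pathChain_d]
  simp [add_arcLen]

/-- The arrows of the Gauss diagram, one for each crossing. -/
abbrev Arrow : Type := {c : UnitAddCircle × UnitAddCircle // c ∈ D.crossings}

variable {D}

namespace Arrow

/-- The parameter of the overpass. -/
def tail (c : D.Arrow) : UnitAddCircle := c.1.1

/-- The parameter of the underpass. -/
def head (c : D.Arrow) : UnitAddCircle := c.1.2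

theorem curve_tail (c : D.Arrow) : D.curve c.tail = D.curve c.head :=
  (D.double_point c.1 c.2).2

/-- The sign of the crossing: `1` if the directions of the overpass and the underpass, in this
order, form a positive basis, and `-1` otherwise. -/
def sign (c : D.Arrow) : ℤ :=
  SignType.sign (wedge (velocity D.curve c.tail) (velocity D.curve c.head))

/-- Two different arrows do not intersect: both ends of the one lie on the same side of the
other (and vice versa). -/
def NonIntersecting (c d : D.Arrow) : Prop :=
  c ≠ d ∧ (InArc c.tail c.head d.tail ↔ InArc c.tail c.head d.head) ∧
    (InArc d.tail d.head c.tail ↔ InArc d.tail d.head c.head)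

open Classical in
/-- The direction of `c` seen from the arc that `c` cuts off on the side away from `d`. -/
def outerDir (c d : D.Arrow) : ArrowDir :=
  if InArc c.tail c.head d.tail then .headToTail else .tailToHead

/-- The starting point of the arc that `c` cuts off on the side away from `d`. -/
def outerStart (c d : D.Arrow) : UnitAddCircle :=
  match c.outerDir d with
  | .tailToHead => c.tail
  | .headToTail => c.head

/-- The end point of the arc that `c` cuts off on the side away from `d`. -/
def outerEnd (c d : D.Arrow) : UnitAddCircle :=
  match c.outerDir d with
  | .tailToHead => c.head
  | .headToTail => c.tail

theorem curve_outer (c d : D.Arrow) :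
    D.curve (c.outerStart d) = D.curve (c.outerEnd d) := by
  unfold outerStart outerEnd
  cases c.outerDir d
  · exact c.curve_tail
  · exact c.curve_tail.symm

/-- The homology class of the closed curve of the outer region cut off by `c`. -/
def outerClass (c d : D.Arrow) : H1 S :=
  cycleClass (D.arcChain (c.outerStart d) (c.outerEnd d)) (by
    rw [arcChain_d, c.curve_outer d, sub_self])

/-- The homology class of the closed curve of the region between `c` and `d`. -/
def middleClass (c d : D.Arrow) : H1 S :=
  cycleClass (D.arcChain (c.outerEnd d) (d.outerStart c) +
      D.arcChain (d.outerEnd c) (c.outerStart d)) (by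
    rw [Preadditive.add_comp, arcChain_d, arcChain_d, c.curve_outer d, d.curve_outer c]
    abel)

theorem middleClass_comm (c d : D.Arrow) : c.middleClass d = d.middleClass c := by
  unfold middleClass
  congr 1
  exact add_comm _ _

/-- The unsigned Gauss diagram of the two arrows `c`, `d`, regions labelled by the homology classes
of the closed curves obtained by the oriented smoothing of both crossings. -/
def labelled (c d : D.Arrow) : LabelledDiagram (H1 S) :=
  ⟨c.middleClass d, s((c.outerClass d, c.outerDir d), (d.outerClass c, d.outerDir c))⟩

theorem labelled_comm (c d : D.Arrow) : c.labelled d = d.labelled c := by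
  unfold labelled
  rw [middleClass_comm, Sym2.eq_swap]

theorem nonIntersecting_comm (c d : D.Arrow) :
    c.NonIntersecting d ↔ d.NonIntersecting c := by
  unfold NonIntersecting
  rw [ne_comm]
  tauto

open Classical in
/-- The contribution of the subdiagram formed by the unordered pair of arrows `c`, `d`. -/
def term : Sym2 D.Arrow → SurfaceGroup S :=
  Sym2.lift ⟨fun c d => if c.NonIntersecting d then
      (c.sign * d.sign) • (QuotientAddGroup.mk (FreeAbelianGroup.of (c.labelled d)) : SurfaceGroup S)
    else 0, fun c d => by
      dsimp only
      rw [labelled_comm, mul_comm]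
      exact if_congr (nonIntersecting_comm c d) rfl rfl⟩

end Arrow

open Classical in
variable (D) in
/-- The value `Φ[S](D)` in `𝒜(S)`: the signed sum of the two-arrow non-intersecting
subdiagrams of the Gauss diagram of `D`. -/
def phi : SurfaceGroup S := ∑ p : Sym2 D.Arrow, Arrow.term p

end KnotDiagram

end SurfaceKnot

end

/-! Existence amounts to the invariance of `KnotDiagram.phi` under each generating move; uniqueness
holds because the classes of diagrams generate the free abelian group.

Labels are compared in the group of singular 1-chains modulo boundaries, into which `H1` injects
(`homologyInclusion_injective`). There every path has a class, additive under concatenation, so a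
label is a sum of classes of arcs. A potential (`IsPotential`) is a function `p` on the line whose
differences give these classes up to a correction `V` that depends only on the end points in the
surface and therefore cancels around closed curves. Hence the term of a pair of arrows depends only
on the order of its four ends on the circle and on the values of `p` there
(`arrowTerm_eq_of_sameOrder`). The diagrams before and after a move in a disc have a common
potential that is constant along each strand in the disc (`exists_common_potential`): as far as
labels are concerned, a strand is a point.

An isotopy transports the potential and preserves cyclic order and signs. The first move adds an
arrow that cuts off an empty arc of class 0, so all its terms vanish. The second move adds two
arrows of opposite signs that are interchangeable against any third arrow; as a pair they intersect
or enclose a middle region of class 0.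

In the third move the three crossings keep their signs and their terms with arrows outside the disc.
Any two of them share one strand, on which their order is reversed, so this pair is non-intersecting
in exactly one of the two diagrams (`arrowTerm_sub`). The three resulting changes carry the same
three labels, the classes of the arcs that join the strands, and with their signs they add up to
plus or minus a triangle relator; which of the two relators occurs depends on the cyclic order in
which the knot visits the top, middle and bottom strands. -/

noncomputable section

namespace SurfaceKnot

open CategoryTheory

/-! ### Classes of paths in the 1-chains modulo boundaries. -/

section PathClasses

open AlgebraicTopology Simplicial Opposite

variable (S : Type u) [TopologicalSpace S]

/-- Singular `1`-chains modulo boundaries. -/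
abbrev ChainClass : Type u := (chains S).opcycles 1

/-- The inclusion of the first homology group into the `1`-chains modulo boundaries. -/
def homologyInclusion : H1 S →+ ChainClass S := ((chains S).homologyι 1).hom

theorem homologyInclusion_injective : Function.Injective (homologyInclusion S) :=
  (AddCommGrpCat.mono_iff_injective ((chains S).homologyι 1)).1 inferInstance

variable {S}

/-- The class of a `1`-chain modulo boundaries. -/
def chainClass (z : Zcoeff.{u} ⟶ (chains S).X 1) : ChainClass S :=
  (z ≫ (chains S).pOpcycles 1).hom (ULift.up 1)

theorem chainClass_add (z w : Zcoeff.{u} ⟶ (chains S).X 1) :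
    chainClass (z + w) = chainClass z + chainClass w := by
  simp [chainClass, Preadditive.add_comp]

theorem homologyInclusion_cycleClass (z : Zcoeff.{u} ⟶ (chains S).X 1)
    (hz : z ≫ (chains S).d 1 0 = 0) :
    homologyInclusion S (cycleClass z hz) = chainClass z := by
  have h : ((chains S).liftCycles z 0 (by simp) hz ≫ (chains S).homologyπ 1) ≫
      (chains S).homologyι 1 = z ≫ (chains S).pOpcycles 1 := by
    simp
  unfold chainClass
  rw [← h]
  rfl

/-- The class of a path modulo boundaries. -/
def pathClass (f : C(ℝ, S)) : ChainClass S := chainClass (pathChain f)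

/-- A singular simplex sees only the parameters in `[0,1]`; paths are defined on the whole line
merely for convenience. -/
theorem pathClass_congr {f g : C(ℝ, S)} (h : ∀ s ∈ Set.Icc (0 : ℝ) 1, f s = g s) :
    pathClass f = pathClass g := by
  have : pathSimplex f = pathSimplex g := by
    ext v
    exact h _ ⟨v.2.1 1, stdSimplex.le_one v 1⟩
  unfold pathClass pathChain
  rw [this]

variable {E : Type*} [AddCommGroup E] [Module ℝ E] [TopologicalSpace E] [ContinuousAdd E]
  [ContinuousSMul ℝ E]

/-- The image under `f` of the straight path from `u` to `v`. -/
def segPath (f : C(E, S)) (u v : E) : C(ℝ, S) :=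
  f.comp ⟨fun s : ℝ => (1 - s) • u + s • v, by fun_prop⟩

/-- The image under `f` of a triangle. -/
def triangleSimplex (f : C(E, S)) (u v w : E) : C(stdSimplex ℝ (Fin 3), S) :=
  f.comp ⟨fun x => (x : Fin 3 → ℝ) 0 • u + (x : Fin 3 → ℝ) 1 • v + (x : Fin 3 → ℝ) 2 • w, by
    have (i : Fin 3) : Continuous fun x : stdSimplex ℝ (Fin 3) => (x : Fin 3 → ℝ) i :=
      (continuous_apply i).comp continuous_subtype_val
    exact (((this 0).smul continuous_const).add ((this 1).smul continuous_const)).add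
      ((this 2).smul continuous_const)⟩

theorem triangleSimplex_face (f : C(E, S)) (u : Fin 3 → E) (i : Fin 3) (g : C(ℝ, S))
    (hg : ∀ s, g s = f ((1 - s) • u (i.succAbove 0) + s • u (i.succAbove 1))) :
    (sing S).δ i ((TopCat.toSSetObjEquiv (TopCat.of S) (op ⦋2⦌)).symm
        (triangleSimplex f (u 0) (u 1) (u 2))) =
      (TopCat.toSSetObjEquiv (TopCat.of S) (op ⦋1⦌)).symm (pathSimplex g) := by
  apply (TopCat.toSSetObjEquiv (TopCat.of S) (op ⦋1⦌)).injective
  rw [Equiv.apply_symm_apply]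
  ext v
  let w : stdSimplex ℝ (Fin 3) := stdSimplex.map (S := ℝ) (SimplexCategory.δ i) v
  have hw (j : Fin 3) : (w : Fin 3 → ℝ) j = ∑ a : Fin 2, if i.succAbove a = j then v a else 0 := by
    rw [← Finset.sum_filter]
    change (stdSimplex.map (S := ℝ) (SimplexCategory.δ i) v : Fin 3 → ℝ) j = _
    rw [stdSimplex.map_coe, FunOnFinite.linearMap_apply_apply]
    rfl
  have h1 : v 0 + v 1 = 1 := stdSimplex.add_eq_one v
  have h2 : v 0 = 1 - v 1 := by linarith
  change f ((w : Fin 3 → ℝ) 0 • u 0 + (w : Fin 3 → ℝ) 1 • u 1 + (w : Fin 3 → ℝ) 2 • u 2) = g (v 1)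
  rw [hg, hw, hw, hw, ← h2]
  congr 1
  fin_cases i <;> simp [Fin.sum_univ_two, Fin.succAbove]

/-- The image under `f` of a triangle, as a singular `2`-chain. -/
def triangleChain (f : C(E, S)) (u v w : E) : Zcoeff.{u} ⟶ (chains S).X 2 :=
  SSet.ιChainComplex (X := sing S)
    ((TopCat.toSSetObjEquiv (TopCat.of S) (op ⦋2⦌)).symm (triangleSimplex f u v w))

/-- The three sides form the boundary of a singular 2-simplex. This is the only source of relations
between path classes: all homotopies below are reduced to it. -/
theorem pathClass_triangle (f : C(E, S)) (u v w : E) :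
    pathClass (segPath f u v) + pathClass (segPath f v w) = pathClass (segPath f u w) := by
  have key := SSet.ιChainComplex_d (X := sing S) (R := Zcoeff.{u})
    ((TopCat.toSSetObjEquiv (TopCat.of S) (op ⦋2⦌)).symm (triangleSimplex f u v w))
  have e0 := triangleSimplex_face f ![u, v, w] 0 (segPath f v w) (fun s => rfl)
  have e1 := triangleSimplex_face f ![u, v, w] 1 (segPath f u w) (fun s => rfl)
  have e2 := triangleSimplex_face f ![u, v, w] 2 (segPath f u v) (fun s => rfl)
  simp only [Matrix.cons_val] at e0 e1 e2
  have key' : triangleChain f u v w ≫ (chains S).d 2 1 = pathChain (segPath f v w) +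
      -pathChain (segPath f u w) + pathChain (segPath f u v) := by
    refine key.trans ?_
    rw [Fin.sum_univ_three, e0, e1, e2]
    simp [pathChain]
    rfl
  have h3 : (pathChain (segPath f v w) + -pathChain (segPath f u w) +
      pathChain (segPath f u v)) ≫ (chains S).pOpcycles 1 = 0 := by
    rw [← key', Category.assoc, (chains S).d_pOpcycles 2 1, Limits.comp_zero]
  have h4 := congrArg (fun z => z.hom (ULift.up (1 : ℤ))) h3
  simp only [Preadditive.add_comp, Preadditive.neg_comp] at h4
  change pathClass (segPath f v w) + -pathClass (segPath f u w) + pathClass (segPath f u v) = 0 at h4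
  rw [← sub_eq_zero, ← h4]
  abel

theorem pathClass_segPath_self (f : C(E, S)) (u : E) : pathClass (segPath f u u) = 0 := by
  have := pathClass_triangle f u u u
  simpa using this

theorem pathClass_const (f : C(ℝ, S)) (h : ∀ s ∈ Set.Icc (0 : ℝ) 1, f s = f 0) :
    pathClass f = 0 := by
  rw [← pathClass_segPath_self f (0 : ℝ)]
  refine pathClass_congr fun s hs => ?_
  simp [segPath, h s hs]

/-- The difference of the classes of the two horizontal sides of a square is the difference of
the classes of the vertical sides. -/
theorem pathClass_square (G : C(ℝ × ℝ, S)) (a b : ℝ) :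
    pathClass (segPath G (0, a) (0, b)) + pathClass (segPath G (0, b) (1, b)) =
      pathClass (segPath G (0, a) (1, a)) + pathClass (segPath G (1, a) (1, b)) := by
  rw [pathClass_triangle, pathClass_triangle]

/-- A path in a vector space is homotopic to its chord; the homotopy `G` keeps the end points fixed,
so two sides of the square are constant. -/
theorem pathClass_comp (f : C(E, S)) (c : C(ℝ, E)) :
    pathClass (f.comp c) = pathClass (segPath f (c 0) (c 1)) := by
  let G : C(ℝ × ℝ, S) := f.comp
    ⟨fun p => (1 - p.1) • c p.2 + p.1 • ((1 - p.2) • c 0 + p.2 • c 1), by fun_prop⟩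
  have h := pathClass_square G 0 1
  have h1 : pathClass (segPath G (0, 0) (0, 1)) = pathClass (f.comp c) :=
    pathClass_congr fun s _ => by simp [segPath, G]
  have h2 : pathClass (segPath G (1, 0) (1, 1)) = pathClass (segPath f (c 0) (c 1)) :=
    pathClass_congr fun s _ => by simp [segPath, G]
  have h3 : pathClass (segPath G (0, 0) (1, 0)) = 0 :=
    pathClass_const _ fun s _ => by simp [segPath, G, ← add_smul]
  have h4 : pathClass (segPath G (0, 1) (1, 1)) = 0 :=
    pathClass_const _ fun s _ => by simp [segPath, G, ← add_smul]
  rw [h1, h2, h3, h4] at h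
  simpa using h

end PathClasses

/-! ### Potentials of curves, and a common potential for two curves that differ in a disc. -/

section Potentials

variable {S : Type u} [TopologicalSpace S]

/-- The class of the piece of a curve between two parameters. -/
abbrev pieceClass (γ : C(ℝ, S)) (a b : ℝ) : ChainClass S := pathClass (segPath γ a b)

theorem pieceClass_add (γ : C(ℝ, S)) (a b c : ℝ) :
    pieceClass γ a b + pieceClass γ b c = pieceClass γ a c :=
  pathClass_triangle γ a b c

/-- A potential of a curve: the classes of pieces of the curve are the differences of its values,
up to a correction that depends on the end points of the piece in the surface only. -/
def IsPotential (γ : C(ℝ, S)) (p : ℝ → ChainClass S) : Prop :=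
  ∃ V : S → ChainClass S, ∀ a b, pieceClass γ a b = p b - p a + (V (γ b) - V (γ a))

theorem isPotential_pieceClass (γ : C(ℝ, S)) : IsPotential γ (pieceClass γ 0) :=
  ⟨0, fun a b => by
    rw [← pieceClass_add γ 0 a b]
    simp⟩

/-- The square rule for the homotopy `G`. The tracks of the two end points are what the correction
term of a potential has to absorb. -/
theorem pieceClass_add_track {γ γ' : C(ℝ, S)} (G : C(ℝ × ℝ, S)) (h0 : ∀ t, G (0, t) = γ t)
    (h1 : ∀ t, G (1, t) = γ' t) (a b : ℝ) :
    pieceClass γ a b + pathClass (segPath G (0, b) (1, b)) =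
      pathClass (segPath G (0, a) (1, a)) + pieceClass γ' a b := by
  have h := pathClass_square G a b
  have h2 : pathClass (segPath G (0, a) (0, b)) = pieceClass γ a b :=
    pathClass_congr fun s _ => by simp [segPath, ← h0]
  have h3 : pathClass (segPath G (1, a) (1, b)) = pieceClass γ' a b :=
    pathClass_congr fun s _ => by simp [segPath, ← h1]
  rwa [h2, h3] at h

theorem pieceClass_comp (γ : C(ℝ, S)) (h : C(ℝ, ℝ)) (a b : ℝ) :
    pieceClass (γ.comp h) a b = pieceClass γ (h a) (h b) := by
  have := pathClass_comp γ (h.comp ⟨fun s : ℝ => (1 - s) • a + s • b, by fun_prop⟩)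
  simp only [ContinuousMap.comp_apply, ContinuousMap.coe_mk, sub_zero, one_smul, zero_smul,
    add_zero, sub_self, zero_add] at this
  exact this

/-- The retraction of the plane onto the closed square. -/
def clampBox : C(Plane, Plane) :=
  ⟨fun v => !₂[max (-1) (min 1 (v 0)), max (-1) (min 1 (v 1))], by fun_prop⟩

theorem clampBox_mem (v : Plane) : clampBox v ∈ closedBox := by
  constructor <;> simp [clampBox, abs_le]

theorem clampBox_of_mem {v : Plane} (hv : v ∈ closedBox) : clampBox v = v := by
  have h0 := abs_le.1 hv.1
  have h1 := abs_le.1 hv.2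
  ext i
  fin_cases i <;> simp [clampBox, h0, h1]

theorem isCompact_closedBox : IsCompact closedBox := by
  have : closedBox = Set.range clampBox := by
    ext v
    exact ⟨fun hv => ⟨v, clampBox_of_mem hv⟩, by rintro ⟨w, rfl⟩; exact clampBox_mem w⟩
  have h2 : closedBox = (WithLp.toLp 2 : (Fin 2 → ℝ) → Plane) '' Set.Icc (-1) 1 := by
    ext v
    constructor
    · intro hv
      have h0 := abs_le.1 hv.1
      have h1 := abs_le.1 hv.2
      refine ⟨v.ofLp, ⟨fun i => ?_, fun i => ?_⟩, rfl⟩ <;> fin_cases i <;> simp [h0, h1]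
    · rintro ⟨w, hw, rfl⟩
      exact ⟨abs_le.2 ⟨hw.1 0, hw.2 0⟩, abs_le.2 ⟨hw.1 1, hw.2 1⟩⟩
  rw [h2]
  exact isCompact_Icc.image (by fun_prop)

/-- The preimage of the closed square under a chart. -/
abbrev boxOf (e : OpenPartialHomeomorph S Plane) : Set S := e.symm '' closedBox

/-- The inverse chart, restricted to the closed square and extended continuously to the plane. -/
def boxMap (e : OpenPartialHomeomorph S Plane) (he : closedBox ⊆ e.target) : C(Plane, S) :=
  ⟨fun v => e.symm (clampBox v), e.continuousOn_symm.comp_continuous clampBox.continuous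
    fun v => he (clampBox_mem v)⟩

theorem mem_boxOf {e : OpenPartialHomeomorph S Plane} (he : closedBox ⊆ e.target) {u : S}
    (hu : u ∈ boxOf e) : u ∈ e.source ∧ e u ∈ closedBox ∧ boxMap e he (e u) = u := by
  obtain ⟨v, hv, rfl⟩ := hu
  have h1 : e (e.symm v) = v := e.right_inv (he hv)
  refine ⟨e.map_target (he hv), by rwa [h1], ?_⟩
  simp [boxMap, h1, clampBox_of_mem hv]

/-- Two curves that coincide outside a closed set of parameters, on which both run in one disc,
have a common potential, which is constant on every interval of that set. -/
theorem exists_common_potential [T2Space S] {γ γ' : C(ℝ, S)} {e : OpenPartialHomeomorph S Plane}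
    (he : closedBox ⊆ e.target) {K : Set ℝ} (hK : IsClosed K) (hoff : ∀ t ∉ K, γ t = γ' t)
    (hon : ∀ t ∈ K, γ t ∈ boxOf e ∧ γ' t ∈ boxOf e) :
    ∃ p, IsPotential γ p ∧ IsPotential γ' p ∧
      ∀ a b, a ≤ b → (∀ t ∈ Set.Icc a b, t ∈ K) → p a = p b := by
  classical
  let f := boxMap e he
  -- Inside the disc the class of a path is determined by its end points; `V` measures it from the
  -- centre of the square. No continuity of `V` is needed.
  let V : S → ChainClass S := fun u => if u ∈ boxOf e then pathClass (segPath f 0 (e u)) else 0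
  have hV {u v : S} (hu : u ∈ boxOf e) (hv : v ∈ boxOf e) :
      pathClass (segPath f (e u) (e v)) = V v - V u := by
    simp only [V, if_pos hu, if_pos hv]
    rw [← pathClass_triangle f 0 (e u) (e v)]
    abel
  have hc {δ : C(ℝ, S)} (hδ : ∀ t ∈ K, δ t ∈ boxOf e) : ContinuousOn (fun t => e (δ t)) K :=
    e.continuousOn.comp δ.continuous.continuousOn fun t ht => (mem_boxOf he (hδ t ht)).1
  -- The straight-line homotopy in the chart over `K`, constant elsewhere. On the frontier of `K`
  -- the curves agree by continuity, so the two clauses match.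
  let g : ℝ × ℝ → S := fun q =>
    if q.2 ∈ K then f ((1 - q.1) • e (γ q.2) + q.1 • e (γ' q.2)) else γ q.2
  have hg : Continuous g := by
    have hA : IsClosed {q : ℝ × ℝ | q.2 ∈ K} := hK.preimage continuous_snd
    refine continuous_if ?_ ?_ (γ.continuous.comp continuous_snd).continuousOn
    · intro q hq
      have hqK : q.2 ∈ K := hA.frontier_subset hq
      have heq : γ q.2 = γ' q.2 := by
        have hcl : IsClosed {q : ℝ × ℝ | γ q.2 = γ' q.2} :=
          isClosed_eq (γ.continuous.comp continuous_snd) (γ'.continuous.comp continuous_snd)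
        have hsub : {q : ℝ × ℝ | q.2 ∈ K}ᶜ ⊆ {q : ℝ × ℝ | γ q.2 = γ' q.2} :=
          fun q hq => hoff _ hq
        rw [frontier_eq_closure_inter_closure] at hq
        exact closure_minimal hsub hcl hq.2
      rw [← heq, ← add_smul, sub_add_cancel, one_smul]
      exact (mem_boxOf he (hon _ hqK).1).2.2
    · rw [hA.closure_eq]
      refine f.continuous.comp_continuousOn ?_
      have h1 : ContinuousOn (fun q : ℝ × ℝ => e (γ q.2)) {q : ℝ × ℝ | q.2 ∈ K} :=
        (hc fun t ht => (hon t ht).1).comp continuousOn_snd fun q hq => hq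
      have h2 : ContinuousOn (fun q : ℝ × ℝ => e (γ' q.2)) {q : ℝ × ℝ | q.2 ∈ K} :=
        (hc fun t ht => (hon t ht).2).comp continuousOn_snd fun q hq => hq
      exact ((continuousOn_const.sub continuousOn_fst).smul h1).add (continuousOn_fst.smul h2)
  let G : C(ℝ × ℝ, S) := ⟨g, hg⟩
  have h0 (t : ℝ) : G (0, t) = γ t := by
    by_cases ht : t ∈ K
    · simp [G, g, ht, f, (mem_boxOf he (hon _ ht).1).2.2]
    · simp [G, g, ht]
  have h1 (t : ℝ) : G (1, t) = γ' t := by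
    by_cases ht : t ∈ K
    · simp [G, g, ht, f, (mem_boxOf he (hon _ ht).2).2.2]
    · simp [G, g, ht, hoff]
  have htrack (t : ℝ) : pathClass (segPath G (0, t) (1, t)) = V (γ' t) - V (γ t) := by
    by_cases ht : t ∈ K
    · rw [← hV (hon _ ht).1 (hon _ ht).2]
      exact pathClass_congr fun s _ => by simp [segPath, G, g, ← add_mul, ht]
    · rw [hoff t ht, sub_self]
      exact pathClass_const _ fun s _ => by simp [segPath, G, g, ← add_mul, ht]
  -- For `γ` this is additivity of pieces; for `γ'` the classes of the tracks, `V (γ' t) - V (γ t)`,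
  -- replace `V` along `γ` by `V` along `γ'`.
  refine ⟨fun t => pieceClass γ 0 t - V (γ t), ⟨V, fun a b => ?_⟩, ⟨V, fun a b => ?_⟩, ?_⟩
  · linear_combination (norm := module) pieceClass_add γ 0 a b
  · have := pieceClass_add_track G h0 h1 a b
    rw [htrack, htrack] at this
    linear_combination (norm := module) pieceClass_add γ 0 a b - this
  · intro a b hab hI
    have hm (s : ℝ) : (Set.projIcc a b hab s : ℝ) ∈ K := hI _ (Set.projIcc a b hab s).2
    -- The projection onto `[a, b]` only extends the path in the chart to the whole line.
    let c : C(ℝ, Plane) := ⟨fun s => e (γ (Set.projIcc a b hab ((1 - s) • a + s • b))),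
      (hc fun t ht => (hon t ht).1).comp_continuous
        (continuous_subtype_val.comp (continuous_projIcc.comp (by fun_prop))) fun s => hm _⟩
    have hcl : pieceClass γ a b = pathClass (f.comp c) := by
      refine pathClass_congr fun s hs => ?_
      have hs' : (1 - s) • a + s • b ∈ Set.Icc a b := by
        constructor <;> simp only [smul_eq_mul] <;> nlinarith [hs.1, hs.2]
      have := (mem_boxOf he (hon _ (hI _ hs')).1).2.2
      simp only [segPath, c, ContinuousMap.comp_apply, ContinuousMap.coe_mk,
        Set.projIcc_of_mem hab hs']
      exact this.symm
    have h2 := hV (hon a (hI a ⟨le_rfl, hab⟩)).1 (hon b (hI b ⟨hab, le_rfl⟩)).1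
    rw [pathClass_comp] at hcl
    have ca : c 0 = e (γ a) := by simp [c]
    have cb : c 1 = e (γ b) := by simp [c]
    rw [ca, cb, h2] at hcl
    linear_combination (norm := module) pieceClass_add γ 0 a b - hcl

end Potentials

/-! ### Representatives of points of the circle, and arcs in terms of them. -/

section CircleLifts

/-- The representative in `[b, b + 1)` of a point of the circle. -/
def lift (b : ℝ) (x : UnitAddCircle) : ℝ := AddCircle.equivIco 1 b x

theorem coe_lift (b : ℝ) (x : UnitAddCircle) : (lift b x : UnitAddCircle) = x :=
  AddCircle.coe_equivIco

theorem lift_mem (b : ℝ) (x : UnitAddCircle) : lift b x ∈ Set.Ico b (b + 1) :=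
  (AddCircle.equivIco 1 b x).2

theorem lift_coe {b u : ℝ} (hu : u ∈ Set.Ico b (b + 1)) : lift b (u : UnitAddCircle) = u :=
  AddCircle.equivIco_coe_of_mem hu

theorem lift_inj {b : ℝ} {x y : UnitAddCircle} : lift b x = lift b y ↔ x = y :=
  ⟨fun h => by rw [← coe_lift b x, h, coe_lift], fun h => by rw [h]⟩

theorem arcLen_coe {u v : ℝ} (h : u < v) (h' : v ≤ u + 1) :
    arcLen (u : UnitAddCircle) (v : UnitAddCircle) = v - u := by
  unfold arcLen
  rw [← AddCircle.coe_sub]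
  exact AddCircle.equivIoc_coe_of_mem ⟨by linarith, by linarith⟩

/-- The extra turn occurs when the arc passes the base point `b`. For `x = y` the arc is the whole
circle, which falls under the same case. -/
theorem arcLen_eq (b : ℝ) (x y : UnitAddCircle) :
    arcLen x y = lift b y - lift b x + if lift b x < lift b y then 0 else 1 := by
  have hx := lift_mem b x
  have hy := lift_mem b y
  conv_lhs => rw [← coe_lift b x, ← coe_lift b y]
  split_ifs with h
  · rw [arcLen_coe h (by linarith [hx.1, hy.2]), add_zero]
  · have : ((lift b y : ℝ) : UnitAddCircle) = ((lift b y + 1 : ℝ) : UnitAddCircle) := by simp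
    rw [this, arcLen_coe (by linarith [hx.2, hy.1]) (by linarith)]
    ring

theorem inArc_iff (b : ℝ) (x y z : UnitAddCircle) :
    InArc x y z ↔ if lift b x < lift b y then lift b x < lift b z ∧ lift b z < lift b y
      else lift b x < lift b z ∨ lift b z < lift b y := by
  have hx := lift_mem b x
  have hy := lift_mem b y
  have hz := lift_mem b z
  unfold InArc
  rw [arcLen_eq b x z, arcLen_eq b x y]
  simp only [Set.mem_Ico] at hx hy hz
  split_ifs with h1 h2 h2
  · exact ⟨fun h => ⟨h1, by linarith⟩, fun h => by linarith [h.2]⟩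
  · exact ⟨fun h => Or.inl h1, fun h => by linarith⟩
  · exact ⟨fun h => by linarith, fun h => by linarith [h.1, h.2]⟩
  · refine ⟨fun h => Or.inr (by linarith), fun h => ?_⟩
    rcases h with h | h <;> linarith

end CircleLifts

/-! ### Labels computed from the order of the ends and a potential. -/

section SameOrder

variable {S : Type u} [TopologicalSpace S]

/-- Two families of points of the circle appear in the same order after `b` and `b'`, respectively,
and at the same values of the potentials. -/
structure SameOrder {n : ℕ} (b b' : ℝ) (p p' : ℝ → ChainClass S)
    (x x' : Fin n → UnitAddCircle) : Prop where
  lt_iff : ∀ i j, lift b (x i) < lift b (x j) ↔ lift b' (x' i) < lift b' (x' j)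
  value : ∀ i, p (lift b (x i)) = p' (lift b' (x' i))

theorem SameOrder.eq_iff {n : ℕ} {b b' : ℝ} {p p' : ℝ → ChainClass S}
    {x x' : Fin n → UnitAddCircle} (h : SameOrder b b' p p' x x') (i j : Fin n) :
    x i = x j ↔ x' i = x' j := by
  rw [← lift_inj (b := b), ← lift_inj (b := b'), eq_iff_le_not_lt, eq_iff_le_not_lt, ← not_lt,
    ← not_lt, h.lt_iff, h.lt_iff]

end SameOrder

section Labels

variable {S : Type u} [TopologicalSpace S] [ChartedSpace Plane S]

namespace KnotDiagram

variable (D : KnotDiagram S)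

/-- The curve of a diagram as a function of a real parameter. -/
def realCurve : C(ℝ, S) := ⟨fun t => D.curve (t : UnitAddCircle),
  D.curve.continuous.comp (AddCircle.continuous_mk' 1)⟩

theorem realCurve_apply (t : ℝ) : D.realCurve t = D.curve (t : UnitAddCircle) := rfl

theorem chainClass_arcChain (u : ℝ) (y : UnitAddCircle) :
    chainClass (D.arcChain u y) = pieceClass D.realCurve u (u + arcLen u y) := by
  refine pathClass_congr fun s _ => ?_
  simp only [segPath, realCurve, ContinuousMap.comp_apply, ContinuousMap.coe_mk, smul_eq_mul]
  rw [← AddCircle.coe_add]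
  congr 2
  ring

end KnotDiagram

/-- The class of the arc from `x` to `y`, computed from a potential. -/
def arcValue (b : ℝ) (p : ℝ → ChainClass S) (x y : UnitAddCircle) : ChainClass S :=
  p (lift b y) - p (lift b x) + if lift b x < lift b y then 0 else p 1 - p 0

variable {D : KnotDiagram S}

/-- The corrections `V` cancel at parameters that differ by a full turn, so the increment over a
turn is the class of the whole curve, wherever it starts. -/
theorem IsPotential.period {p : ℝ → ChainClass S} (hp : IsPotential D.realCurve p) (t : ℝ) :
    p (t + 1) = p t + (p 1 - p 0) := by
  obtain ⟨V, hV⟩ := hp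
  have h1 : pieceClass D.realCurve (0 + 1) (t + 1) = pieceClass D.realCurve 0 t := by
    refine pathClass_congr fun s _ => ?_
    simp only [segPath, KnotDiagram.realCurve, ContinuousMap.comp_apply, ContinuousMap.coe_mk,
      smul_eq_mul]
    have : (1 - s) * (0 + 1) + s * (t + 1) = ((1 - s) * 0 + s * t) + 1 := by ring
    rw [this]
    simp
  have h2 : D.realCurve (t + 1) = D.realCurve t := by simp [KnotDiagram.realCurve_apply]
  have h3 : D.realCurve 1 = D.realCurve 0 := by
    rw [KnotDiagram.realCurve_apply, KnotDiagram.realCurve_apply, AddCircle.coe_period]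
    rfl
  rw [hV, hV, zero_add, h2, h3] at h1
  linear_combination (norm := module) h1

/-- An arc that passes the base point is continued up to `lift b y + 1`; this is where the period in
`arcValue` comes from. -/
theorem IsPotential.chainClass_arcChain {p : ℝ → ChainClass S} {V : S → ChainClass S}
    (hV : ∀ a b, pieceClass D.realCurve a b =
      p b - p a + (V (D.realCurve b) - V (D.realCurve a))) (b : ℝ) (x y : UnitAddCircle) :
    chainClass (D.arcChain x y) = arcValue b p x y + (V (D.curve y) - V (D.curve x)) := by
  have hper := IsPotential.period ⟨V, hV⟩ (lift b y)
  have key := D.chainClass_arcChain (lift b x) y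
  rw [coe_lift] at key
  rw [key, hV, D.realCurve_apply, D.realCurve_apply, AddCircle.coe_add, coe_lift, add_arcLen]
  congr 1
  unfold arcValue
  rw [arcLen_eq b]
  split_ifs with h
  · rw [show lift b x + (lift b y - lift b x + 0) = lift b y by ring, add_zero]
  · rw [show lift b x + (lift b y - lift b x + 1) = lift b y + 1 by ring, hper]
    abel

namespace KnotDiagram.Arrow

/-- The corrections `V` cancel since the arc closes up at the crossing. For the middle region they
cancel between its two arcs, each of which ends at the crossing where the other begins. -/
theorem inclusion_outerClass {p : ℝ → ChainClass S} (hp : IsPotential D.realCurve p) (b : ℝ)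
    (c d : D.Arrow) : homologyInclusion S (c.outerClass d) =
      arcValue b p (c.outerStart d) (c.outerEnd d) := by
  obtain ⟨V, hV⟩ := hp
  rw [outerClass, homologyInclusion_cycleClass, IsPotential.chainClass_arcChain hV b,
    c.curve_outer d, sub_self, add_zero]

theorem inclusion_middleClass {p : ℝ → ChainClass S} (hp : IsPotential D.realCurve p) (b : ℝ)
    (c d : D.Arrow) : homologyInclusion S (c.middleClass d) =
      arcValue b p (c.outerEnd d) (d.outerStart c) +
        arcValue b p (d.outerEnd c) (c.outerStart d) := by
  obtain ⟨V, hV⟩ := hp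
  rw [middleClass, homologyInclusion_cycleClass, chainClass_add,
    IsPotential.chainClass_arcChain hV b, IsPotential.chainClass_arcChain hV b,
    c.curve_outer d, d.curve_outer c]
  abel

/-- The four ends of two arrows. -/
def ends (c d : D.Arrow) : Fin 4 → UnitAddCircle := ![c.tail, c.head, d.tail, d.head]

end KnotDiagram.Arrow

namespace KnotDiagram.Arrow

variable {D' : KnotDiagram S} {b b' : ℝ} {p p' : ℝ → ChainClass S} {c d : D.Arrow}
  {c' d' : D'.Arrow}

/-- Both notions are expressed by `InArc` among the four ends, hence by `inArc_iff` through
comparisons of lifts; the base points of the two diagrams may differ. -/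
theorem nonIntersecting_iff_of_sameOrder (h : SameOrder b b' p p' (ends c d) (ends c' d')) :
    (c.NonIntersecting d ↔ c'.NonIntersecting d') ∧ c.outerDir d = c'.outerDir d' ∧
      d.outerDir c = d'.outerDir c' := by
  have hlt := h.lt_iff
  have heq : c = d ↔ c' = d' := by
    have h1 := h.eq_iff 0 2
    have h2 := h.eq_iff 1 3
    simp only [ends, Matrix.cons_val] at h1 h2
    rw [Subtype.ext_iff, Prod.ext_iff, Subtype.ext_iff, Prod.ext_iff]
    exact and_congr h1 h2
  have key (i j k : Fin 4) : InArc (ends c d i) (ends c d j) (ends c d k) ↔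
      InArc (ends c' d' i) (ends c' d' j) (ends c' d' k) := by
    simp only [inArc_iff b (ends c d i), inArc_iff b' (ends c' d' i), hlt]
  have k012 := key 0 1 2
  have k013 := key 0 1 3
  have k230 := key 2 3 0
  have k231 := key 2 3 1
  simp only [ends, Matrix.cons_val] at k012 k013 k230 k231
  refine ⟨?_, by classical exact if_congr k012 rfl rfl,
    by classical exact if_congr k230 rfl rfl⟩
  simp only [NonIntersecting, ne_eq, heq, k012, k013, k230, k231]

/-- By injectivity of `homologyInclusion` the labels may be compared modulo boundaries, where each
is a sum of values of arcs between the four ends. -/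
theorem labelled_eq_of_sameOrder (hp : IsPotential D.realCurve p)
    (hp' : IsPotential D'.realCurve p') (hper : p 1 - p 0 = p' 1 - p' 0)
    (h : SameOrder b b' p p' (ends c d) (ends c' d')) : c.labelled d = c'.labelled d' := by
  obtain ⟨-, hcd, hdc⟩ := nonIntersecting_iff_of_sameOrder h
  have key (i j : Fin 4) : arcValue b p (ends c d i) (ends c d j) =
      arcValue b' p' (ends c' d' i) (ends c' d' j) := by
    simp only [arcValue, h.value, h.lt_iff, hper]
  have k01 := key 0 1
  have k10 := key 1 0
  have k23 := key 2 3
  have k32 := key 3 2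
  have k02 := key 0 2
  have k20 := key 2 0
  have k03 := key 0 3
  have k30 := key 3 0
  have k12 := key 1 2
  have k21 := key 2 1
  have k13 := key 1 3
  have k31 := key 3 1
  simp only [ends, Matrix.cons_val] at k01 k10 k23 k32 k02 k20 k03 k30 k12 k21 k13 k31
  have e1 : c.outerClass d = c'.outerClass d' := by
    apply homologyInclusion_injective
    rw [inclusion_outerClass hp b, inclusion_outerClass hp' b', outerStart, outerEnd, outerStart,
      outerEnd, hcd]
    cases c'.outerDir d' <;> assumption
  have e2 : d.outerClass c = d'.outerClass c' := by
    apply homologyInclusion_injective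
    rw [inclusion_outerClass hp b, inclusion_outerClass hp' b', outerStart, outerEnd, outerStart,
      outerEnd, hdc]
    cases d'.outerDir c' <;> assumption
  have e3 : c.middleClass d = c'.middleClass d' := by
    apply homologyInclusion_injective
    rw [inclusion_middleClass hp b, inclusion_middleClass hp' b']
    simp only [outerStart, outerEnd]
    rw [hcd, hdc]
    cases c'.outerDir d' <;> cases d'.outerDir c' <;> simp only [*]
  unfold labelled
  rw [e1, e2, e3, hcd, hdc]

end KnotDiagram.Arrow

end Labels

/-! ### Elements of the diagram group. -/

section Elements

variable {S : Type u} [TopologicalSpace S]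

/-- The element of `𝒜(S)` represented by a labelled diagram. -/
def toGroup (L : LabelledDiagram (H1 S)) : SurfaceGroup S :=
  QuotientAddGroup.mk (FreeAbelianGroup.of L)

/-- In the unordered encoding three families of relators cover the four combinations of directions,
`upUp` serving for two of them. -/
theorem toGroup_eq_zero (m : H1 S) (x y : H1 S × ArrowDir) (h : m = 0 ∨ x.1 = 0 ∨ y.1 = 0) :
    toGroup ⟨m, s(x, y)⟩ = 0 := by
  refine (QuotientAddGroup.eq_zero_iff _).2 (AddSubgroup.subset_closure ?_)
  obtain ⟨x, dx⟩ := x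
  obtain ⟨y, dy⟩ := y
  have h' : x = 0 ∨ m = 0 ∨ y = 0 := by tauto
  cases dx <;> cases dy
  · exact .downUp_zero x m y h'
  · rw [Sym2.eq_swap]
    exact .upUp_zero y m x (by tauto)
  · exact .upUp_zero x m y h'
  · exact .upDown_zero x m y h'

/-- The homology class with a given image in the chains modulo boundaries. -/
def homologyOf (q : ChainClass S) : H1 S := Function.invFun (homologyInclusion S) q

/-- Writing labels as `homologyOf` of an expression in the potential avoids showing separately that
this expression is the class of a cycle. -/
theorem homologyOf_inclusion (x : H1 S) : homologyOf (homologyInclusion S x) = x :=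
  Function.leftInverse_invFun (homologyInclusion_injective S) x

theorem homologyOf_zero : homologyOf (0 : ChainClass S) = 0 := by
  rw [← map_zero (homologyInclusion S), homologyOf_inclusion]

theorem sum_sym2_insert {α M : Type*} [DecidableEq α] [AddCommMonoid M] {s : Finset α} {a : α}
    (ha : a ∉ s) (f : Sym2 α → M) :
    ∑ q ∈ (insert a s).sym2, f q = f s(a, a) + ∑ b ∈ s, f s(a, b) + ∑ q ∈ s.sym2, f q := by
  rw [← Finset.cons_eq_insert a s ha, Finset.sym2_cons, Finset.sum_disjUnion, Finset.sum_map,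
    Finset.sum_cons]
  rfl

end Elements

/-! ### Contributions of pairs of arrows. -/

namespace KnotDiagram

section Terms

variable {S : Type u} [TopologicalSpace S] [ChartedSpace Plane S] (D : KnotDiagram S)

open Classical in
/-- The unsigned contribution of a pair of arrows, `0` if these intersect. -/
def arrowTerm (c d : UnitAddCircle × UnitAddCircle) : SurfaceGroup S :=
  if h : c ∈ D.crossings ∧ d ∈ D.crossings then
    if Arrow.NonIntersecting (⟨c, h.1⟩ : D.Arrow) ⟨d, h.2⟩ then
      toGroup (Arrow.labelled (⟨c, h.1⟩ : D.Arrow) ⟨d, h.2⟩) else 0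
  else 0

/-- The sign of a crossing. -/
def crossingSign (c : UnitAddCircle × UnitAddCircle) : ℤ :=
  SignType.sign (wedge (velocity D.curve c.1) (velocity D.curve c.2))

theorem arrowTerm_comm (c d : UnitAddCircle × UnitAddCircle) :
    D.arrowTerm c d = D.arrowTerm d c := by
  unfold arrowTerm
  by_cases h : c ∈ D.crossings ∧ d ∈ D.crossings
  · rw [dif_pos h, dif_pos h.symm, Arrow.labelled_comm]
    classical exact if_congr (Arrow.nonIntersecting_comm _ _) rfl rfl
  · rw [dif_neg h, dif_neg (fun h' => h h'.symm)]

theorem arrowTerm_self (c : UnitAddCircle × UnitAddCircle) : D.arrowTerm c c = 0 := by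
  unfold arrowTerm
  split_ifs with h h'
  · exact absurd rfl h'.1
  · rfl
  · rfl

/-- The signed contribution of a pair of arrows. -/
def signedTerm : Sym2 (UnitAddCircle × UnitAddCircle) → SurfaceGroup S :=
  Sym2.lift ⟨fun c d => (D.crossingSign c * D.crossingSign d) • D.arrowTerm c d, fun c d => by
    dsimp only
    rw [arrowTerm_comm, mul_comm]⟩

/-- The arrows of different diagrams have different types; pairs of points of the circle are an
index type common to all diagrams. -/
theorem phi_eq_sum : D.phi = ∑ q ∈ D.crossings.sym2, D.signedTerm q := by
  classical
  have h1 : D.crossings = Finset.univ.map (Function.Embedding.subtype (· ∈ D.crossings)) := by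
    ext c
    simp
  conv_rhs => rw [h1, Finset.sym2_map, Finset.sum_map]
  unfold phi
  refine Finset.sum_congr (by ext; simp) fun q _ => ?_
  induction q using Sym2.ind with
  | _ c d =>
    change (if c.NonIntersecting d then (c.sign * d.sign) • toGroup (c.labelled d) else 0) =
      (c.sign * d.sign) • D.arrowTerm c.1 d.1
    unfold arrowTerm
    rw [dif_pos ⟨c.2, d.2⟩]
    split_ifs
    · rfl
    · rw [smul_zero]

variable {D} {D' : KnotDiagram S}

theorem arrowTerm_eq_of_sameOrder {b b' : ℝ} {p p' : ℝ → ChainClass S}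
    (hp : IsPotential D.realCurve p) (hp' : IsPotential D'.realCurve p')
    (hper : p 1 - p 0 = p' 1 - p' 0) {c d c' d' : UnitAddCircle × UnitAddCircle}
    (hc : c ∈ D.crossings) (hd : d ∈ D.crossings) (hc' : c' ∈ D'.crossings)
    (hd' : d' ∈ D'.crossings)
    (h : SameOrder b b' p p' ![c.1, c.2, d.1, d.2] ![c'.1, c'.2, d'.1, d'.2]) :
    D.arrowTerm c d = D'.arrowTerm c' d' := by
  unfold arrowTerm
  rw [dif_pos ⟨hc, hd⟩, dif_pos ⟨hc', hd'⟩]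
  have h1 := (Arrow.nonIntersecting_iff_of_sameOrder (c := ⟨c, hc⟩) (d := ⟨d, hd⟩)
    (c' := ⟨c', hc'⟩) (d' := ⟨d', hd'⟩) h).1
  have h2 := Arrow.labelled_eq_of_sameOrder (c := ⟨c, hc⟩) (d := ⟨d, hd⟩)
    (c' := ⟨c', hc'⟩) (d' := ⟨d', hd'⟩) hp hp' hper h
  rw [h2]
  classical exact if_congr h1 rfl rfl

theorem labelled_eq_homologyOf {p : ℝ → ChainClass S} (hp : IsPotential D.realCurve p) (b : ℝ)
    (c d : D.Arrow) : c.labelled d =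
      ⟨homologyOf (arcValue b p (c.outerEnd d) (d.outerStart c) +
          arcValue b p (d.outerEnd c) (c.outerStart d)),
        s((homologyOf (arcValue b p (c.outerStart d) (c.outerEnd d)), c.outerDir d),
          (homologyOf (arcValue b p (d.outerStart c) (d.outerEnd c)), d.outerDir c))⟩ := by
  rw [← Arrow.inclusion_outerClass hp, ← Arrow.inclusion_outerClass hp,
    ← Arrow.inclusion_middleClass hp, homologyOf_inclusion, homologyOf_inclusion,
    homologyOf_inclusion]
  rfl

/-- The direction of an arrow from the start to the end of an arc, or the other way round. -/
def dirOf (forward : Bool) : ArrowDir := if forward then .tailToHead else .headToTail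

/-- The arrow between two parameters. -/
def arrowBetween (forward : Bool) (u v : ℝ) : UnitAddCircle × UnitAddCircle :=
  if forward then (u, v) else (v, u)

/-- The outer arcs run from `u` to `v` and from `w` to `t + 1`; the middle region consists of the
arcs from `v` to `w` and from `t` to `u`. -/
theorem arrowTerm_of_nested {p : ℝ → ChainClass S} (hp : IsPotential D.realCurve p) {t u v w : ℝ}
    (htu : t < u) (huv : u < v) (hvw : v < w) (hwt : w < t + 1) (f g : Bool)
    (hc : arrowBetween f u v ∈ D.crossings) (hd : arrowBetween g w t ∈ D.crossings) :
    D.arrowTerm (arrowBetween f u v) (arrowBetween g w t) =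
      toGroup ⟨homologyOf (p w - p v + (p u - p t)),
        s((homologyOf (p v - p u), dirOf f), (homologyOf (p (t + 1) - p w), dirOf g))⟩ := by
  have ht : lift t t = t := lift_coe ⟨le_rfl, by linarith⟩
  have hu : lift t u = u := lift_coe ⟨by linarith, by linarith⟩
  have hv : lift t v = v := lift_coe ⟨by linarith, by linarith⟩
  have hw : lift t w = w := lift_coe ⟨by linarith, by linarith⟩
  have htv := htu.trans huv
  have htw := htv.trans hvw
  have huw := huv.trans hvw
  have hne : arrowBetween f u v ≠ arrowBetween g w t := by
    intro h
    have hut : (u : UnitAddCircle) ≠ t := by rw [ne_eq, ← lift_inj (b := t), ht, hu]; exact htu.ne'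
    have huw' : (u : UnitAddCircle) ≠ w := by rw [ne_eq, ← lift_inj (b := t), hw, hu]; exact huw.ne
    cases f <;> cases g <;> simp [arrowBetween, Prod.ext_iff, hut, huw'] at h
  rw [hp.period t]
  unfold arrowTerm
  rw [dif_pos ⟨hc, hd⟩, if_pos, labelled_eq_homologyOf hp t]
  · cases f <;> cases g <;>
    simp [arrowBetween, dirOf, Arrow.outerStart, Arrow.outerEnd, Arrow.outerDir, Arrow.tail,
      Arrow.head, inArc_iff t, arcValue, ht, hu, hv, hw, htu, huv, hvw, htv, htw, huw, htu.not_gt,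
      huv.not_gt, hvw.not_gt, htv.not_gt, htw.not_gt, huw.not_gt, add_sub_right_comm]
  · refine ⟨fun h => hne (congrArg Subtype.val h), ?_⟩
    cases f <;> cases g <;>
    simp [arrowBetween, Arrow.tail,
      Arrow.head, inArc_iff t, ht, hu, hv, hw, htu, huv, hvw, htv, htw, huw, htu.not_gt,
      huv.not_gt, hvw.not_gt, htv.not_gt, htw.not_gt, huw.not_gt]

/-- The ends alternate, so exactly one end of the second arrow lies in the arc cut off by the first.
-/
theorem arrowTerm_of_crossing {t u v w : ℝ}
    (htu : t < u) (huv : u < v) (hvw : v < w) (hwt : w < t + 1) (f g : Bool) :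
    D.arrowTerm (arrowBetween f t v) (arrowBetween g u w) = 0 := by
  have ht : lift t t = t := lift_coe ⟨le_rfl, by linarith⟩
  have hu : lift t u = u := lift_coe ⟨by linarith, by linarith⟩
  have hv : lift t v = v := lift_coe ⟨by linarith, by linarith⟩
  have hw : lift t w = w := lift_coe ⟨by linarith, by linarith⟩
  have htv := htu.trans huv
  have htw := htv.trans hvw
  unfold arrowTerm
  split_ifs with h1 h2
  · exfalso
    have h3 := h2.2.1
    revert h3
    cases f <;> cases g <;>
    simp [arrowBetween, Arrow.tail,
      Arrow.head, inArc_iff t, ht, hu, hv, hw, htu, huv, hvw, htv, htw, htu.not_gt,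
      huv.not_gt, hvw.not_gt, htv.not_gt, htw.not_gt]
  · rfl
  · rfl

/-- An arrow whose ends cut off an arc on which the potential does not change and on which there is
no end of another arrow. -/
theorem arrowTerm_eq_zero_of_isolated {p : ℝ → ChainClass S} (hp : IsPotential D.realCurve p)
    {b l r : ℝ} {c d : UnitAddCircle × UnitAddCircle} (h1 : lift b c.1 ∈ Set.Icc l r)
    (h2 : lift b c.2 ∈ Set.Icc l r) (hc : p (lift b c.1) = p (lift b c.2))
    (hd : lift b d.1 ∉ Set.Icc l r) : D.arrowTerm c d = 0 := by
  unfold arrowTerm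
  split_ifs with h h'
  · rw [labelled_eq_homologyOf hp b]
    refine toGroup_eq_zero _ _ _ (Or.inr (Or.inl ?_))
    rw [← homologyOf_zero]
    dsimp only
    congr 1
    have hne : lift b c.1 ≠ lift b c.2 := fun h'' =>
      (D.double_point c h.1).1 (lift_inj.1 h'')
    simp only [Set.mem_Icc, not_and_or, not_le] at h1 h2 hd
    -- Whichever end of `c` comes first, the arc on the side away from `d` is the short one inside
    -- `[l, r]`, which does not pass the base point.
    rcases lt_or_gt_of_ne hne with hlt | hlt
    · have : ¬ (lift b c.1 < lift b d.1 ∧ lift b d.1 < lift b c.2) := by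
        rcases hd with hd | hd <;> intro h3 <;> linarith [h3.1, h3.2]
      simp only [Arrow.outerStart, Arrow.outerEnd, Arrow.outerDir, Arrow.tail, Arrow.head,
        inArc_iff b, hlt, this, arcValue, if_true, if_false, hc]
      simp
    · have : lift b c.1 < lift b d.1 ∨ lift b d.1 < lift b c.2 := by
        rcases hd with hd | hd
        · right; linarith
        · left; linarith
      simp only [Arrow.outerStart, Arrow.outerEnd, Arrow.outerDir, Arrow.tail, Arrow.head,
        inArc_iff b, hlt, hlt.not_gt, this, arcValue, if_true, if_false, hc]
      simp
  · rfl
  · rfl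

end Terms

end KnotDiagram

/-! ### Crossing signs under changes of charts and under isotopies. -/

section Charts

theorem wedge_map (A : Plane →L[ℝ] Plane) (v w : Plane) :
    wedge (A v) (A w) = A.det * wedge v w := by
  let B := (EuclideanSpace.basisFun (Fin 2) ℝ).toBasis
  have hdet : A.det = (LinearMap.toMatrix B B A).det := (LinearMap.det_toMatrix B A.toLinearMap).symm
  have hA (v : Plane) (i : Fin 2) : A v i = ∑ j, LinearMap.toMatrix B B A i j * v j := by
    have := congrFun (LinearMap.toMatrix_mulVec_repr B B A.toLinearMap v) i
    simpa [B, Matrix.mulVec, dotProduct] using this.symm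
  rw [hdet, Matrix.det_fin_two]
  simp only [wedge, hA, Fin.sum_univ_two]
  ring

theorem wedge_smul (a b : ℝ) (v w : Plane) : wedge (a • v) (b • w) = a * b * wedge v w := by
  simp [wedge]
  ring

variable {S : Type u} [TopologicalSpace S] [ChartedSpace Plane S]

/-- A map of the surface in terms of two charts. -/
def chartMap (e e' : OpenPartialHomeomorph S Plane) (Φ : S → S) (y : Plane) : Plane :=
  e' (Φ (e.symm y))

variable {e e' e'' : OpenPartialHomeomorph S Plane} {Φ Ψ : S → S}

theorem differentiableAt_chart_curve {γ : ℝ → S} {t : ℝ}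
    (he : e ∈ IsManifold.maximalAtlas (𝓡 2) ∞ S)
    (hγ : ContMDiffAt 𝓘(ℝ, ℝ) (𝓡 2) ∞ γ t) (ht : γ t ∈ e.source) :
    DifferentiableAt ℝ (fun t => e (γ t)) t :=
  (contMDiffAt_iff_contDiffAt.1
    ((contMDiffAt_of_mem_maximalAtlas he ht).comp t hγ)).differentiableAt (by simp)

theorem differentiableAt_chartMap (he : e ∈ IsManifold.maximalAtlas (𝓡 2) ∞ S)
    (he' : e' ∈ IsManifold.maximalAtlas (𝓡 2) ∞ S) (hΦ : ContMDiff (𝓡 2) (𝓡 2) ∞ Φ) {y : Plane}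
    (hy : y ∈ e.target) (hy' : Φ (e.symm y) ∈ e'.source) :
    DifferentiableAt ℝ (chartMap e e' Φ) y := by
  have h1 : ContMDiffAt (𝓡 2) (𝓡 2) ∞ e.symm y := contMDiffAt_symm_of_mem_maximalAtlas he hy
  have h2 := contMDiffAt_of_mem_maximalAtlas he' hy'
  exact (contMDiffAt_iff_contDiffAt.1
    (h2.comp y ((hΦ _).comp y h1))).differentiableAt (by simp)

theorem fderiv_chartMap_comp (he : e ∈ IsManifold.maximalAtlas (𝓡 2) ∞ S)
    (he' : e' ∈ IsManifold.maximalAtlas (𝓡 2) ∞ S) (he'' : e'' ∈ IsManifold.maximalAtlas (𝓡 2) ∞ S)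
    (hΦ : ContMDiff (𝓡 2) (𝓡 2) ∞ Φ) (hΨ : ContMDiff (𝓡 2) (𝓡 2) ∞ Ψ) {y : Plane}
    (hy : y ∈ e.target) (hy' : Φ (e.symm y) ∈ e'.source) (hy'' : Ψ (Φ (e.symm y)) ∈ e''.source) :
    fderiv ℝ (chartMap e e'' (Ψ ∘ Φ)) y =
      (fderiv ℝ (chartMap e' e'' Ψ) (e' (Φ (e.symm y)))).comp (fderiv ℝ (chartMap e e' Φ) y) := by
  have h1 := differentiableAt_chartMap he he' hΦ hy hy'
  have h2 := differentiableAt_chartMap he' he'' hΨ (e'.map_source hy')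
    (by rwa [e'.left_inv hy'])
  have h3 : chartMap e e'' (Ψ ∘ Φ) =ᶠ[nhds y] chartMap e' e'' Ψ ∘ chartMap e e' Φ := by
    have hc : ContinuousAt (fun y => Φ (e.symm y)) y :=
      hΦ.continuous.continuousAt.comp (e.continuousAt_symm hy)
    filter_upwards [hc.preimage_mem_nhds (e'.open_source.mem_nhds hy')] with z hz
    simp only [chartMap, Function.comp_apply]
    rw [e'.left_inv hz]
  rw [h3.fderiv_eq]
  exact fderiv_comp y h2 h1

theorem deriv_chartMap_curve {γ : ℝ → S} {t : ℝ} (he : e ∈ IsManifold.maximalAtlas (𝓡 2) ∞ S)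
    (he' : e' ∈ IsManifold.maximalAtlas (𝓡 2) ∞ S) (hΦ : ContMDiff (𝓡 2) (𝓡 2) ∞ Φ)
    (hγ : ContMDiffAt 𝓘(ℝ, ℝ) (𝓡 2) ∞ γ t) (ht : γ t ∈ e.source) (ht' : Φ (γ t) ∈ e'.source) :
    deriv (fun t => e' (Φ (γ t))) t =
      fderiv ℝ (chartMap e e' Φ) (e (γ t)) (deriv (fun t => e (γ t)) t) := by
  have h1 := differentiableAt_chart_curve he hγ ht
  have h2 := differentiableAt_chartMap he he' hΦ (e.map_source ht) (by rwa [e.left_inv ht])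
  have h3 : (fun t => e' (Φ (γ t))) =ᶠ[nhds t] chartMap e e' Φ ∘ fun t => e (γ t) := by
    filter_upwards [hγ.continuousAt.preimage_mem_nhds (e.open_source.mem_nhds ht)] with z hz
    simp only [chartMap, Function.comp_apply]
    rw [e.left_inv hz]
  rw [h3.deriv_eq, fderiv_comp_deriv t h2 h1]

namespace KnotDiagram

theorem smooth_shift (D : KnotDiagram S) (x : UnitAddCircle) :
    ContMDiff 𝓘(ℝ, ℝ) (𝓡 2) ∞ (fun t : ℝ => D.curve (x + (t : UnitAddCircle))) := by
  obtain ⟨u, rfl⟩ := QuotientAddGroup.mk_surjective x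
  have h : ContMDiff 𝓘(ℝ, ℝ) 𝓘(ℝ, ℝ) ∞ (fun t : ℝ => u + t) :=
    (contDiff_const.add contDiff_id).contMDiff
  exact D.smooth.comp h

/-- The velocity of a diagram in a chart. -/
def chartVelocity (D : KnotDiagram S) (e : OpenPartialHomeomorph S Plane) (x : UnitAddCircle) :
    Plane :=
  deriv (fun t : ℝ => e (D.curve (x + (t : UnitAddCircle)))) 0

variable [IsManifold (𝓡 2) ∞ S]

theorem velocity_eq_fderiv (D : KnotDiagram S) (he : e ∈ IsManifold.maximalAtlas (𝓡 2) ∞ S)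
    {x : UnitAddCircle} (hx : D.curve x ∈ e.source) :
    velocity D.curve x =
      fderiv ℝ (e.symm.trans (chartAt Plane (D.curve x))) (e (D.curve x)) (D.chartVelocity e x) := by
  have := deriv_chartMap_curve (γ := fun t : ℝ => D.curve (x + (t : UnitAddCircle))) (t := 0)
    (Φ := id) he (IsManifold.chart_mem_maximalAtlas (D.curve x)) contMDiff_id
    (D.smooth_shift x 0) (by simpa using hx) (by simp)
  simp only [AddCircle.coe_zero, add_zero, id] at this
  exact this

/-- The coordinate change to the preferred chart has positive Jacobian, so signs of crossings may be
computed in the chart of a move. -/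
theorem wedge_velocity (D : KnotDiagram S) (he : IsPositiveChart e) {x y : UnitAddCircle}
    (hxy : D.curve x = D.curve y) (hx : D.curve x ∈ e.source) :
    ∃ a : ℝ, 0 < a ∧ wedge (velocity D.curve x) (velocity D.curve y) =
      a * wedge (D.chartVelocity e x) (D.chartVelocity e y) := by
  refine ⟨(fderiv ℝ (e.symm.trans (chartAt Plane (D.curve x))) (e (D.curve x))).det,
    he.2 _ (chart_mem_atlas _ _) _ ?_, ?_⟩
  · rw [OpenPartialHomeomorph.trans_source]
    exact ⟨e.map_source hx, by simp [e.left_inv hx]⟩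
  · rw [D.velocity_eq_fderiv he.1 hx, D.velocity_eq_fderiv he.1 (hxy ▸ hx), ← hxy, wedge_map]

theorem crossingSign_eq_chart (D : KnotDiagram S) (he : IsPositiveChart e) {x y : UnitAddCircle}
    (hxy : D.curve x = D.curve y) (hx : D.curve x ∈ e.source) :
    D.crossingSign (x, y) = SignType.sign (wedge (D.chartVelocity e x) (D.chartVelocity e y)) := by
  obtain ⟨a, ha, h⟩ := D.wedge_velocity he hxy hx
  rw [crossingSign, h, sign_mul, sign_pos ha, one_mul]

end KnotDiagram

variable [IsManifold (𝓡 2) ∞ S] [OrientedAtlas S]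

/-- The Jacobian never vanishes because `F s` is invertible, its sign is locally constant in `s`,
and at `s = 0` it equals 1. The target chart varies with `s`, which is harmless for the sign because
the atlas is oriented. -/
theorem det_fderiv_isotopy_pos (F : ℝ → (S ≃ₘ^∞⟮𝓡 2, 𝓡 2⟯ S))
    (h0 : F 0 = Diffeomorph.refl (𝓡 2) S ∞)
    (hF : ContMDiff (𝓘(ℝ, ℝ).prod (𝓡 2)) (𝓡 2) ∞ (fun p : ℝ × S => F p.1 p.2)) (q : S) (s : ℝ) :
    0 < (fderiv ℝ (chartMap (chartAt Plane q) (chartAt Plane (F s q)) (F s))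
      (chartAt Plane q q)).det := by
  let c (p : S) := chartAt Plane p
  have hc (p : S) : c p ∈ IsManifold.maximalAtlas (𝓡 2) ∞ S := IsManifold.chart_mem_maximalAtlas p
  have hcs (p : S) : p ∈ (c p).source := mem_chart_source Plane p
  let y := c q q
  have hy : y ∈ (c q).target := (c q).map_source (hcs q)
  have hyq : (c q).symm y = q := (c q).left_inv (hcs q)
  let J (e : OpenPartialHomeomorph S Plane) (s : ℝ) : ℝ :=
    (fderiv ℝ (chartMap (c q) e (F s)) y).det
  have hid (p : S) : (fderiv ℝ (chartMap (c p) (c p) id) (c p p)).det = 1 := by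
    have : chartMap (c p) (c p) id =ᶠ[nhds (c p p)] id := by
      filter_upwards [(c p).open_target.mem_nhds ((c p).map_source (hcs p))] with z hz
      exact (c p).right_inv hz
    rw [this.fderiv_eq, fderiv_id]
    exact LinearMap.det_id
  have hne (s : ℝ) : J (c (F s q)) s ≠ 0 := by
    have h := fderiv_chartMap_comp (hc q) (hc (F s q)) (hc q) (F s).contMDiff (F s).symm.contMDiff
      hy (by rw [hyq]; exact hcs _) (by rw [hyq]; simpa using hcs q)
    have h2 : ⇑(F s).symm ∘ ⇑(F s) = id := by ext; simp
    have h3 := congrArg ContinuousLinearMap.det h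
    rw [h2, hid] at h3
    intro h4
    have h5 : (1 : ℝ) = _ * J (c (F s q)) s := h3.trans (LinearMap.det_comp _ _)
    rw [h4, mul_zero] at h5
    exact one_ne_zero h5
  -- Continuity is checked in the fixed chart at `F s₀ q`, where the derivative in the space
  -- variable is a restriction of the derivative of the jointly smooth map `g`.
  have hcont (s₀ : ℝ) : ContinuousAt (J (c (F s₀ q))) s₀ := by
    let g : ℝ × Plane → Plane := fun z => chartMap (c q) (c (F s₀ q)) (F z.1) z.2
    have hg : ContDiffAt ℝ ∞ g (s₀, y) := by
      rw [← contMDiffAt_iff_contDiffAt]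
      have h1 : ContMDiffAt 𝓘(ℝ, ℝ × Plane) 𝓘(ℝ, ℝ) ∞ (fun z : ℝ × Plane => z.1) (s₀, y) :=
        contDiffAt_fst.contMDiffAt
      have h2 : ContMDiffAt 𝓘(ℝ, ℝ × Plane) (𝓡 2) ∞ (fun z : ℝ × Plane => z.2) (s₀, y) :=
        contDiffAt_snd.contMDiffAt
      have h3 : ContMDiffAt 𝓘(ℝ, ℝ × Plane) (𝓡 2) ∞
          (fun z : ℝ × Plane => (c q).symm z.2) (s₀, y) :=
        (contMDiffAt_symm_of_mem_maximalAtlas (hc q) hy).comp (s₀, y) h2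
      have h4 := (hF (s₀, (c q).symm y)).comp (s₀, y) (h1.prodMk h3)
      refine (contMDiffAt_of_mem_maximalAtlas (hc (F s₀ q)) ?_).comp (s₀, y) h4
      simp only [hyq]
      exact hcs _
    have hf : ContinuousAt (fun s => (fderiv ℝ g (s, y)).comp (ContinuousLinearMap.inr ℝ ℝ Plane))
        s₀ := by
      have h1 : ContinuousAt (fderiv ℝ g) (s₀, y) :=
        (hg.fderiv_right (m := ∞) (by simp)).continuousAt
      have h2 : ContinuousAt (fun s : ℝ => fderiv ℝ g (s, y)) s₀ :=
        ContinuousAt.comp (f := fun s : ℝ => (s, y)) h1 (by fun_prop)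
      exact h2.clm_comp continuousAt_const
    have hev : ∀ᶠ s in nhds s₀, J (c (F s₀ q)) s =
        ((fderiv ℝ g (s, y)).comp (ContinuousLinearMap.inr ℝ ℝ Plane)).det := by
      have h1 : ∀ᶠ z in nhds (s₀, y), DifferentiableAt ℝ g z :=
        (hg.of_le (m := 1) (by simp)).eventually (by simp) |>.mono
          fun z hz => hz.differentiableAt (by simp)
      have h2 : ContinuousAt (fun s : ℝ => (s, y)) s₀ := by fun_prop
      filter_upwards [h2.eventually h1] with s hs
      have h3 : HasFDerivAt (fun z : Plane => (s, z)) (ContinuousLinearMap.inr ℝ ℝ Plane) y :=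
        hasFDerivAt_prodMk_right s y
      have h4 := HasFDerivAt.comp y (f := fun z : Plane => (s, z)) hs.hasFDerivAt h3
      change (fderiv ℝ (g ∘ fun z => (s, z)) y).det = _
      rw [h4.fderiv]
    refine ContinuousAt.congr ?_ (hev.mono fun s hs => hs.symm)
    exact ContinuousLinearMap.continuous_det.continuousAt.comp hf
  have hconst : IsLocallyConstant fun s => SignType.sign (J (c (F s q)) s) := by
    rw [IsLocallyConstant.iff_eventually_eq]
    intro s₀
    have h1 : ∀ᶠ s in nhds s₀, F s q ∈ (c (F s₀ q)).source := by
      have : Continuous fun s : ℝ => F s q := hF.continuous.comp (continuous_id.prodMk continuous_const)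
      exact this.continuousAt.preimage_mem_nhds ((c (F s₀ q)).open_source.mem_nhds (hcs _))
    have h2 : ∀ᶠ s in nhds s₀, SignType.sign (J (c (F s₀ q)) s) =
        SignType.sign (J (c (F s₀ q)) s₀) := by
      rcases lt_or_gt_of_ne (hne s₀) with h | h
      · filter_upwards [(hcont s₀).eventually (gt_mem_nhds h)] with s hs
        rw [sign_neg h, sign_neg hs]
      · filter_upwards [(hcont s₀).eventually (lt_mem_nhds h)] with s hs
        rw [sign_pos h, sign_pos hs]
    filter_upwards [h1, h2] with s hs hs2
    rw [← hs2]
    -- Back from the fixed chart to the chart at `F s q`: the two Jacobians differ by a positive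
    -- factor.
    have h := fderiv_chartMap_comp (Ψ := id) (hc q) (hc (F s q)) (hc (F s₀ q)) (F s).contMDiff
      contMDiff_id hy (by rw [hyq]; exact hcs _) (by rw [hyq]; exact hs)
    have h3 := congrArg ContinuousLinearMap.det h
    have h5 : J (c (F s₀ q)) s = _ * J (c (F s q)) s := h3.trans (LinearMap.det_comp _ _)
    have hpos : 0 < (fderiv ℝ (chartMap (c (F s q)) (c (F s₀ q)) id) (c (F s q) (F s q))).det := by
      refine OrientedAtlas.jacobian_pos (c (F s q)) (chart_mem_atlas _ _) (c (F s₀ q))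
        (chart_mem_atlas _ _) _ ?_
      rw [OpenPartialHomeomorph.trans_source]
      exact ⟨(c (F s q)).map_source (hcs _), by simpa [(c (F s q)).left_inv (hcs _)] using hs⟩
    rw [hyq] at h5
    rw [h5, sign_mul]
    erw [sign_pos hpos]
    rw [one_mul]
  have h1 : SignType.sign (J (c (F s q)) s) = SignType.sign (J (c (F 0 q)) 0) :=
    hconst.apply_eq_of_isPreconnected isPreconnected_univ trivial trivial
  have h2 : J (c (F 0 q)) 0 = 1 := by
    simp only [J, h0]
    exact hid q
  rw [h2, sign_one] at h1
  exact sign_eq_one_iff.1 h1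

end Charts

/-! ### Invariance under isotopy and reparametrization. -/

section Isotopy

variable {S : Type u} [TopologicalSpace S] [ChartedSpace Plane S] {D D' : KnotDiagram S}

/-- The track of a point under the ambient isotopy depends on that point only, so its class can be
added to the correction `V`. -/
theorem isPotential_isotopy {F : ℝ → (S ≃ₘ^∞⟮𝓡 2, 𝓡 2⟯ S)} {h : C(ℝ, ℝ)}
    (h0 : F 0 = Diffeomorph.refl (𝓡 2) S ∞) (hF : Continuous fun p : ℝ × S => F p.1 p.2)
    (hcurve : ∀ t : ℝ, D'.curve (t : UnitAddCircle) = F 1 (D.curve (h t : UnitAddCircle)))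
    {p : ℝ → ChainClass S} (hp : IsPotential D.realCurve p) :
    IsPotential D'.realCurve (fun t => p (h t)) := by
  obtain ⟨V, hV⟩ := hp
  let track (z : S) : ChainClass S :=
    pathClass ⟨fun s => F s z, hF.comp (continuous_id.prodMk continuous_const)⟩
  refine ⟨fun w => V ((F 1).symm w) + track ((F 1).symm w), fun a b => ?_⟩
  let G : C(ℝ × ℝ, S) := ⟨fun q => F q.1 (D.realCurve (h q.2)),
    hF.comp (continuous_fst.prodMk (D.realCurve.continuous.comp (h.continuous.comp continuous_snd)))⟩
  have hG0 (t : ℝ) : G (0, t) = (D.realCurve.comp h) t := by simp [G, h0]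
  have hG1 (t : ℝ) : G (1, t) = D'.realCurve t := (hcurve t).symm
  have htr (t : ℝ) : pathClass (segPath G (0, t) (1, t)) = track (D.realCurve (h t)) :=
    pathClass_congr fun s _ => by simp [segPath, G, ← add_mul]
  have hs (t : ℝ) : (F 1).symm (D'.realCurve t) = D.realCurve (h t) := by
    rw [← hG1]
    exact (F 1).symm_apply_apply _
  have key := pieceClass_add_track G hG0 hG1 a b
  rw [htr, htr, pieceClass_comp, hV] at key
  dsimp only
  rw [hs, hs]
  linear_combination (norm := module) -key

variable [IsManifold (𝓡 2) ∞ S]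

theorem velocity_isotopy {Φ : S → S} {h : ℝ → ℝ} (hΦ : ContMDiff (𝓡 2) (𝓡 2) ∞ Φ)
    (hh : ContDiff ℝ ∞ h)
    (hcurve : ∀ t : ℝ, D'.curve (t : UnitAddCircle) = Φ (D.curve (h t : UnitAddCircle))) {q : S}
    {s : ℝ} (hq : D.curve (h s : UnitAddCircle) = q) :
    velocity D'.curve (s : UnitAddCircle) = deriv h s •
      fderiv ℝ (chartMap (chartAt Plane q) (chartAt Plane (Φ q)) Φ) (chartAt Plane q q)
        (velocity D.curve (h s : UnitAddCircle)) := by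
  subst hq
  have hshift : ContDiff ℝ ∞ fun τ : ℝ => h (s + τ) := hh.comp (contDiff_const.add contDiff_id)
  have hsm : ContMDiffAt 𝓘(ℝ, ℝ) (𝓡 2) ∞
      (fun τ : ℝ => D.curve ((h (s + τ) : ℝ) : UnitAddCircle)) 0 :=
    (D.smooth.comp hshift.contMDiff) 0
  have h1 := deriv_chartMap_curve (Φ := Φ)
    (e := chartAt Plane (D.curve (h s : UnitAddCircle)))
    (e' := chartAt Plane (Φ (D.curve (h s : UnitAddCircle)))) (t := 0)
    (IsManifold.chart_mem_maximalAtlas _) (IsManifold.chart_mem_maximalAtlas _) hΦ hsm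
    (by simp) (by simp)
  have h2 : deriv (fun τ : ℝ => chartAt Plane (D.curve (h s : UnitAddCircle))
      (D.curve ((h (s + τ) : ℝ) : UnitAddCircle))) 0 =
      deriv h s • velocity D.curve (h s : UnitAddCircle) := by
    have hd : HasDerivAt (fun τ => h (s + τ) - h s) (deriv h s) 0 := by
      have h4 : HasDerivAt h (deriv h s) (s + 0) := by
        rw [add_zero]
        exact ((hh.differentiable (by simp)) s).hasDerivAt
      exact (h4.comp_const_add s 0).sub_const _
    have h3 : DifferentiableAt ℝ (fun t : ℝ => chartAt Plane (D.curve (h s : UnitAddCircle))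
        (D.curve ((h s : UnitAddCircle) + (t : UnitAddCircle)))) (h (s + 0) - h s) := by
      rw [add_zero, sub_self]
      exact differentiableAt_chart_curve (IsManifold.chart_mem_maximalAtlas _)
        (D.smooth_shift _ 0) (by simp)
    have h5 := h3.hasDerivAt.scomp 0 hd
    rw [add_zero, sub_self] at h5
    have h6 := h5.deriv
    rw [velocity, ← h6]
    congr 1
    funext τ
    simp only [Function.comp_apply]
    rw [← AddCircle.coe_add]
    congr 3
    ring
  rw [h2, map_smul, add_zero] at h1
  rw [← h1, velocity, hcurve]
  congr 1
  funext τ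
  rw [← AddCircle.coe_add, hcurve]

variable [OrientedAtlas S]

/-- The circle map `θ` induced by `h` carries the crossings of `D'` bijectively to those of `D`.
Measured from the base points `0` and `h 0` it preserves the order of lifts. Signs persist because
`deriv h` and the Jacobian of the final diffeomorphism are positive. -/
theorem phi_eq_of_isotopyMove (hmove : IsotopyMove D D') : D.phi = D'.phi := by
  obtain ⟨F, h, hF0, hF, hh, hpos, hper, hcurve, hcross⟩ := hmove
  have hcont : Continuous h := hh.continuous
  have hmono : StrictMono h := strictMono_of_deriv_pos hpos
  have hperiodic : Function.Periodic (fun t => (h t : UnitAddCircle)) 1 := fun t => by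
    simp [hper]
  let θ : UnitAddCircle → UnitAddCircle := hperiodic.lift
  have hθ (t : ℝ) : θ (t : UnitAddCircle) = (h t : UnitAddCircle) := hperiodic.lift_coe t
  have h1 : h 1 = h 0 + 1 := by rw [← hper, zero_add]
  have hlift (x : UnitAddCircle) : lift (h 0) (θ x) = h (lift 0 x) := by
    have hx := lift_mem 0 x
    conv_lhs => rw [← coe_lift 0 x, hθ]
    refine lift_coe ⟨hmono.monotone hx.1, ?_⟩
    rw [← h1]
    exact hmono (by linarith [hx.2])
  have hinj : Function.Injective θ := fun x y hxy => by
    rw [← lift_inj (b := h 0), hlift, hlift] at hxy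
    exact lift_inj.1 (hmono.injective hxy)
  have hsurj (y : UnitAddCircle) : ∃ x, θ x = y := by
    have hy := lift_mem (h 0) y
    rw [← h1] at hy
    obtain ⟨t, -, ht⟩ := intermediate_value_Ico zero_le_one hcont.continuousOn hy
    exact ⟨t, by rw [hθ, ht, coe_lift]⟩
  let θ2 : UnitAddCircle × UnitAddCircle ↪ UnitAddCircle × UnitAddCircle :=
    ⟨Prod.map θ θ, hinj.prodMap hinj⟩
  have hcr (x y : UnitAddCircle) : (x, y) ∈ D'.crossings ↔ (θ x, θ y) ∈ D.crossings := by
    rw [← coe_lift 0 x, ← coe_lift 0 y, hθ, hθ]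
    exact hcross _ _
  have hset : D.crossings = D'.crossings.map θ2 := by
    ext ⟨x, y⟩
    obtain ⟨x, rfl⟩ := hsurj x
    obtain ⟨y, rfl⟩ := hsurj y
    rw [← hcr]
    exact (Finset.mem_map' θ2 (a := (x, y))).symm
  let hC : C(ℝ, ℝ) := ⟨h, hcont⟩
  have hp := isPotential_pieceClass D.realCurve
  set p := pieceClass D.realCurve 0
  have hp' : IsPotential D'.realCurve (fun t => p (h t)) :=
    isPotential_isotopy (h := hC) hF0 hF.continuous hcurve hp
  have hterm {c d : UnitAddCircle × UnitAddCircle} (hc : c ∈ D'.crossings)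
      (hd : d ∈ D'.crossings) : D.arrowTerm (θ2 c) (θ2 d) = D'.arrowTerm c d := by
    have hlt (x y : UnitAddCircle) :
        lift (h 0) (θ x) < lift (h 0) (θ y) ↔ lift 0 x < lift 0 y := by
      rw [hlift, hlift, hmono.lt_iff_lt]
    refine KnotDiagram.arrowTerm_eq_of_sameOrder (b := h 0) (b' := 0) hp hp' ?_
      ((hcr c.1 c.2).1 hc) ((hcr d.1 d.2).1 hd) hc hd ⟨fun i j => ?_, fun i => ?_⟩
    · rw [h1, hp.period]
      abel
    · fin_cases i <;> fin_cases j <;> exact hlt _ _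
    · fin_cases i <;> exact congrArg p (hlift _)
  have hsign {c : UnitAddCircle × UnitAddCircle} (hc : c ∈ D'.crossings) :
      D.crossingSign (θ2 c) = D'.crossingSign c := by
    obtain ⟨x, y⟩ := c
    obtain ⟨s, rfl⟩ := QuotientAddGroup.mk_surjective x
    obtain ⟨t, rfl⟩ := QuotientAddGroup.mk_surjective y
    have hst := (D.double_point _ ((hcr _ _).1 hc)).2
    simp only [hθ] at hst
    have hdet := det_fderiv_isotopy_pos F hF0 hF (D.curve (h s : UnitAddCircle)) 1
    change ((SignType.sign (wedge (velocity D.curve (θ s)) (velocity D.curve (θ t))) : SignType) :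
      ℤ) = (SignType.sign (wedge (velocity D'.curve (s : UnitAddCircle))
        (velocity D'.curve (t : UnitAddCircle))) : SignType)
    rw [velocity_isotopy (F 1).contMDiff hh hcurve rfl,
      velocity_isotopy (F 1).contMDiff hh hcurve hst.symm, wedge_smul, wedge_map, sign_mul,
      sign_mul, sign_mul, sign_pos (hpos s), sign_pos (hpos t), sign_pos hdet, one_mul, one_mul,
      one_mul, hθ, hθ]
  rw [KnotDiagram.phi_eq_sum, KnotDiagram.phi_eq_sum, hset, Finset.sym2_map, Finset.sum_map]
  refine Finset.sum_congr rfl fun q hq => ?_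
  induction q using Sym2.ind with
  | _ c d =>
    rw [Finset.mk_mem_sym2_iff] at hq
    change (D.crossingSign (θ2 c) * D.crossingSign (θ2 d)) • D.arrowTerm (θ2 c) (θ2 d) =
      (D'.crossingSign c * D'.crossingSign d) • D'.arrowTerm c d
    rw [hterm hq.1 hq.2, hsign hq.1, hsign hq.2]

end Isotopy

/-! ### Disjoint arcs of the circle and sliding of points along them. -/

section Arcs

theorem mem_circleArc (x : UnitAddCircle) (r : ℝ) {t : ℝ} (ht : t ∈ Set.Icc (-1 : ℝ) 1) :
    x + ((r * t : ℝ) : UnitAddCircle) ∈ circleArc x r :=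
  ⟨t, ht, rfl⟩

theorem isClosed_circleArc (x : UnitAddCircle) (r : ℝ) : IsClosed (circleArc x r) := by
  refine (isCompact_Icc.image ?_).isClosed
  exact continuous_const.add ((AddCircle.continuous_mk' 1).comp (by fun_prop))

theorem coe_mem_circleArc {x : UnitAddCircle} {r X u : ℝ} (hr : 0 < r) (hX : (X : UnitAddCircle) = x)
    (hu : u ∈ Set.Icc (X - r) (X + r)) : (u : UnitAddCircle) ∈ circleArc x r := by
  refine ⟨(u - X) / r, ⟨?_, ?_⟩, ?_⟩
  · rw [le_div_iff₀ hr]; linarith [hu.1]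
  · rw [div_le_iff₀ hr]; linarith [hu.2]
  · dsimp only
    rw [← hX, mul_div_cancel₀ _ hr.ne', ← AddCircle.coe_add, add_sub_cancel]

/-- Lifts of arcs of the circle to intervals in `(b, b + 1)`. -/
structure ArcLifts {k : ℕ} (b : ℝ) (x : Fin k → UnitAddCircle) (r X : Fin k → ℝ) : Prop where
  pos : ∀ i, 0 < r i
  coe : ∀ i, (X i : UnitAddCircle) = x i
  left : ∀ i, b < X i - r i
  right : ∀ i, X i + r i < b + 1

section ArcLifts

variable {k : ℕ} {b : ℝ} {x : Fin k → UnitAddCircle} {r X : Fin k → ℝ}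

theorem ArcLifts.lift_eq (h : ArcLifts b x r X) (i : Fin k) {t : ℝ} (ht : t ∈ Set.Icc (-1 : ℝ) 1) :
    lift b (x i + ((r i * t : ℝ) : UnitAddCircle)) = X i + r i * t := by
  have h1 := h.left i
  have h2 := h.right i
  have h3 := h.pos i
  rw [← h.coe i, ← AddCircle.coe_add]
  refine lift_coe ⟨?_, ?_⟩ <;> nlinarith [ht.1, ht.2]

theorem ArcLifts.mem_iff (h : ArcLifts b x r X) (i : Fin k) (z : UnitAddCircle) :
    lift b z ∈ Set.Icc (X i - r i) (X i + r i) ↔ z ∈ circleArc (x i) (r i) := by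
  constructor
  · intro hz
    rw [← coe_lift b z]
    exact coe_mem_circleArc (h.pos i) (h.coe i) hz
  · rintro ⟨t, ht, rfl⟩
    dsimp only
    rw [h.lift_eq i ht]
    have h3 := h.pos i
    constructor <;> nlinarith [ht.1, ht.2]

theorem exists_arcLifts (hr : ∀ i, 0 < r i) (hb : ∀ i, (b : UnitAddCircle) ∉ circleArc (x i) (r i)) :
    ∃ X, ArcLifts b x r X := by
  refine ⟨fun i => lift b (x i), hr, fun i => coe_lift b _, fun i => ?_, fun i => ?_⟩
  · by_contra! h
    refine hb i (coe_mem_circleArc (hr i) (coe_lift b (x i)) ⟨h, ?_⟩)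
    linarith [(lift_mem b (x i)).1, hr i]
  · by_contra! h
    have h2 : ((b + 1 : ℝ) : UnitAddCircle) = b := by simp
    refine hb i (h2 ▸ coe_mem_circleArc (hr i) (coe_lift b (x i)) ⟨?_, h⟩)
    linarith [(lift_mem b (x i)).2, hr i]

/-- Otherwise the connected circle would be the union of two disjoint nonempty closed sets, arc `i`
and the other arcs. Two arcs are needed: a single one could cover the circle. -/
theorem exists_not_mem_circleArc {i j : Fin k} (hij : i ≠ j)
    (hdisj : ∀ i j, i ≠ j → Disjoint (circleArc (x i) (r i)) (circleArc (x j) (r j))) :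
    ∃ b : ℝ, ∀ i, (b : UnitAddCircle) ∉ circleArc (x i) (r i) := by
  by_contra! hcon
  have hne (i : Fin k) : x i ∈ circleArc (x i) (r i) := ⟨0, by simp, by simp⟩
  have hcl : IsClosed (⋃ l ∈ {l : Fin k | l ≠ i}, circleArc (x l) (r l)) :=
    (Set.toFinite _).isClosed_biUnion fun l _ => isClosed_circleArc _ _
  have hcover : Set.univ ⊆ circleArc (x i) (r i) ∪
      ⋃ l ∈ {l : Fin k | l ≠ i}, circleArc (x l) (r l) := by
    intro z _
    obtain ⟨u, rfl⟩ := QuotientAddGroup.mk_surjective z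
    obtain ⟨l, hl⟩ := hcon u
    by_cases h : l = i
    · exact Or.inl (h ▸ hl)
    · exact Or.inr (Set.mem_biUnion (s := {l | l ≠ i}) h hl)
  obtain ⟨z, -, hz, hz'⟩ := isPreconnected_closed_iff.1
    (isPreconnected_univ (α := UnitAddCircle)) _ _ (isClosed_circleArc (x i) (r i)) hcl
    hcover ⟨x i, trivial, hne i⟩
    ⟨x j, trivial, Set.mem_biUnion (s := {l | l ≠ i}) hij.symm (hne j)⟩
  simp only [Set.mem_iUnion] at hz'
  obtain ⟨l, hl, hz'⟩ := hz'
  exact Set.disjoint_left.1 (hdisj l i hl) hz' hz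

theorem lt_iff_of_mem_Icc {l h u u' v : ℝ} (hu : u ∈ Set.Icc l h) (hu' : u' ∈ Set.Icc l h)
    (hv : v ∉ Set.Icc l h) : (u < v ↔ u' < v) ∧ (v < u ↔ v < u') := by
  simp only [Set.mem_Icc, not_and_or, not_le] at hu hu' hv
  rcases hv with hv | hv
  · exact ⟨⟨fun h => by linarith, fun h => by linarith⟩,
      ⟨fun _ => by linarith, fun _ => by linarith⟩⟩
  · exact ⟨⟨fun _ => by linarith, fun _ => by linarith⟩,
      ⟨fun h => by linarith, fun h => by linarith⟩⟩

/-- Two points of the circle coincide outside the arcs, or lie on the same arc. -/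
def SameArc (x : Fin k → UnitAddCircle) (r : Fin k → ℝ) (z z' : UnitAddCircle) : Prop :=
  (z = z' ∧ ∀ i, z ∉ circleArc (x i) (r i)) ∨
    ∃ i, z ∈ circleArc (x i) (r i) ∧ z' ∈ circleArc (x i) (r i)

variable {S : Type u} [TopologicalSpace S]

/-- If no arc contains two of the points, each may slide along its arc without passing another; in a
comparison the two points are moved one at a time. -/
theorem ArcLifts.sameOrder (h : ArcLifts b x r X)
    (hdisj : ∀ i j, i ≠ j → Disjoint (circleArc (x i) (r i)) (circleArc (x j) (r j)))
    {p : ℝ → ChainClass S}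
    (hp : ∀ i, ∀ u ∈ Set.Icc (X i - r i) (X i + r i), ∀ v ∈ Set.Icc (X i - r i) (X i + r i),
      p u = p v)
    {n : ℕ} {z z' : Fin n → UnitAddCircle} (hz : ∀ a, SameArc x r (z a) (z' a))
    (hsep : ∀ a a', a ≠ a' → ∀ i,
      ¬ (z a ∈ circleArc (x i) (r i) ∧ z a' ∈ circleArc (x i) (r i))) :
    SameOrder b b p p z z' := by
  refine ⟨fun a a' => ?_, fun a => ?_⟩
  · by_cases haa : a = a'
    · subst haa
      simp
    have hsep' : ∀ i, z a ∈ circleArc (x i) (r i) → z' a' ∉ circleArc (x i) (r i) := by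
      intro i hi hi'
      rcases hz a' with ⟨h1, h2⟩ | ⟨j, h1, h2⟩
      · exact h2 i (h1 ▸ hi')
      · by_cases hji : j = i
        · exact hsep a a' haa i ⟨hi, hji ▸ h1⟩
        · exact Set.disjoint_left.1 (hdisj j i hji) h2 hi'
    have e1 : lift b (z a) < lift b (z a') ↔ lift b (z a) < lift b (z' a') := by
      rcases hz a' with ⟨h1, -⟩ | ⟨j, h1, h2⟩
      · rw [h1]
      · refine (lt_iff_of_mem_Icc ((h.mem_iff j _).2 h1) ((h.mem_iff j _).2 h2) ?_).2
        rw [h.mem_iff]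
        exact fun h3 => hsep a a' haa j ⟨h3, h1⟩
    have e2 : lift b (z a) < lift b (z' a') ↔ lift b (z' a) < lift b (z' a') := by
      rcases hz a with ⟨h1, -⟩ | ⟨j, h1, h2⟩
      · rw [h1]
      · refine (lt_iff_of_mem_Icc ((h.mem_iff j _).2 h1) ((h.mem_iff j _).2 h2) ?_).1
        rw [h.mem_iff]
        exact hsep' j h1
    exact e1.trans e2
  · rcases hz a with ⟨h1, -⟩ | ⟨j, h1, h2⟩
    · rw [h1]
    · exact hp j _ ((h.mem_iff j _).2 h1) _ ((h.mem_iff j _).2 h2)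

end ArcLifts

end Arcs

/-! ### Moves inside a disc; the first Reidemeister move. -/

section LocalMoves

variable {S : Type u} [TopologicalSpace S] [ChartedSpace Plane S]

/-- Two diagrams coincide over the complement of a closed set `K` of parameters, and `K` consists of
the parameters at which the curves run in a given disc. -/
structure LocalMove (D D' : KnotDiagram S) (e : OpenPartialHomeomorph S Plane)
    (K : Set UnitAddCircle) : Prop where
  box : closedBox ⊆ e.target
  closed : IsClosed K
  agree : AgreeOn Kᶜ D D'
  off : ∀ z ∉ K, D.curve z ∉ boxOf e
  on : ∀ z ∈ K, D.curve z ∈ boxOf e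
  on' : ∀ z ∈ K, D'.curve z ∈ boxOf e

namespace LocalMove

variable {D D' : KnotDiagram S} {e : OpenPartialHomeomorph S Plane} {K : Set UnitAddCircle}

theorem symm (h : LocalMove D D' e K) : LocalMove D' D e K where
  box := h.box
  closed := h.closed
  agree := ⟨fun z hz => (h.agree.1 z hz).symm, fun z hz w hw => (h.agree.2 z hz w hw).symm⟩
  off := fun z hz => by
    rw [← h.agree.1 z hz]
    exact h.off z hz
  on := h.on'
  on' := h.on

/-- `K` is exactly the set of parameters at which the curve runs in the disc, and both ends of a
crossing have the same image. -/
theorem mem_iff (h : LocalMove D D' e K) {c : UnitAddCircle × UnitAddCircle}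
    (hc : c ∈ D.crossings) : c.1 ∈ K ↔ c.2 ∈ K := by
  have key (z : UnitAddCircle) : z ∈ K ↔ D.curve z ∈ boxOf e :=
    ⟨h.on z, fun hz => by_contra fun h' => h.off z h' hz⟩
  rw [key, key, (D.double_point c hc).2]

theorem mem_crossings (h : LocalMove D D' e K) {c : UnitAddCircle × UnitAddCircle}
    (hc : c ∈ D.crossings) (hK : c.1 ∉ K) : c ∈ D'.crossings :=
  (h.agree.2 c.1 hK c.2 fun h' => hK ((h.mem_iff hc).2 h')).1 hc

theorem velocity_eq (h : LocalMove D D' e K) {z : UnitAddCircle} (hz : z ∉ K) :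
    velocity D.curve z = velocity D'.curve z := by
  unfold velocity
  rw [h.agree.1 z hz]
  have hc : ContinuousAt (fun t : ℝ => z + (t : UnitAddCircle)) 0 :=
    (continuous_const.add (AddCircle.continuous_mk' 1)).continuousAt
  have hK : Kᶜ ∈ nhds (z + ((0 : ℝ) : UnitAddCircle)) := by
    rw [AddCircle.coe_zero, add_zero]
    exact h.closed.isOpen_compl.mem_nhds hz
  refine Filter.EventuallyEq.deriv_eq ?_
  filter_upwards [hc.preimage_mem_nhds hK] with t ht
  rw [h.agree.1 _ ht]

theorem crossingSign_eq (h : LocalMove D D' e K) {c : UnitAddCircle × UnitAddCircle}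
    (hc : c ∈ D.crossings) (hK : c.1 ∉ K) : D.crossingSign c = D'.crossingSign c := by
  unfold KnotDiagram.crossingSign
  rw [h.velocity_eq hK, h.velocity_eq fun h' => hK ((h.mem_iff hc).2 h')]

theorem exists_potential [T2Space S] (h : LocalMove D D' e K) :
    ∃ p, IsPotential D.realCurve p ∧ IsPotential D'.realCurve p ∧
      ∀ a b : ℝ, a ≤ b → (∀ t ∈ Set.Icc a b, (t : UnitAddCircle) ∈ K) → p a = p b :=
  exists_common_potential h.box (K := {t : ℝ | (t : UnitAddCircle) ∈ K})
    (h.closed.preimage (AddCircle.continuous_mk' 1)) (fun _ ht => h.agree.1 _ ht)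
    fun _ ht => ⟨h.on _ ht, h.on' _ ht⟩

/-- The terms of a local move that do not involve crossings in the disc. -/
theorem signedTerm_eq (h : LocalMove D D' e K) {p : ℝ → ChainClass S} (hp : IsPotential D.realCurve p) (hp' : IsPotential D'.realCurve p)
    {c d : UnitAddCircle × UnitAddCircle} (hc : c ∈ D.crossings) (hd : d ∈ D.crossings)
    (hcK : c.1 ∉ K) (hdK : d.1 ∉ K) : D.signedTerm s(c, d) = D'.signedTerm s(c, d) := by
  change (D.crossingSign c * D.crossingSign d) • D.arrowTerm c d =
    (D'.crossingSign c * D'.crossingSign d) • D'.arrowTerm c d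
  rw [h.crossingSign_eq hc hcK, h.crossingSign_eq hd hdK]
  congr 1
  refine KnotDiagram.arrowTerm_eq_of_sameOrder (b := 0) (b' := 0) hp hp' rfl hc hd
    (h.mem_crossings hc hcK) (h.mem_crossings hd hdK) ⟨fun _ _ => Iff.rfl, fun _ => rfl⟩

end LocalMove

variable {D D' : KnotDiagram S}

/-- The new arrow `c₀` cuts off an arc inside the disc, of class 0 and free of other ends, so each
of its terms contains the label 0. -/
theorem phi_eq_of_r1Move [T2Space S] (hmove : R1Move D D') : D.phi = D'.phi := by
  classical
  obtain ⟨e, x, r, he, hbox, hr, hr2, hagree, hoff, hon, hno, c₀, ⟨hc₀, hc₀1, hc₀2⟩, huniq⟩ := hmove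
  have hclosed : IsClosed (boxOf e) :=
    (isCompact_closedBox.image_of_continuousOn (e.continuousOn_symm.mono hbox)).isClosed
  -- The move describes only the open arc; its end points are included because the image of the
  -- square is compact, hence closed.
  have hbd (E : KnotDiagram S) (hE : ∀ t ∈ Set.Ioo (-1 : ℝ) 1,
      E.curve (x + ((r * t : ℝ) : UnitAddCircle)) ∈ e.symm '' openBox) :
      ∀ z ∈ circleArc x r, E.curve z ∈ boxOf e := by
    rintro _ ⟨t, ht, rfl⟩
    have hcont : Continuous fun t : ℝ => E.curve (x + ((r * t : ℝ) : UnitAddCircle)) :=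
      E.curve.continuous.comp
        (continuous_const.add ((AddCircle.continuous_mk' 1).comp (by fun_prop)))
    rw [← closure_Ioo (by norm_num : (-1 : ℝ) ≠ 1)] at ht
    refine closure_minimal (fun t ht => ?_) (hclosed.preimage hcont) ht
    obtain ⟨v, hv, hv'⟩ := hE t ht
    exact ⟨v, ⟨hv.1.le, hv.2.le⟩, hv'⟩
  have hloc : LocalMove D D' e (circleArc x r) :=
    ⟨hbox, isClosed_circleArc x r, hagree, hoff, hbd D fun t ht => (hon t ht).1,
      hbd D' fun t ht => (hon t ht).2⟩
  obtain ⟨X, rfl⟩ := QuotientAddGroup.mk_surjective x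
  -- The base point opposite to `X` is off the arc because `r < 1 / 2`.
  have hl : ArcLifts (k := 1) (X - 1 / 2) (fun _ => (X : UnitAddCircle)) (fun _ => r)
      (fun _ => X) :=
    ⟨fun _ => hr, fun _ => rfl, fun _ => by linarith, fun _ => by linarith⟩
  obtain ⟨p, hp, hp', hconst⟩ := hloc.exists_potential
  have hD (c) (hc : c ∈ D.crossings) : c.1 ∉ circleArc (X : UnitAddCircle) r := fun h =>
    hno c hc ⟨h, (hloc.mem_iff hc).1 h⟩
  have hset : D'.crossings = insert c₀ D.crossings := by
    ext c
    rw [Finset.mem_insert]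
    constructor
    · intro hc
      by_cases h : c.1 ∈ circleArc (X : UnitAddCircle) r
      · exact Or.inl (huniq c ⟨hc, h, (hloc.symm.mem_iff hc).1 h⟩)
      · exact Or.inr (hloc.symm.mem_crossings hc h)
    · rintro (rfl | hc)
      · exact hc₀
      · exact hloc.mem_crossings hc (hD c hc)
  have hc₀D : c₀ ∉ D.crossings := fun h => hD c₀ h hc₀1
  have hzero : ∀ d ∈ D.crossings, D'.signedTerm s(c₀, d) = 0 := by
    intro d hd
    change (D'.crossingSign c₀ * D'.crossingSign d) • D'.arrowTerm c₀ d = 0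
    have m1 := (hl.mem_iff 0 _).2 hc₀1
    have m2 := (hl.mem_iff 0 _).2 hc₀2
    have hpc (u v : ℝ) (hu : u ∈ Set.Icc (X - r) (X + r)) (hv : v ∈ Set.Icc (X - r) (X + r))
        (huv : u ≤ v) : p u = p v :=
      hconst u v huv fun t ht => coe_mem_circleArc hr rfl ⟨hu.1.trans ht.1, ht.2.trans hv.2⟩
    rw [KnotDiagram.arrowTerm_eq_zero_of_isolated hp' m1 m2, smul_zero]
    · rcases le_total (lift (X - 1 / 2) c₀.1) (lift (X - 1 / 2) c₀.2) with h | h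
      · exact hpc _ _ m1 m2 h
      · exact (hpc _ _ m2 m1 h).symm
    · rw [hl.mem_iff 0]
      exact hD d hd
  have hself : D'.signedTerm s(c₀, c₀) = 0 := by
    change (D'.crossingSign c₀ * D'.crossingSign c₀) • D'.arrowTerm c₀ c₀ = 0
    rw [KnotDiagram.arrowTerm_self, smul_zero]
  rw [KnotDiagram.phi_eq_sum, KnotDiagram.phi_eq_sum, hset, sum_sym2_insert hc₀D, hself,
    Finset.sum_eq_zero hzero, zero_add, zero_add]
  refine Finset.sum_congr rfl fun q hq => ?_
  induction q using Sym2.ind with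
  | _ c d =>
    rw [Finset.mk_mem_sym2_iff] at hq
    exact hloc.signedTerm_eq hp hp' hq.1 hq.2 (hD c hq.1) (hD d hq.2)

end LocalMoves

/-! ### Layered strands along graphs: their crossings and signs. -/

section Strands

variable {S : Type u} [TopologicalSpace S] [ChartedSpace Plane S] {k : ℕ}

/-- The point of strand `i` with abscissa `t`. -/
def strandPoint (x : Fin k → UnitAddCircle) (r dir : Fin k → ℝ) (i : Fin k) (t : ℝ) :
    UnitAddCircle :=
  x i + ((r i * (dir i * t) : ℝ) : UnitAddCircle)

/-- Inside a disc the diagram consists of layered strands along the graphs of the functions `φ i`. -/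
structure Strands (φ : Fin k → ℝ → ℝ) (D : KnotDiagram S) (e : OpenPartialHomeomorph S Plane)
    (x : Fin k → UnitAddCircle) (r dir : Fin k → ℝ) (height : Fin k → ℕ) : Prop where
  chart : IsPositiveChart e
  box : closedBox ⊆ e.target
  pos : ∀ i, 0 < r i
  dir_eq : ∀ i, dir i = 1 ∨ dir i = -1
  height_inj : Function.Injective height
  disj : ∀ i j, i ≠ j → Disjoint (circleArc (x i) (r i)) (circleArc (x j) (r j))
  bound : ∀ i, ∀ t ∈ Set.Icc (-1 : ℝ) 1, |φ i t| ≤ 1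
  curve_eq : ∀ i, ∀ t ∈ Set.Icc (-1 : ℝ) 1,
    D.curve (x i + ((r i * t : ℝ) : UnitAddCircle)) = e.symm !₂[dir i * t, φ i (dir i * t)]
  layered : ∀ i j, height j < height i →
    ∀ z ∈ circleArc (x i) (r i), ∀ w ∈ circleArc (x j) (r j),
      D.curve z = D.curve w → (z, w) ∈ D.crossings

theorem StrandMove.strands {φ φ' : Fin k → ℝ → ℝ} {D D' : KnotDiagram S}
    (h : StrandMove φ φ' D D') (hφ : ∀ i, ∀ t ∈ Set.Icc (-1 : ℝ) 1, |φ i t| ≤ 1)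
    (hφ' : ∀ i, ∀ t ∈ Set.Icc (-1 : ℝ) 1, |φ' i t| ≤ 1) :
    ∃ (e : OpenPartialHomeomorph S Plane) (x : Fin k → UnitAddCircle) (r dir : Fin k → ℝ)
      (height : Fin k → ℕ), Strands φ D e x r dir height ∧ Strands φ' D' e x r dir height ∧
        LocalMove D D' e (⋃ i, circleArc (x i) (r i)) := by
  obtain ⟨e, x, r, dir, height, hc, hbox, hr, hdir, hh, hdisj, hagree, hoff, hcurve, hover⟩ := h
  have hmem (ψ : Fin k → ℝ → ℝ) (hψ : ∀ i, ∀ t ∈ Set.Icc (-1 : ℝ) 1, |ψ i t| ≤ 1)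
      (E : KnotDiagram S) (hE : ∀ i, ∀ t ∈ Set.Icc (-1 : ℝ) 1,
        E.curve (x i + ((r i * t : ℝ) : UnitAddCircle)) = e.symm !₂[dir i * t, ψ i (dir i * t)]) :
      ∀ z ∈ ⋃ i, circleArc (x i) (r i), E.curve z ∈ boxOf e := by
    intro z hz
    obtain ⟨i, t, ht, rfl⟩ := Set.mem_iUnion.1 hz
    refine ⟨_, ?_, (hE i t ht).symm⟩
    have h1 : dir i * t ∈ Set.Icc (-1 : ℝ) 1 := by
      rcases hdir i with h | h <;> rw [h] <;> constructor <;> linarith [ht.1, ht.2]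
    exact ⟨by simpa using abs_le.2 h1, by simpa using hψ i _ h1⟩
  have hloc : LocalMove D D' e (⋃ i, circleArc (x i) (r i)) :=
    ⟨hbox, isClosed_iUnion_of_finite fun i => isClosed_circleArc _ _, hagree, hoff,
      hmem φ hφ D fun i t ht => (hcurve i t ht).1, hmem φ' hφ' D' fun i t ht => (hcurve i t ht).2⟩
  exact ⟨e, x, r, dir, height,
    ⟨hc, hbox, hr, hdir, hh, hdisj, hφ, fun i t ht => (hcurve i t ht).1,
      fun i j hij z hz w hw => (hover i j hij z hz w hw).1⟩,
    ⟨hc, hbox, hr, hdir, hh, hdisj, hφ', fun i t ht => (hcurve i t ht).2,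
      fun i j hij z hz w hw => (hover i j hij z hz w hw).2⟩, hloc⟩

namespace Strands

variable {φ : Fin k → ℝ → ℝ} {D : KnotDiagram S} {e : OpenPartialHomeomorph S Plane}
  {x : Fin k → UnitAddCircle} {r dir : Fin k → ℝ} {height : Fin k → ℕ}

theorem dir_sq (h : Strands φ D e x r dir height) (i : Fin k) : dir i * dir i = 1 := by
  rcases h.dir_eq i with h | h <;> rw [h] <;> norm_num

theorem dir_mul_mem (h : Strands φ D e x r dir height) (i : Fin k) {t : ℝ}
    (ht : t ∈ Set.Icc (-1 : ℝ) 1) : dir i * t ∈ Set.Icc (-1 : ℝ) 1 := by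
  rcases h.dir_eq i with h | h <;> rw [h] <;> constructor <;> linarith [ht.1, ht.2]

theorem strandPoint_mem (h : Strands φ D e x r dir height) (i : Fin k) {t : ℝ}
    (ht : t ∈ Set.Icc (-1 : ℝ) 1) : strandPoint x r dir i t ∈ circleArc (x i) (r i) :=
  mem_circleArc _ _ (h.dir_mul_mem i ht)

theorem curve_strandPoint (h : Strands φ D e x r dir height) (i : Fin k) {t : ℝ}
    (ht : t ∈ Set.Icc (-1 : ℝ) 1) :
    D.curve (strandPoint x r dir i t) = e.symm !₂[t, φ i t] := by
  rw [strandPoint, h.curve_eq i _ (h.dir_mul_mem i ht), ← mul_assoc, h.dir_sq, one_mul]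

theorem exists_strandPoint (h : Strands φ D e x r dir height) {i : Fin k} {z : UnitAddCircle}
    (hz : z ∈ circleArc (x i) (r i)) :
    ∃ t ∈ Set.Icc (-1 : ℝ) 1, z = strandPoint x r dir i t := by
  obtain ⟨t, ht, rfl⟩ := hz
  refine ⟨dir i * t, h.dir_mul_mem i ht, ?_⟩
  rw [strandPoint, ← mul_assoc (dir i), h.dir_sq, one_mul]

theorem mem_target (h : Strands φ D e x r dir height) (i : Fin k) {t : ℝ}
    (ht : t ∈ Set.Icc (-1 : ℝ) 1) : !₂[t, φ i t] ∈ e.target :=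
  h.box ⟨by simpa using abs_le.2 ht, by simpa using h.bound i t ht⟩

theorem curve_strandPoint_eq_iff (h : Strands φ D e x r dir height) {i j : Fin k} {s t : ℝ}
    (hs : s ∈ Set.Icc (-1 : ℝ) 1) (ht : t ∈ Set.Icc (-1 : ℝ) 1) :
    D.curve (strandPoint x r dir i s) = D.curve (strandPoint x r dir j t) ↔
      s = t ∧ φ i s = φ j t := by
  rw [h.curve_strandPoint i hs, h.curve_strandPoint j ht,
    e.symm.injOn.eq_iff (h.mem_target i hs) (h.mem_target j ht)]
  constructor
  · intro heq
    exact ⟨by simpa using congrArg (fun v : Plane => v 0) heq,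
      by simpa using congrArg (fun v : Plane => v 1) heq⟩
  · rintro ⟨rfl, h2⟩
    rw [h2]

theorem mem_crossings (h : Strands φ D e x r dir height) {i j : Fin k} (hij : height j < height i)
    {t : ℝ} (ht : t ∈ Set.Icc (-1 : ℝ) 1) (heq : φ i t = φ j t) :
    (strandPoint x r dir i t, strandPoint x r dir j t) ∈ D.crossings :=
  h.layered i j hij _ (h.strandPoint_mem i ht) _ (h.strandPoint_mem j ht)
    ((h.curve_strandPoint_eq_iff ht ht).2 ⟨rfl, heq⟩)

/-- Points with the same image have the same abscissa, hence lie on different strands;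
`over_or_under` then excludes the wrong order of heights. -/
theorem exists_of_mem_crossings (h : Strands φ D e x r dir height)
    {c : UnitAddCircle × UnitAddCircle} (hc : c ∈ D.crossings)
    (h1 : c.1 ∈ ⋃ i, circleArc (x i) (r i)) (h2 : c.2 ∈ ⋃ i, circleArc (x i) (r i)) :
    ∃ i j t, height j < height i ∧ t ∈ Set.Icc (-1 : ℝ) 1 ∧ φ i t = φ j t ∧
      c = (strandPoint x r dir i t, strandPoint x r dir j t) := by
  obtain ⟨c1, c2⟩ := c
  obtain ⟨i, hi⟩ := Set.mem_iUnion.1 h1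
  obtain ⟨j, hj⟩ := Set.mem_iUnion.1 h2
  obtain ⟨s, hs, rfl⟩ := h.exists_strandPoint hi
  obtain ⟨t, ht, rfl⟩ := h.exists_strandPoint hj
  obtain ⟨hne, heq⟩ := D.double_point _ hc
  obtain ⟨rfl, heq'⟩ := (h.curve_strandPoint_eq_iff hs ht).1 heq
  refine ⟨i, j, s, ?_, hs, heq', rfl⟩
  rcases lt_trichotomy (height j) (height i) with hlt | hlt | hlt
  · exact hlt
  · exact absurd (by rw [h.height_inj hlt]) hne
  · exact absurd (h.mem_crossings hlt hs heq'.symm)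
      ((D.over_or_under _ _ hne heq).1 hc)

section Velocity

/-- Differentiability of `φ i` is not part of the move: it comes from the smooth curve, which in the
chart is the graph traversed with an affine change of parameter. The first coordinate fixes the
speed. -/
theorem exists_chartVelocity (h : Strands φ D e x r dir height) (i : Fin k) {t : ℝ}
    (ht : t ∈ Set.Ioo (-1 : ℝ) 1) :
    ∃ m, HasDerivAt (φ i) m t ∧
      D.chartVelocity e (strandPoint x r dir i t) = (dir i / r i) • !₂[1, m] := by
  have hr := h.pos i
  have hd := h.dir_sq i
  let z := strandPoint x r dir i t
  let g : ℝ → Plane := fun τ => e (D.curve (z + (τ : UnitAddCircle)))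
  have hz : D.curve z = e.symm !₂[t, φ i t] := h.curve_strandPoint i ⟨ht.1.le, ht.2.le⟩
  have hgd : DifferentiableAt ℝ g 0 := by
    refine differentiableAt_chart_curve h.chart.1 (D.smooth_shift z 0) ?_
    rw [AddCircle.coe_zero, add_zero, hz]
    exact e.map_target (h.mem_target i ⟨ht.1.le, ht.2.le⟩)
  have hev : ∀ᶠ u in nhds t, g (r i * dir i * (u - t)) = !₂[u, φ i u] := by
    filter_upwards [Ioo_mem_nhds ht.1 ht.2] with u hu
    have h1 : z + ((r i * dir i * (u - t) : ℝ) : UnitAddCircle) = strandPoint x r dir i u := by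
      simp only [z, strandPoint]
      rw [add_assoc, ← AddCircle.coe_add]
      congr 2
      ring
    simp only [g]
    rw [h1, h.curve_strandPoint i ⟨hu.1.le, hu.2.le⟩,
      e.right_inv (h.mem_target i ⟨hu.1.le, hu.2.le⟩)]
  have hcomp : HasDerivAt (fun u => g (r i * dir i * (u - t))) ((r i * dir i) • deriv g 0) t := by
    have h1 : HasDerivAt (fun u => r i * dir i * (u - t)) (r i * dir i) t := by
      simpa using ((hasDerivAt_id t).sub_const t).const_mul (r i * dir i)
    have h2 : HasDerivAt g (deriv g 0) (r i * dir i * (t - t)) := by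
      rw [sub_self, mul_zero]
      exact hgd.hasDerivAt
    exact h2.scomp t h1
  have hcomp' := hcomp.congr_of_eventuallyEq (hev.mono fun u hu => hu.symm)
  have hproj (a : Fin 2) := (EuclideanSpace.proj a : Plane →L[ℝ] ℝ).hasFDerivAt.comp_hasDerivAt t
    hcomp'
  have h0 : (1 : ℝ) = r i * dir i * deriv g 0 0 := by
    refine (hasDerivAt_id' t).unique ?_
    have := hproj 0
    simpa [Function.comp_def] using this
  refine ⟨r i * dir i * deriv g 0 1, ?_, ?_⟩
  · have := hproj 1
    simpa [Function.comp_def] using this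
  · change deriv g 0 = _
    have h2 : dir i / r i * (r i * dir i) = 1 := by
      field_simp
      linarith
    ext a
    fin_cases a
    · simp only [Fin.zero_eta, PiLp.smul_apply, smul_eq_mul]
      calc deriv g 0 0 = dir i / r i * (r i * dir i) * deriv g 0 0 := by rw [h2, one_mul]
        _ = dir i / r i * (r i * dir i * deriv g 0 0) := by ring
        _ = _ := by rw [← h0]; simp
    · simp only [Fin.mk_one, PiLp.smul_apply, smul_eq_mul]
      calc deriv g 0 1 = dir i / r i * (r i * dir i) * deriv g 0 1 := by rw [h2, one_mul]
        _ = dir i / r i * (r i * dir i * deriv g 0 1) := by ring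
        _ = _ := by simp

/-- The sign of the direction of a strand. -/
def dirSign (dir : Fin k → ℝ) (i : Fin k) : ℤ := SignType.sign (dir i)

variable [IsManifold (𝓡 2) ∞ S]

/-- In the chart the velocities are positive multiples of `dir i • (1, mi)` and `dir j • (1, mj)`;
transversality forces the slopes to differ. -/
theorem crossingSign_eq (h : Strands φ D e x r dir height) {i j : Fin k}
    (hij : height j < height i) {t : ℝ} (ht : t ∈ Set.Ioo (-1 : ℝ) 1) (heq : φ i t = φ j t) :
    ∃ mi mj, HasDerivAt (φ i) mi t ∧ HasDerivAt (φ j) mj t ∧ mi ≠ mj ∧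
      D.crossingSign (strandPoint x r dir i t, strandPoint x r dir j t) =
        dirSign dir i * dirSign dir j * SignType.sign (mj - mi) := by
  have ht' : t ∈ Set.Icc (-1 : ℝ) 1 := ⟨ht.1.le, ht.2.le⟩
  obtain ⟨mi, hmi, hvi⟩ := h.exists_chartVelocity i ht
  obtain ⟨mj, hmj, hvj⟩ := h.exists_chartVelocity j ht
  have hc := h.mem_crossings hij ht' heq
  have hcurve := (D.double_point _ hc).2
  have hsrc : D.curve (strandPoint x r dir i t) ∈ e.source := by
    rw [h.curve_strandPoint i ht']
    exact e.map_target (h.mem_target i ht')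
  have hw : wedge (D.chartVelocity e (strandPoint x r dir i t))
      (D.chartVelocity e (strandPoint x r dir j t)) =
      dir i / r i * (dir j / r j) * (mj - mi) := by
    rw [hvi, hvj, wedge_smul]
    simp [wedge]
  have hdivsign (i : Fin k) : SignType.sign (dir i / r i) = SignType.sign (dir i) := by
    rw [div_eq_mul_inv, sign_mul, sign_pos (inv_pos.2 (h.pos i)), mul_one]
  refine ⟨mi, mj, hmi, hmj, ?_, ?_⟩
  · rintro rfl
    obtain ⟨a, -, ha⟩ := D.wedge_velocity h.chart hcurve hsrc
    rw [hw, sub_self, mul_zero, mul_zero] at ha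
    exact D.transverse _ hc ha
  · rw [D.crossingSign_eq_chart h.chart hcurve hsrc, hw, sign_mul, sign_mul, hdivsign, hdivsign]
    simp [dirSign]

end Velocity

end Strands

end Strands

/-! ### Parallel arrows and the second Reidemeister move. -/

section StrandMoves

variable {S : Type u} [TopologicalSpace S] [ChartedSpace Plane S]

namespace KnotDiagram

variable {D : KnotDiagram S}

/-- By `h3` the heads both follow or both precede the tails. Either the arrows intersect, or the
middle region consists of two arcs over which the potential has no increment, so its label is 0. -/
theorem arrowTerm_eq_zero_of_parallel_of_lt {p : ℝ → ChainClass S}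
    (hp : IsPotential D.realCurve p) {b : ℝ} {c d : UnitAddCircle × UnitAddCircle}
    (hc : c ∈ D.crossings) (hd : d ∈ D.crossings) (hlt : lift b c.1 < lift b d.1)
    (hne : c.2 ≠ d.2) (h1 : p (lift b c.1) = p (lift b d.1)) (h2 : p (lift b c.2) = p (lift b d.2))
    (h3 : (lift b d.1 < lift b c.2 ∧ lift b d.1 < lift b d.2) ∨
      (lift b c.2 < lift b c.1 ∧ lift b d.2 < lift b c.1)) :
    D.arrowTerm c d = 0 := by
  obtain ⟨c1, c2⟩ := c
  obtain ⟨d1, d2⟩ := d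
  have hm (z : UnitAddCircle) : b ≤ lift b z ∧ lift b z < b + 1 := lift_mem b z
  rw [← coe_lift b c1, ← coe_lift b c2] at hc ⊢
  rw [← coe_lift b d1, ← coe_lift b d2] at hd ⊢
  have hne' : lift b c2 ≠ lift b d2 := fun h => hne (lift_inj.1 h)
  dsimp only at hlt h1 h2 h3
  have hm1 := hm c1
  have hm2 := hm c2
  have hm3 := hm d1
  have hm4 := hm d2
  rcases h3 with ⟨h3, h4⟩ | ⟨h3, h4⟩ <;> rcases lt_or_gt_of_ne hne' with h5 | h5
  · exact arrowTerm_of_crossing hlt h3 h5 (by linarith) true true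
  · rw [arrowTerm_comm]
    refine (arrowTerm_of_nested hp hlt h4 h5 (by linarith) true false hd hc).trans
      (toGroup_eq_zero _ _ _ (Or.inl ?_))
    rw [h1, h2, sub_self, sub_self, add_zero, homologyOf_zero]
  · exact arrowTerm_of_crossing h5 h4 hlt (by linarith) false false
  · refine (arrowTerm_of_nested hp h5 h3 hlt (by linarith) false true hc hd).trans
      (toGroup_eq_zero _ _ _ (Or.inl ?_))
    rw [h1, h2, sub_self, sub_self, add_zero, homologyOf_zero]

/-- Two arrows that are parallel, in the sense that the ends of one are close to those of the
other, contribute nothing. -/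
theorem arrowTerm_eq_zero_of_parallel {p : ℝ → ChainClass S}
    (hp : IsPotential D.realCurve p) {b l₁ r₁ l₂ r₂ : ℝ} {c d : UnitAddCircle × UnitAddCircle}
    (hc : c ∈ D.crossings) (hd : d ∈ D.crossings) (hne1 : c.1 ≠ d.1) (hne2 : c.2 ≠ d.2)
    (hc1 : lift b c.1 ∈ Set.Icc l₁ r₁) (hd1 : lift b d.1 ∈ Set.Icc l₁ r₁)
    (hc2 : lift b c.2 ∈ Set.Icc l₂ r₂) (hd2 : lift b d.2 ∈ Set.Icc l₂ r₂)
    (h1 : p (lift b c.1) = p (lift b d.1)) (h2 : p (lift b c.2) = p (lift b d.2))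
    (h3 : r₁ < l₂ ∨ r₂ < l₁) :
    D.arrowTerm c d = 0 := by
  simp only [Set.mem_Icc] at hc1 hd1 hc2 hd2
  rcases lt_or_gt_of_ne (fun h => hne1 (lift_inj (b := b).1 h)) with hlt | hlt
  · refine arrowTerm_eq_zero_of_parallel_of_lt hp hc hd hlt hne2 h1 h2 ?_
    rcases h3 with h3 | h3
    · left; constructor <;> linarith
    · right; constructor <;> linarith
  · rw [arrowTerm_comm]
    refine arrowTerm_eq_zero_of_parallel_of_lt hp hd hc hlt hne2.symm h1.symm h2.symm ?_
    rcases h3 with h3 | h3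
    · left; constructor <;> linarith
    · right; constructor <;> linarith

/-- An arrow may be moved along the arcs that contain its ends. -/
theorem arrowTerm_congr {D' : KnotDiagram S} {k : ℕ} {b : ℝ} {x : Fin k → UnitAddCircle}
    {r X : Fin k → ℝ} (hl : ArcLifts b x r X)
    (hdisj : ∀ i j, i ≠ j → Disjoint (circleArc (x i) (r i)) (circleArc (x j) (r j)))
    {p : ℝ → ChainClass S} (hp : IsPotential D.realCurve p) (hp' : IsPotential D'.realCurve p)
    (hconst : ∀ i, ∀ u ∈ Set.Icc (X i - r i) (X i + r i),
      ∀ v ∈ Set.Icc (X i - r i) (X i + r i), p u = p v)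
    {i j : Fin k} (hij : i ≠ j) {c c' d : UnitAddCircle × UnitAddCircle}
    (hc : c ∈ D.crossings) (hc' : c' ∈ D'.crossings) (hd : d ∈ D.crossings)
    (hd' : d ∈ D'.crossings) (h1 : c.1 ∈ circleArc (x i) (r i)) (h1' : c'.1 ∈ circleArc (x i) (r i))
    (h2 : c.2 ∈ circleArc (x j) (r j)) (h2' : c'.2 ∈ circleArc (x j) (r j))
    (hd1 : d.1 ∉ ⋃ i, circleArc (x i) (r i)) (hd2 : d.2 ∉ ⋃ i, circleArc (x i) (r i)) :
    D.arrowTerm c d = D'.arrowTerm c' d := by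
  simp only [Set.mem_iUnion, not_exists] at hd1 hd2
  refine arrowTerm_eq_of_sameOrder hp hp' rfl hc hd hc' hd' (b := b) (b' := b)
    (hl.sameOrder hdisj hconst (fun a => ?_) fun a a' haa l => ?_)
  · fin_cases a
    · exact Or.inr ⟨i, h1, h1'⟩
    · exact Or.inr ⟨j, h2, h2'⟩
    · exact Or.inl ⟨rfl, hd1⟩
    · exact Or.inl ⟨rfl, hd2⟩
  · rintro ⟨ha, ha'⟩
    have hex (z w : UnitAddCircle) (hz : z ∈ circleArc (x i) (r i)) (hw : w ∈ circleArc (x j) (r j))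
        (hzl : z ∈ circleArc (x l) (r l)) (hwl : w ∈ circleArc (x l) (r l)) : False := by
      by_cases hil : i = l
      · subst hil
        exact Set.disjoint_left.1 (hdisj i j hij) hwl hw
      · exact Set.disjoint_left.1 (hdisj i l hil) hz hzl
    fin_cases a <;> fin_cases a' <;>
      first
        | exact haa rfl
        | exact hd1 l ha
        | exact hd2 l ha
        | exact hd1 l ha'
        | exact hd2 l ha'
        | exact hex _ _ h1 h2 ha ha'
        | exact hex _ _ h1 h2 ha' ha

end KnotDiagram

/-- The potential is constant on every lift of an arc, not only on the one after `b`: the third move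
lifts its strands in cyclic order. -/
theorem StrandMove.exists_setup [T2Space S] {k : ℕ} {φ φ' : Fin k → ℝ → ℝ} {D D' : KnotDiagram S}
    (h : StrandMove φ φ' D D') {i j : Fin k} (hij : i ≠ j)
    (hφ : ∀ i, ∀ t ∈ Set.Icc (-1 : ℝ) 1, |φ i t| ≤ 1)
    (hφ' : ∀ i, ∀ t ∈ Set.Icc (-1 : ℝ) 1, |φ' i t| ≤ 1) :
    ∃ (e : OpenPartialHomeomorph S Plane) (x : Fin k → UnitAddCircle) (r dir : Fin k → ℝ)
      (height : Fin k → ℕ) (b : ℝ) (X : Fin k → ℝ) (p : ℝ → ChainClass S),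
      Strands φ D e x r dir height ∧ Strands φ' D' e x r dir height ∧
      LocalMove D D' e (⋃ i, circleArc (x i) (r i)) ∧ ArcLifts b x r X ∧
      IsPotential D.realCurve p ∧ IsPotential D'.realCurve p ∧
      ∀ i, ∀ y : ℝ, (y : UnitAddCircle) = x i → ∀ u ∈ Set.Icc (y - r i) (y + r i),
        ∀ v ∈ Set.Icc (y - r i) (y + r i), p u = p v := by
  obtain ⟨e, x, r, dir, height, hD, hD', hloc⟩ := h.strands hφ hφ'
  obtain ⟨b, hb⟩ := exists_not_mem_circleArc hij hD.disj
  obtain ⟨X, hX⟩ := exists_arcLifts hD.pos hb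
  obtain ⟨p, hp, hp', hconst⟩ := hloc.exists_potential
  refine ⟨e, x, r, dir, height, b, X, p, hD, hD', hloc, hX, hp, hp', fun i y hy u hu v hv => ?_⟩
  have key {u v : ℝ} (hu : u ∈ Set.Icc (y - r i) (y + r i)) (hv : v ∈ Set.Icc (y - r i) (y + r i))
      (huv : u ≤ v) : p u = p v :=
    hconst u v huv fun t ht => Set.mem_iUnion.2
      ⟨i, coe_mem_circleArc (hD.pos i) hy ⟨hu.1.trans ht.1, ht.2.trans hv.2⟩⟩
  rcases le_total u v with huv | huv
  · exact key hu hv huv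
  · exact (key hv hu huv).symm

theorem ArcLifts.disjoint_or {k : ℕ} {b : ℝ} {x : Fin k → UnitAddCircle} {r X : Fin k → ℝ}
    (h : ArcLifts b x r X) {i j : Fin k}
    (hij : Disjoint (circleArc (x i) (r i)) (circleArc (x j) (r j))) :
    X i + r i < X j - r j ∨ X j + r j < X i - r i := by
  by_contra! hcon
  have hi := h.pos i
  have hj := h.pos j
  let u := max (X i - r i) (X j - r j)
  have h1 : u ∈ Set.Icc (X i - r i) (X i + r i) :=
    ⟨le_max_left _ _, max_le (by linarith) hcon.1⟩
  have h2 : u ∈ Set.Icc (X j - r j) (X j + r j) :=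
    ⟨le_max_right _ _, max_le hcon.2 (by linarith)⟩
  exact Set.disjoint_left.1 hij (coe_mem_circleArc hi (h.coe i) h1)
    (coe_mem_circleArc hj (h.coe j) h2)

theorem Strands.strandPoint_ne {k : ℕ} {φ : Fin k → ℝ → ℝ} {D : KnotDiagram S}
    {e : OpenPartialHomeomorph S Plane} {x : Fin k → UnitAddCircle} {r dir : Fin k → ℝ}
    {height : Fin k → ℕ} (h : Strands φ D e x r dir height) (i : Fin k) {s t : ℝ}
    (hs : s ∈ Set.Icc (-1 : ℝ) 1) (ht : t ∈ Set.Icc (-1 : ℝ) 1) (hst : s ≠ t) :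
    strandPoint x r dir i s ≠ strandPoint x r dir i t := fun heq =>
  hst ((h.curve_strandPoint_eq_iff hs ht).1 (congrArg D.curve heq)).1

/-- The difference quotients give only a weak inequality; `m ≠ 0`, supplied by transversality, makes
it strict. -/
theorem deriv_neg_of_sign {f : ℝ → ℝ} {m a : ℝ} (h : HasDerivAt f m a) (hm : m ≠ 0)
    (hf : ∀ᶠ t in nhds a, 0 ≤ (a - t) * (f t - f a)) : m < 0 := by
  refine lt_of_le_of_ne (le_of_tendsto (hasDerivAt_iff_tendsto_slope.1 h) ?_) hm
  filter_upwards [hf.filter_mono nhdsWithin_le_nhds, self_mem_nhdsWithin] with t ht hta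
  rw [slope_def_field]
  have h1 : 0 < (t - a) ^ 2 := by
    have : t - a ≠ 0 := sub_ne_zero.2 hta
    positivity
  have h2 : (f t - f a) / (t - a) = -((a - t) * (f t - f a)) / (t - a) ^ 2 := by
    have : t - a ≠ 0 := sub_ne_zero.2 hta
    field_simp
    ring
  rw [h2]
  exact div_nonpos_of_nonpos_of_nonneg (by linarith) h1.le

theorem deriv_pos_of_sign {f : ℝ → ℝ} {m a : ℝ} (h : HasDerivAt f m a) (hm : m ≠ 0)
    (hf : ∀ᶠ t in nhds a, 0 ≤ (t - a) * (f t - f a)) : 0 < m := by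
  have := deriv_neg_of_sign h.neg (neg_ne_zero.2 hm) (hf.mono fun t ht => by
    simp only [Pi.neg_apply]
    linarith)
  linarith

/-- The two crossings of `D` in the disc have opposite signs and the same term with any other arrow,
so these contributions cancel; their mutual term vanishes because they are parallel. -/
theorem phi_eq_of_r2Move [T2Space S] [IsManifold (𝓡 2) ∞ S] {D D' : KnotDiagram S}
    (hmove : R2Move D D') : D.phi = D'.phi := by
  classical
  obtain ⟨f, g, p₁, p₂, hp1, hp12, hp2, hf, hg, hmove⟩ := hmove
  have hI1 : p₁ ∈ Set.Ioo (-1 : ℝ) 1 := ⟨hp1, hp12.trans hp2⟩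
  have hI2 : p₂ ∈ Set.Ioo (-1 : ℝ) 1 := ⟨hp1.trans hp12, hp2⟩
  have hc1 : p₁ ∈ Set.Icc (-1 : ℝ) 1 := ⟨hI1.1.le, hI1.2.le⟩
  have hc2 : p₂ ∈ Set.Icc (-1 : ℝ) 1 := ⟨hI2.1.le, hI2.2.le⟩
  have hf0 {t : ℝ} (ht : t ∈ Set.Icc (-1 : ℝ) 1) : f t = 0 ↔ t = p₁ ∨ t = p₂ := by
    obtain ⟨-, h1, h2⟩ := hf t ht
    constructor
    · intro h0
      rw [h0] at h1 h2
      simp only [lt_irrefl, false_iff, not_or, not_lt, not_and_or] at h1 h2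
      rcases h2 with h2 | h2
      · exact Or.inl (le_antisymm h2 h1.1)
      · exact Or.inr (le_antisymm h1.2 h2)
    · intro h0
      have h3 : ¬ 0 < f t := by rw [h1]; rintro (h | h) <;> rcases h0 with h0 | h0 <;> linarith
      have h4 : ¬ f t < 0 := by rw [h2]; rintro ⟨h, h'⟩; rcases h0 with h0 | h0 <;> linarith
      linarith
  have hf1 : f p₁ = 0 := (hf0 hc1).2 (Or.inl rfl)
  have hf2 : f p₂ = 0 := (hf0 hc2).2 (Or.inr rfl)
  -- `f` passes from positive to negative at `p₁` and back at `p₂`; the opposite slopes give the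
  -- opposite signs of the crossings.
  have hderiv1 {m : ℝ} (h : HasDerivAt f m p₁) (hm : m ≠ 0) : m < 0 := by
    refine deriv_neg_of_sign h hm ?_
    filter_upwards [Ioo_mem_nhds hp1 hp12] with t ht
    obtain ⟨-, h1, h2⟩ := hf t ⟨ht.1.le, by linarith [ht.2]⟩
    rw [hf1, sub_zero]
    rcases lt_trichotomy t p₁ with h3 | h3 | h3
    · exact mul_nonneg (by linarith) (h1.2 (Or.inl h3)).le
    · simp [h3]
    · exact mul_nonneg_of_nonpos_of_nonpos (by linarith) (h2.2 ⟨h3, ht.2⟩).le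
  have hderiv2 {m : ℝ} (h : HasDerivAt f m p₂) (hm : m ≠ 0) : 0 < m := by
    refine deriv_pos_of_sign h hm ?_
    filter_upwards [Ioo_mem_nhds hp12 hp2] with t ht
    obtain ⟨-, h1, h2⟩ := hf t ⟨by linarith [ht.1], ht.2.le⟩
    rw [hf2, sub_zero]
    rcases lt_trichotomy t p₂ with h3 | h3 | h3
    · exact mul_nonneg_of_nonpos_of_nonpos (by linarith) (h2.2 ⟨ht.1, h3⟩).le
    · simp [h3]
    · exact mul_nonneg (by linarith) (h1.2 (Or.inr h3)).le
  obtain ⟨e, x, r, dir, height, b, X, p, hD, hD', hloc, hX, hp, hp', hconst⟩ :=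
    hmove.exists_setup (i := 0) (j := 1) (by decide)
      (fun i t ht => by
        fin_cases i
        · simp
        · exact (hf t ht).1.le)
      (fun i t ht => by
        fin_cases i
        · simp
        · exact (abs_of_pos (hg t ht).1).trans_le (hg t ht).2.le)
  have hconst' := fun i => hconst i (X i) (hX.coe i)
  -- `i` is the upper strand; it may be the axis or the graph of `f`.
  obtain ⟨i, j, hij, hcase⟩ : ∃ i j : Fin 2, height j < height i ∧
      ((i = 0 ∧ j = 1) ∨ (i = 1 ∧ j = 0)) := by
    rcases lt_or_gt_of_ne (fun h => absurd (hD.height_inj h) (by decide) :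
      height 0 ≠ height 1) with h | h
    · exact ⟨1, 0, h, Or.inr ⟨rfl, rfl⟩⟩
    · exact ⟨0, 1, h, Or.inl ⟨rfl, rfl⟩⟩
  have hne : i ≠ j := by rintro rfl; exact lt_irrefl _ hij
  have heq {t : ℝ} (ht : t = p₁ ∨ t = p₂) :
      (![fun _ => 0, f] : Fin 2 → ℝ → ℝ) i t = (![fun _ => 0, f] : Fin 2 → ℝ → ℝ) j t := by
    have h0 : f t = 0 := by rcases ht with rfl | rfl <;> assumption
    rcases hcase with ⟨rfl, rfl⟩ | ⟨rfl, rfl⟩ <;> simp [h0]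
  let c (t : ℝ) : UnitAddCircle × UnitAddCircle := (strandPoint x r dir i t, strandPoint x r dir j t)
  have hcm1 : c p₁ ∈ D.crossings := hD.mem_crossings hij hc1 (heq (Or.inl rfl))
  have hcm2 : c p₂ ∈ D.crossings := hD.mem_crossings hij hc2 (heq (Or.inr rfl))
  have hK {t : ℝ} (ht : t ∈ Set.Icc (-1 : ℝ) 1) : (c t).1 ∈ ⋃ i, circleArc (x i) (r i) :=
    Set.mem_iUnion.2 ⟨i, hD.strandPoint_mem i ht⟩
  have hD'off {d} (hd : d ∈ D'.crossings) : d.1 ∉ ⋃ i, circleArc (x i) (r i) := by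
    intro h1
    obtain ⟨l, l', t, hll, ht, h0, -⟩ :=
      hD'.exists_of_mem_crossings hd h1 ((hloc.symm.mem_iff hd).1 h1)
    have hpos := (hg t ht).1
    fin_cases l <;> fin_cases l'
    · exact lt_irrefl _ hll
    · exact hpos.ne h0
    · exact hpos.ne' h0
    · exact lt_irrefl _ hll
  have hset : D.crossings = insert (c p₁) (insert (c p₂) D'.crossings) := by
    ext d
    simp only [Finset.mem_insert]
    constructor
    · intro hd
      by_cases h1 : d.1 ∈ ⋃ i, circleArc (x i) (r i)
      · obtain ⟨l, l', t, hll, ht, h0, rfl⟩ :=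
          hD.exists_of_mem_crossings hd h1 ((hloc.mem_iff hd).1 h1)
        have hlij : l = i ∧ l' = j ∧ f t = 0 := by
          rcases hcase with ⟨rfl, rfl⟩ | ⟨rfl, rfl⟩ <;> fin_cases l <;> fin_cases l' <;>
            first
              | exact absurd hll (lt_irrefl _)
              | exact absurd hll hij.not_gt
              | exact ⟨rfl, rfl, h0⟩
              | exact ⟨rfl, rfl, h0.symm⟩
        obtain ⟨rfl, rfl, h0⟩ := hlij
        rcases (hf0 ht).1 h0 with rfl | rfl
        · exact Or.inl rfl
        · exact Or.inr (Or.inl rfl)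
      · exact Or.inr (Or.inr (hloc.mem_crossings hd h1))
    · rintro (rfl | rfl | hd)
      · exact hcm1
      · exact hcm2
      · exact hloc.symm.mem_crossings hd (hD'off hd)
  have hcne1 : (c p₁).1 ≠ (c p₂).1 := hD.strandPoint_ne i hc1 hc2 hp12.ne
  have hcne2 : (c p₁).2 ≠ (c p₂).2 := hD.strandPoint_ne j hc1 hc2 hp12.ne
  have hn2 : c p₂ ∉ D'.crossings := fun h => hD'off h (hK hc2)
  have hn1 : c p₁ ∉ insert (c p₂) D'.crossings := by
    rw [Finset.mem_insert, not_or]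
    exact ⟨fun h => hcne1 (congrArg Prod.fst h), fun h => hD'off h (hK hc1)⟩
  have hsign : D.crossingSign (c p₁) = -D.crossingSign (c p₂) := by
    obtain ⟨m, n, hm, hn, hmn, hs⟩ := hD.crossingSign_eq hij hI1 (heq (Or.inl rfl))
    obtain ⟨m', n', hm', hn', hmn', hs'⟩ := hD.crossingSign_eq hij hI2 (heq (Or.inr rfl))
    have hsg : SignType.sign (n - m) = -SignType.sign (n' - m') := by
      rcases hcase with ⟨rfl, rfl⟩ | ⟨rfl, rfl⟩
      · have e1 : m = 0 := hm.unique (hasDerivAt_const _ _)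
        have e2 : m' = 0 := hm'.unique (hasDerivAt_const _ _)
        subst e1 e2
        have e3 := hderiv1 hn hmn.symm
        have e4 := hderiv2 hn' hmn'.symm
        rw [sub_zero, sub_zero, sign_neg e3, sign_pos e4]
      · have e1 : n = 0 := hn.unique (hasDerivAt_const _ _)
        have e2 : n' = 0 := hn'.unique (hasDerivAt_const _ _)
        subst e1 e2
        have e3 := hderiv1 hm hmn
        have e4 := hderiv2 hm' hmn'
        rw [zero_sub, zero_sub, sign_pos (by linarith), sign_neg (by linarith), neg_neg]
    simp only [c, hs, hs', hsg, SignType.coe_neg]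
    ring
  have hpar : D.arrowTerm (c p₁) (c p₂) = 0 := by
    have m1 := (hX.mem_iff i _).2 (hD.strandPoint_mem i hc1)
    have m2 := (hX.mem_iff i _).2 (hD.strandPoint_mem i hc2)
    have n1 := (hX.mem_iff j _).2 (hD.strandPoint_mem j hc1)
    have n2 := (hX.mem_iff j _).2 (hD.strandPoint_mem j hc2)
    exact KnotDiagram.arrowTerm_eq_zero_of_parallel hp hcm1 hcm2 hcne1 hcne2 m1 m2 n1 n2
      (hconst' i _ m1 _ m2) (hconst' j _ n1 _ n2) (hX.disjoint_or (hD.disj i j hne))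
  have hcancel : ∀ d ∈ D'.crossings, D.signedTerm s(c p₁, d) = -D.signedTerm s(c p₂, d) := by
    intro d hd
    have hdK := hD'off hd
    have hdD := hloc.symm.mem_crossings hd hdK
    have h1 : D.arrowTerm (c p₁) d = D.arrowTerm (c p₂) d :=
      KnotDiagram.arrowTerm_congr hX hD.disj hp hp hconst' hne hcm1 hcm2 hdD hdD
        (hD.strandPoint_mem i hc1) (hD.strandPoint_mem i hc2) (hD.strandPoint_mem j hc1)
        (hD.strandPoint_mem j hc2) hdK fun h => hdK ((hloc.mem_iff hdD).2 h)
    change (D.crossingSign (c p₁) * D.crossingSign d) • D.arrowTerm (c p₁) d =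
      -((D.crossingSign (c p₂) * D.crossingSign d) • D.arrowTerm (c p₂) d)
    rw [h1, hsign, ← neg_smul, neg_mul]
  have hself (t : ℝ) : D.signedTerm s(c t, c t) = 0 := by
    change (D.crossingSign (c t) * D.crossingSign (c t)) • D.arrowTerm (c t) (c t) = 0
    rw [KnotDiagram.arrowTerm_self, smul_zero]
  have h12 : D.signedTerm s(c p₁, c p₂) = 0 := by
    change (D.crossingSign (c p₁) * D.crossingSign (c p₂)) • D.arrowTerm (c p₁) (c p₂) = 0
    rw [hpar, smul_zero]
  rw [KnotDiagram.phi_eq_sum, KnotDiagram.phi_eq_sum, hset, sum_sym2_insert hn1,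
    sum_sym2_insert hn2, Finset.sum_insert hn2, hself, hself, h12, Finset.sum_congr rfl hcancel,
    Finset.sum_neg_distrib, zero_add, zero_add, zero_add, neg_add_cancel_left]
  refine Finset.sum_congr rfl fun q hq => ?_
  induction q using Sym2.ind with
  | _ d d' =>
    rw [Finset.mk_mem_sym2_iff] at hq
    exact (hloc.symm.signedTerm_eq hp' hp hq.1 hq.2 (hD'off hq.1) (hD'off hq.2)).symm

end StrandMoves

/-! ### The geometry of three graphs and the triangle relations. -/

section Triangles

section Graphs

theorem continuousOn_of_contraction {u : ℝ → ℝ}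
    (hu : ∀ s ∈ Set.Icc (-1 : ℝ) 1, ∀ t ∈ Set.Icc (-1 : ℝ) 1, s < t → |u t - u s| < t - s) :
    ContinuousOn u (Set.Icc (-1) 1) := by
  refine (LipschitzOnWith.of_dist_le_mul (K := 1) fun s hs t ht => ?_).continuousOn
  rw [Real.dist_eq, Real.dist_eq, NNReal.coe_one, one_mul]
  rcases lt_trichotomy s t with h | rfl | h
  · rw [abs_sub_comm, abs_sub_comm s t, abs_of_pos (sub_pos.2 h)]
    exact (hu s hs t ht h).le
  · simp
  · rw [abs_of_pos (sub_pos.2 h)]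
    exact (hu t ht s hs h).le

/-- The intermediate value theorem for `t - u t` gives existence, strict contraction gives
uniqueness. If `a` were on the wrong side of 0, then `|u 0 - u a| ≥ |a|`. -/
theorem exists_fixedPoint {u : ℝ → ℝ} (hb : ∀ t ∈ Set.Icc (-1 : ℝ) 1, |u t| < 1)
    (hu : ∀ s ∈ Set.Icc (-1 : ℝ) 1, ∀ t ∈ Set.Icc (-1 : ℝ) 1, s < t → |u t - u s| < t - s) :
    ∃ a ∈ Set.Ioo (-1 : ℝ) 1, (∀ t ∈ Set.Icc (-1 : ℝ) 1, u t = t ↔ t = a) ∧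
      (0 < u 0 → 0 < a) ∧ (u 0 < 0 → a < 0) := by
  have h0 : (0 : ℝ) ∈ Set.Icc (-1 : ℝ) 1 := by constructor <;> norm_num
  have hl := abs_lt.1 (hb (-1) (by constructor <;> norm_num))
  have hr := abs_lt.1 (hb 1 (by constructor <;> norm_num))
  have hcont : ContinuousOn (fun t => t - u t) (Set.Icc (-1) 1) :=
    continuousOn_id.sub (continuousOn_of_contraction hu)
  obtain ⟨a, ha, hfix⟩ := intermediate_value_Icc (by norm_num : (-1 : ℝ) ≤ 1) hcont
    (show (0 : ℝ) ∈ _ from ⟨by linarith [hl.1], by linarith [hr.2]⟩)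
  have hfix : u a = a := by
    dsimp only at hfix
    linarith
  have hba := abs_lt.1 (hb a ha)
  rw [hfix] at hba
  refine ⟨a, hba, fun t ht => ⟨fun h => ?_, fun h => h ▸ hfix⟩, fun h => ?_, fun h => ?_⟩
  · rcases lt_trichotomy t a with hta | hta | hta
    · have := hu t ht a ha hta
      rw [h, hfix] at this
      exact absurd (le_abs_self _) this.not_ge
    · exact hta
    · have := hu a ha t ht hta
      rw [h, hfix] at this
      exact absurd (le_abs_self _) this.not_ge
  · by_contra! h2
    rcases h2.lt_or_eq with h3 | h3
    · have := (abs_lt.1 (hu a ha 0 h0 h3)).2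
      linarith
    · rw [h3] at hfix
      linarith
  · by_contra! h2
    rcases h2.lt_or_eq with h3 | h3
    · have := (abs_lt.1 (hu 0 h0 a ha h3)).2
      linarith
    · rw [← h3] at hfix
      linarith

theorem abs_deriv_le_one_of_contraction {u : ℝ → ℝ}
    (hu : ∀ s ∈ Set.Icc (-1 : ℝ) 1, ∀ t ∈ Set.Icc (-1 : ℝ) 1, s < t → |u t - u s| < t - s)
    {a m : ℝ} (ha : a ∈ Set.Ioo (-1 : ℝ) 1) (hm : HasDerivAt u m a) : |m| ≤ 1 := by
  refine hm.le_of_lip' zero_le_one ?_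
  filter_upwards [Ioo_mem_nhds ha.1 ha.2] with t ht
  have ht' : t ∈ Set.Icc (-1 : ℝ) 1 := ⟨ht.1.le, ht.2.le⟩
  have ha' : a ∈ Set.Icc (-1 : ℝ) 1 := ⟨ha.1.le, ha.2.le⟩
  rw [one_mul, Real.norm_eq_abs, Real.norm_eq_abs]
  rcases lt_trichotomy t a with h | rfl | h
  · rw [abs_sub_comm, abs_sub_comm t a, abs_of_pos (sub_pos.2 h)]
    exact (hu t ht' a ha' h).le
  · simp
  · rw [abs_of_pos (sub_pos.2 h)]
    exact (hu a ha' t ht' h).le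

/-- The order of the abscissas of the crossings of strand `i` with the strands `l` and `j`, when
the third strand runs below the crossing of the diagonals. -/
def abscissaOrder (i l j : Fin 3) : SignType :=
  -- Representative abscissas for `u 0 < 0`: the third strand meets the rising diagonal left of the
  -- centre and the falling one right of it.
  let τ : Fin 3 → Fin 3 → ℤ := ![![0, 0, -1], ![0, 0, 1], ![-1, 1, 0]]
  SignType.sign (τ i j - τ i l)

/-- The order of the slopes of the strands `i` and `j`. -/
def slopeOrder (i j : Fin 3) : SignType :=
  let σ : Fin 3 → ℤ := ![1, -1, 0]
  SignType.sign (σ j - σ i)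

/-- The sign bookkeeping of the third move, for every way of assigning the top, middle and bottom
levels to the three strands. -/
theorem slopeOrder_mul_abscissaOrder : ∀ T M B : Fin 3, T ≠ M → T ≠ B → M ≠ B →
    slopeOrder T B * slopeOrder M B * abscissaOrder B M T =
      slopeOrder T M * slopeOrder T B * abscissaOrder T B M ∧
    slopeOrder T M * slopeOrder M B * abscissaOrder M T B =
      -(slopeOrder T M * slopeOrder T B * abscissaOrder T B M) ∧
    abscissaOrder T M B = -abscissaOrder T B M ∧ abscissaOrder M B T = -abscissaOrder M T B ∧
    abscissaOrder B T M = -abscissaOrder B M T ∧ abscissaOrder T B M ≠ 0 ∧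
    abscissaOrder M T B ≠ 0 ∧ abscissaOrder B M T ≠ 0 := by
  decide

/-- The abscissas of the crossings of the two diagonals and a third graph. -/
theorem exists_abscissas {u : ℝ → ℝ} (hb : ∀ t ∈ Set.Icc (-1 : ℝ) 1, |u t| < 1)
    (hu : ∀ s ∈ Set.Icc (-1 : ℝ) 1, ∀ t ∈ Set.Icc (-1 : ℝ) 1, s < t → |u t - u s| < t - s)
    (h0 : u 0 ≠ 0) {φ : Fin 3 → ℝ → ℝ} (hφ : φ = ![fun t => t, fun t => -t, u]) :
    ∃ τ : Fin 3 → Fin 3 → ℝ,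
      (∀ i j, i ≠ j → τ i j ∈ Set.Ioo (-1 : ℝ) 1 ∧
        ∀ t ∈ Set.Icc (-1 : ℝ) 1, φ i t = φ j t ↔ t = τ i j) ∧
      (∀ i l j, i ≠ j → i ≠ l → l ≠ j →
        SignType.sign (τ i j - τ i l) = -SignType.sign (u 0) * abscissaOrder i l j) ∧
      ∀ i j, i ≠ j → ∀ mi mj, HasDerivAt (φ i) mi (τ i j) → HasDerivAt (φ j) mj (τ i j) →
        mi ≠ mj → SignType.sign (mj - mi) = slopeOrder i j := by
  subst hφ
  obtain ⟨a, ha, hfa, hpa, hna⟩ := exists_fixedPoint hb hu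
  -- A crossing with the falling diagonal is a fixed point of `-u`.
  obtain ⟨b, hbI, hfb, hpb, hnb⟩ := exists_fixedPoint (u := fun t => -u t)
    (fun t ht => by rw [abs_neg]; exact hb t ht)
    (fun s hs t ht hst => by
      rw [← abs_neg, show -(-u t - -u s) = u t - u s by ring]
      exact hu s hs t ht hst)
  have hzero : (0 : ℝ) ∈ Set.Ioo (-1 : ℝ) 1 := by constructor <;> norm_num
  refine ⟨![![0, 0, a], ![0, 0, b], ![a, b, 0]], ?_, ?_, ?_⟩
  · intro i j hij
    fin_cases i <;> fin_cases j <;> first | exact absurd rfl hij | skip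
    · exact ⟨hzero, fun t _ => by simp [eq_neg_iff_add_eq_zero, ← two_mul]⟩
    · exact ⟨ha, fun t ht => eq_comm.trans (hfa t ht)⟩
    · exact ⟨hzero, fun t _ => by simp [neg_eq_iff_add_eq_zero, ← two_mul]⟩
    · refine ⟨hbI, fun t ht => Iff.trans ?_ (hfb t ht)⟩
      exact ⟨fun h => by simp at h; linarith, fun h => by simp; linarith⟩
    · exact ⟨ha, fun t ht => hfa t ht⟩
    · refine ⟨hbI, fun t ht => Iff.trans ?_ (hfb t ht)⟩
      exact ⟨fun h => by simp at h; linarith, fun h => by simp; linarith⟩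
  · intro i l j hij hil hlj
    rcases lt_or_gt_of_ne h0 with h | h
    · have h1 := hna h
      have h2 := hpb (by linarith)
      rw [sign_neg h]
      fin_cases i <;> fin_cases l <;> fin_cases j <;>
        first
          | exact absurd rfl hij
          | exact absurd rfl hil
          | exact absurd rfl hlj
          | exact (sign_pos (by simp; linarith)).trans (by decide)
          | exact (sign_neg (by simp; linarith)).trans (by decide)
    · have h1 := hpa h
      have h2 := hnb (by linarith)
      rw [sign_pos h]
      fin_cases i <;> fin_cases l <;> fin_cases j <;>
        first
          | exact absurd rfl hij
          | exact absurd rfl hil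
          | exact absurd rfl hlj
          | exact (sign_pos (by simp; linarith)).trans (by decide)
          | exact (sign_neg (by simp; linarith)).trans (by decide)
  · have hid (t m : ℝ) (h : HasDerivAt (fun t : ℝ => t) m t) : m = 1 := h.unique (hasDerivAt_id' t)
    have hneg (t m : ℝ) (h : HasDerivAt (fun t : ℝ => -t) m t) : m = -1 :=
      h.unique (hasDerivAt_neg t)
    have hm (t m : ℝ) (ht : t ∈ Set.Ioo (-1 : ℝ) 1) (h : HasDerivAt u m t) : -1 ≤ m ∧ m ≤ 1 :=
      abs_le.1 (abs_deriv_le_one_of_contraction hu ht h)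
    intro i j hij mi mj hi hj hne
    fin_cases i <;> fin_cases j <;> first | exact absurd rfl hij | skip
    · rw [hid _ _ hi, hneg _ _ hj]
      exact (sign_neg (by norm_num)).trans (by decide)
    · have e1 := hid _ _ hi
      have e2 := (hm a _ ha hj).2
      subst e1
      exact (sign_neg (sub_neg.2 (lt_of_le_of_ne e2 hne.symm))).trans (by decide)
    · rw [hneg _ _ hi, hid _ _ hj]
      exact (sign_pos (by norm_num)).trans (by decide)
    · have e1 := hneg _ _ hi
      have e2 := (hm b _ hbI hj).1
      subst e1
      exact (sign_pos (sub_pos.2 (lt_of_le_of_ne e2 hne))).trans (by decide)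
    · have e1 := hid _ _ hj
      have e2 := (hm a _ ha hi).2
      subst e1
      exact (sign_pos (sub_pos.2 (lt_of_le_of_ne e2 hne))).trans (by decide)
    · have e1 := hneg _ _ hj
      have e2 := (hm b _ hbI hi).1
      subst e1
      exact (sign_neg (sub_neg.2 (lt_of_le_of_ne e2 hne.symm))).trans (by decide)

end Graphs

section Relations

variable {S : Type u} [TopologicalSpace S]

/-- The relation met when the knot visits the strands in the cyclic order top, middle, bottom: `γ`,
`β`, `α` are the classes of the arcs from top to middle, middle to bottom and bottom to top.
`toGroup_triangle_right` serves for the other order. -/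
theorem toGroup_triangle_left (α β γ : H1 S) :
    toGroup ⟨β, s((γ, .tailToHead), (α, .headToTail))⟩ +
      toGroup ⟨γ, s((α, .headToTail), (β, .tailToHead))⟩ =
      toGroup ⟨α, s((β, .tailToHead), (γ, .tailToHead))⟩ := by
  rw [← sub_eq_zero, Sym2.eq_swap (a := (γ, ArrowDir.tailToHead))]
  exact (QuotientAddGroup.eq_zero_iff _).2
    (AddSubgroup.subset_closure (LabelledDiagram.Relator.triangle_left α β γ))

theorem toGroup_triangle_right (α β γ : H1 S) :
    toGroup ⟨β, s((γ, .tailToHead), (α, .headToTail))⟩ +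
      toGroup ⟨α, s((β, .headToTail), (γ, .tailToHead))⟩ =
      toGroup ⟨γ, s((α, .headToTail), (β, .headToTail))⟩ := by
  rw [← sub_eq_zero, Sym2.eq_swap (a := (γ, ArrowDir.tailToHead))]
  exact (QuotientAddGroup.eq_zero_iff _).2
    (AddSubgroup.subset_closure (LabelledDiagram.Relator.triangle_right α β γ))

end Relations

end Triangles

/-! ### Two crossings on one strand of a triangle. -/

section TriangleMoves

variable {S : Type u} [TopologicalSpace S] [ChartedSpace Plane S]

/-- The crossing of the strands `i` and `j` at abscissa `t`, the upper strand first. -/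
def strandCrossing {k : ℕ} (x : Fin k → UnitAddCircle) (r dir : Fin k → ℝ) (height : Fin k → ℕ)
    (i j : Fin k) (t : ℝ) : UnitAddCircle × UnitAddCircle :=
  if height j < height i then (strandPoint x r dir i t, strandPoint x r dir j t)
  else (strandPoint x r dir j t, strandPoint x r dir i t)

namespace Strands

variable {k : ℕ} {φ φ' : Fin k → ℝ → ℝ} {D D' : KnotDiagram S}
  {e : OpenPartialHomeomorph S Plane} {x : Fin k → UnitAddCircle} {r dir : Fin k → ℝ}
  {height : Fin k → ℕ}

theorem strandCrossing_comm (h : Strands φ D e x r dir height) {i j : Fin k} (hij : i ≠ j) (t : ℝ) :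
    strandCrossing x r dir height i j t = strandCrossing x r dir height j i t := by
  unfold strandCrossing
  rcases lt_or_gt_of_ne (fun h' => hij (h.height_inj h')) with h' | h'
  · rw [if_neg h'.not_gt, if_pos h']
  · rw [if_pos h', if_neg h'.not_gt]

theorem mul_dir_mem (h : Strands φ D e x r dir height) (i : Fin k) (y : ℝ) {t : ℝ}
    (ht : t ∈ Set.Icc (-1 : ℝ) 1) :
    y + r i * (dir i * t) ∈ Set.Icc (y - r i) (y + r i) := by
  have h1 := h.dir_mul_mem i ht
  have h2 := h.pos i
  constructor <;> nlinarith [h1.1, h1.2]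

/-- The two crossings on strand `i` with the next strand `j` and the previous strand `l`. -/
theorem arrowTerm_eq_ite (h : Strands φ D e x r dir height) {p : ℝ → ChainClass S}
    (hp : IsPotential D.realCurve p) {i j l : Fin k} (hil : i ≠ l)
    {yi yj yl : ℝ} {Pi Pj Pl : ChainClass S} (hyi : (yi : UnitAddCircle) = x i)
    (hyj : (yj : UnitAddCircle) = x j) (hyl : (yl : UnitAddCircle) = x l)
    (hPi : ∀ u ∈ Set.Icc (yi - r i) (yi + r i), p u = Pi)
    (hPj : ∀ u ∈ Set.Icc (yj - r j) (yj + r j), p u = Pj)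
    (hPl : ∀ u ∈ Set.Icc (yl - r l) (yl + r l), p u = Pl)
    (hyij : yi + r i < yj - r j) (hyjl : yj + r j < yl - r l)
    (hyli : yl + r l < yi - r i + 1) {s t : ℝ} (hs : s ∈ Set.Icc (-1 : ℝ) 1)
    (ht : t ∈ Set.Icc (-1 : ℝ) 1) (hst : s ≠ t)
    (hcs : strandCrossing x r dir height i l s ∈ D.crossings)
    (hct : strandCrossing x r dir height i j t ∈ D.crossings) :
    D.arrowTerm (strandCrossing x r dir height i j t) (strandCrossing x r dir height i l s) =
      if dir i * s < dir i * t then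
        toGroup ⟨homologyOf (Pl - Pj),
          s((homologyOf (Pj - Pi), KnotDiagram.dirOf (decide (height j < height i))),
            (homologyOf (Pi + (p 1 - p 0) - Pl),
              KnotDiagram.dirOf (decide (height i < height l))))⟩
      else 0 := by
  have hpt {a : Fin k} {y : ℝ} (ha : (y : UnitAddCircle) = x a) (t : ℝ) :
      strandPoint x r dir a t = ((y + r a * (dir a * t) : ℝ) : UnitAddCircle) := by
    rw [strandPoint, ← ha, ← AddCircle.coe_add]
  have hct' : strandCrossing x r dir height i j t =
      KnotDiagram.arrowBetween (decide (height j < height i)) (yi + r i * (dir i * t))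
        (yj + r j * (dir j * t)) := by
    simp only [strandCrossing, KnotDiagram.arrowBetween, hpt hyi, hpt hyj, decide_eq_true_eq]
  have hcs' : strandCrossing x r dir height i l s =
      KnotDiagram.arrowBetween (decide (height l < height i)) (yi + r i * (dir i * s))
        (yl + r l * (dir l * s)) := by
    simp only [strandCrossing, KnotDiagram.arrowBetween, hpt hyi, hpt hyl, decide_eq_true_eq]
  have hcs'' : strandCrossing x r dir height i l s =
      KnotDiagram.arrowBetween (decide (height i < height l)) (yl + r l * (dir l * s))
        (yi + r i * (dir i * s)) := by
    rw [h.strandCrossing_comm hil]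
    simp only [strandCrossing, KnotDiagram.arrowBetween, hpt hyi, hpt hyl, decide_eq_true_eq]
  have mis := h.mul_dir_mem i yi hs
  have mit := h.mul_dir_mem i yi ht
  have mjt := h.mul_dir_mem j yj ht
  have mls := h.mul_dir_mem l yl hs
  have hri := h.pos i
  -- In the first case the ends occur in the order `s` on `i`, `t` on `i`, `t` on `j`, `s` on `l`,
  -- so the arrows are nested. Otherwise the two ends on strand `i` are exchanged and the arrows
  -- intersect.
  split_ifs with hlt
  · have hlt' := mul_lt_mul_of_pos_left hlt hri
    rw [hct'] at hct ⊢
    rw [hcs''] at hcs ⊢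
    rw [KnotDiagram.arrowTerm_of_nested hp (by linarith) (by linarith [mit.2, mjt.1])
      (by linarith [mjt.2, mls.1]) (by linarith [mls.2, mis.1]) _ _ hct hcs, hp.period,
      hPi _ mis, hPi _ mit, hPj _ mjt, hPl _ mls, sub_self, add_zero]
  · have hne : dir i * s ≠ dir i * t := by
      rcases h.dir_eq i with hd | hd <;> rw [hd]
      · simpa using hst
      · simpa using hst
    have hlt' := mul_lt_mul_of_pos_left (lt_of_le_of_ne (not_lt.1 hlt) hne.symm) hri
    rw [hct', hcs']
    exact KnotDiagram.arrowTerm_of_crossing (by linarith) (by linarith [mis.2, mjt.1])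
      (by linarith [mjt.2, mls.1]) (by linarith [mls.2, mit.1]) _ _

/-- The change of the contribution of the two crossings on strand `i`, when their order is
reversed. -/
theorem arrowTerm_sub (h : Strands φ D e x r dir height) (h' : Strands φ' D' e x r dir height)
    {p : ℝ → ChainClass S}
    (hp : IsPotential D.realCurve p) (hp' : IsPotential D'.realCurve p) {i j l : Fin k}
    (hil : i ≠ l)
    {yi yj yl : ℝ} {Pi Pj Pl : ChainClass S} (hyi : (yi : UnitAddCircle) = x i)
    (hyj : (yj : UnitAddCircle) = x j) (hyl : (yl : UnitAddCircle) = x l)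
    (hPi : ∀ u ∈ Set.Icc (yi - r i) (yi + r i), p u = Pi)
    (hPj : ∀ u ∈ Set.Icc (yj - r j) (yj + r j), p u = Pj)
    (hPl : ∀ u ∈ Set.Icc (yl - r l) (yl + r l), p u = Pl)
    (hyij : yi + r i < yj - r j) (hyjl : yj + r j < yl - r l)
    (hyli : yl + r l < yi - r i + 1) {s t s' t' : ℝ} (hs : s ∈ Set.Icc (-1 : ℝ) 1)
    (ht : t ∈ Set.Icc (-1 : ℝ) 1) (hs' : s' ∈ Set.Icc (-1 : ℝ) 1) (ht' : t' ∈ Set.Icc (-1 : ℝ) 1)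
    {η : SignType} (hη : η ≠ 0) (hst : SignType.sign (t - s) = η)
    (hst' : SignType.sign (t' - s') = -η)
    (hcs : strandCrossing x r dir height i l s ∈ D.crossings)
    (hct : strandCrossing x r dir height i j t ∈ D.crossings)
    (hcs' : strandCrossing x r dir height i l s' ∈ D'.crossings)
    (hct' : strandCrossing x r dir height i j t' ∈ D'.crossings) :
    D.arrowTerm (strandCrossing x r dir height i j t) (strandCrossing x r dir height i l s) -
      D'.arrowTerm (strandCrossing x r dir height i j t') (strandCrossing x r dir height i l s') =
      (dirSign dir i * η) •
        toGroup ⟨homologyOf (Pl - Pj),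
          s((homologyOf (Pj - Pi), KnotDiagram.dirOf (decide (height j < height i))),
            (homologyOf (Pi + (p 1 - p 0) - Pl),
              KnotDiagram.dirOf (decide (height i < height l))))⟩ := by
  have hne : s ≠ t := by
    rintro rfl
    rw [sub_self, sign_zero] at hst
    exact hη hst.symm
  have hne' : s' ≠ t' := by
    rintro rfl
    rw [sub_self, sign_zero] at hst'
    exact hη (by rw [← neg_neg η, ← hst', neg_zero])
  rw [h.arrowTerm_eq_ite hp hil hyi hyj hyl hPi hPj hPl hyij hyjl hyli hs ht hne hcs hct,
    h'.arrowTerm_eq_ite hp' hil hyi hyj hyl hPi hPj hPl hyij hyjl hyli hs' ht' hne' hcs' hct']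
  -- Since the order on strand `i` is reversed, the arrows are nested in exactly one of the two
  -- diagrams.
  have hcases : (s < t ∧ t' < s' ∧ η = 1) ∨ (t < s ∧ s' < t' ∧ η = -1) := by
    rcases lt_or_gt_of_ne hne with h1 | h1
    · rw [sign_pos (sub_pos.2 h1)] at hst
      rw [← hst, sign_eq_neg_one_iff, sub_neg] at hst'
      exact Or.inl ⟨h1, hst', hst.symm⟩
    · rw [sign_neg (sub_neg.2 h1)] at hst
      rw [← hst, neg_neg, sign_eq_one_iff, sub_pos] at hst'
      exact Or.inr ⟨h1, hst', hst.symm⟩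
  rcases hcases with ⟨h1, h2, rfl⟩ | ⟨h1, h2, rfl⟩ <;> rcases h.dir_eq i with hd | hd <;>
    simp [dirSign, hd, h1, h2, h1.not_gt, h2.not_gt]

end Strands

namespace KnotDiagram

theorem phi_eq_of_insert {D : KnotDiagram S} {c₁ c₂ c₃ : UnitAddCircle × UnitAddCircle}
    {R : Finset (UnitAddCircle × UnitAddCircle)} [DecidableEq (UnitAddCircle × UnitAddCircle)]
    (h : D.crossings = insert c₁ (insert c₂ (insert c₃ R)))
    (h₁ : c₁ ∉ insert c₂ (insert c₃ R)) (h₂ : c₂ ∉ insert c₃ R) (h₃ : c₃ ∉ R) :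
    D.phi = (D.signedTerm s(c₁, c₂) + D.signedTerm s(c₁, c₃) + D.signedTerm s(c₂, c₃)) +
      ∑ d ∈ R, (D.signedTerm s(c₁, d) + D.signedTerm s(c₂, d) + D.signedTerm s(c₃, d)) +
      ∑ q ∈ R.sym2, D.signedTerm q := by
  have hself (c) : D.signedTerm s(c, c) = 0 := by
    change (D.crossingSign c * D.crossingSign c) • D.arrowTerm c c = 0
    rw [arrowTerm_self, smul_zero]
  rw [phi_eq_sum, h, sum_sym2_insert h₁, sum_sym2_insert h₂, sum_sym2_insert h₃,
    Finset.sum_insert h₂, Finset.sum_insert h₃, Finset.sum_insert h₃, hself, hself, hself,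
    Finset.sum_add_distrib, Finset.sum_add_distrib]
  abel

end KnotDiagram

/-- Three disjoint intervals on a circle of length one can be lifted to the line in their cyclic
order, starting from the first one. -/
theorem exists_cyclic_lift {b X₁ X₂ X₃ r₁ r₂ r₃ : ℝ} (h₁ : b < X₁ - r₁ ∧ X₁ + r₁ < b + 1)
    (h₂ : b < X₂ - r₂ ∧ X₂ + r₂ < b + 1) (h₃ : b < X₃ - r₃ ∧ X₃ + r₃ < b + 1)
    (h₁₂ : X₁ + r₁ < X₂ - r₂ ∨ X₂ + r₂ < X₁ - r₁) (h₁₃ : X₁ + r₁ < X₃ - r₃ ∨ X₃ + r₃ < X₁ - r₁)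
    (h₂₃ : X₂ + r₂ < X₃ - r₃ ∨ X₃ + r₃ < X₂ - r₂) :
    ∃ y₂ y₃ : ℝ, (y₂ = X₂ ∨ y₂ = X₂ + 1) ∧ (y₃ = X₃ ∨ y₃ = X₃ + 1) ∧
      ((X₁ + r₁ < y₂ - r₂ ∧ y₂ + r₂ < y₃ - r₃ ∧ y₃ + r₃ < X₁ - r₁ + 1) ∨
        (X₁ + r₁ < y₃ - r₃ ∧ y₃ + r₃ < y₂ - r₂ ∧ y₂ + r₂ < X₁ - r₁ + 1)) := by
  rcases h₁₂ with h | h <;> rcases h₁₃ with h' | h'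
  · refine ⟨X₂, X₃, Or.inl rfl, Or.inl rfl, ?_⟩
    rcases h₂₃ with h'' | h''
    · left; refine ⟨h, h'', by linarith⟩
    · right; refine ⟨h', h'', by linarith⟩
  · refine ⟨X₂, X₃ + 1, Or.inl rfl, Or.inr rfl, ?_⟩
    left; refine ⟨h, by linarith, by linarith⟩
  · refine ⟨X₂ + 1, X₃, Or.inr rfl, Or.inl rfl, ?_⟩
    right; refine ⟨h', by linarith, by linarith⟩
  · refine ⟨X₂ + 1, X₃ + 1, Or.inr rfl, Or.inr rfl, ?_⟩
    rcases h₂₃ with h'' | h''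
    · left; refine ⟨by linarith, by linarith, by linarith⟩
    · right; refine ⟨by linarith, by linarith, by linarith⟩

end TriangleMoves

/-! ### The third Reidemeister move. -/

section ThirdMove

/-- Here `δ` stands for directions of strands, `ρ` for orders of slopes, `κ` for orders of
abscissas. Once the squares of the `δ` cancel, `gT` and `gB` have the same coefficient and `gM` the
opposite one, so the total change is a multiple of `gT + gB - gM`. -/
theorem smul_add_smul_add_smul_eq {M : Type*} [AddCommGroup M] {xT xT' xM xM' xB xB' gT gM gB : M}
    {δT δM δB κT κM κB ρTM ρTB ρMB : ℤ} (hT : xT - xT' = (δT * κT) • gT)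
    (hM : xM - xM' = (δM * κM) • gM) (hB : xB - xB' = (δB * κB) • gB) (hrel : gT + gB = gM)
    (hδT : δT * δT = 1) (hδM : δM * δM = 1) (hδB : δB * δB = 1)
    (h1 : ρTB * ρMB * κB = ρTM * ρTB * κT) (h2 : ρTM * ρMB * κM = -(ρTM * ρTB * κT)) :
    (δT * δM * ρTM * (δT * δB * ρTB)) • xT + (δT * δM * ρTM * (δM * δB * ρMB)) • xM +
        (δT * δB * ρTB * (δM * δB * ρMB)) • xB =
      (δT * δM * ρTM * (δT * δB * ρTB)) • xT' + (δT * δM * ρTM * (δM * δB * ρMB)) • xM' +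
        (δT * δB * ρTB * (δM * δB * ρMB)) • xB' := by
  rw [sub_eq_iff_eq_add] at hT hM hB
  rw [hT, hM, hB, ← hrel]
  simp only [smul_add, smul_smul]
  have e1 : δT * δM * ρTM * (δT * δB * ρTB) * (δT * κT) =
      δT * δM * δB * (ρTM * ρTB * κT) := by
    linear_combination (δT * δM * δB * ρTM * ρTB * κT) * hδT
  have e2 : δT * δM * ρTM * (δM * δB * ρMB) * (δM * κM) =
      -(δT * δM * δB * (ρTM * ρTB * κT)) := by
    linear_combination (δT * δM * δB * ρTM * ρMB * κM) * hδM + δT * δM * δB * h2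
  have e3 : δT * δB * ρTB * (δM * δB * ρMB) * (δB * κB) =
      δT * δM * δB * (ρTM * ρTB * κT) := by
    linear_combination (δT * δM * δB * ρTB * ρMB * κB) * hδB + δT * δM * δB * h1
  rw [e1, e2, e3, neg_smul, neg_smul]
  abel

variable {S : Type u} [TopologicalSpace S] [ChartedSpace Plane S]

namespace Strands

variable {φ φ' : Fin 3 → ℝ → ℝ} {D D' : KnotDiagram S}
  {e : OpenPartialHomeomorph S Plane} {x : Fin 3 → UnitAddCircle} {r dir : Fin 3 → ℝ}
  {height : Fin 3 → ℕ}

theorem dirSign_mul_self (h : Strands φ D e x r dir height) (i : Fin 3) :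
    dirSign dir i * dirSign dir i = 1 := by
  unfold dirSign
  rcases h.dir_eq i with hd | hd <;> rw [hd] <;> simp

/-- The crossings of a diagram with three pairwise crossing strands in a disc. -/
theorem crossings_eq_insert [DecidableEq (UnitAddCircle × UnitAddCircle)]
    (h : Strands φ D e x r dir height)
    (hloc : LocalMove D D' e (⋃ i, circleArc (x i) (r i))) {τ : Fin 3 → Fin 3 → ℝ}
    (hτ : ∀ i j, i ≠ j → τ i j ∈ Set.Ioo (-1 : ℝ) 1 ∧
      ∀ t ∈ Set.Icc (-1 : ℝ) 1, φ i t = φ j t ↔ t = τ i j)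
    {R : Finset (UnitAddCircle × UnitAddCircle)}
    (hR : ∀ c, c ∈ R ↔ c ∈ D.crossings ∧ c.1 ∉ ⋃ i, circleArc (x i) (r i))
    {T M B : Fin 3} (hTM : height M < height T) (hMB : height B < height M) :
    D.crossings = insert (strandPoint x r dir T (τ T M), strandPoint x r dir M (τ T M))
      (insert (strandPoint x r dir T (τ T B), strandPoint x r dir B (τ T B))
        (insert (strandPoint x r dir M (τ M B), strandPoint x r dir B (τ M B)) R)) ∧
    (strandPoint x r dir T (τ T M), strandPoint x r dir M (τ T M)) ∉
      insert (strandPoint x r dir T (τ T B), strandPoint x r dir B (τ T B))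
        (insert (strandPoint x r dir M (τ M B), strandPoint x r dir B (τ M B)) R) ∧
    (strandPoint x r dir T (τ T B), strandPoint x r dir B (τ T B)) ∉
      insert (strandPoint x r dir M (τ M B), strandPoint x r dir B (τ M B)) R ∧
    (strandPoint x r dir M (τ M B), strandPoint x r dir B (τ M B)) ∉ R := by
  have neTM : T ≠ M := by rintro rfl; exact lt_irrefl _ hTM
  have neMB : M ≠ B := by rintro rfl; exact lt_irrefl _ hMB
  have neTB : T ≠ B := by rintro rfl; exact lt_asymm hTM hMB
  have hIcc {i j : Fin 3} (hij : i ≠ j) : τ i j ∈ Set.Icc (-1 : ℝ) 1 :=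
    ⟨(hτ i j hij).1.1.le, (hτ i j hij).1.2.le⟩
  have hne {i j : Fin 3} (hij : i ≠ j) {s t : ℝ} (hs : s ∈ Set.Icc (-1 : ℝ) 1)
      (ht : t ∈ Set.Icc (-1 : ℝ) 1) : strandPoint x r dir i s ≠ strandPoint x r dir j t := fun heq =>
    Set.disjoint_left.1 (h.disj i j hij) (h.strandPoint_mem i hs) (heq ▸ h.strandPoint_mem j ht)
  have hnR {i j : Fin 3} {t : ℝ} (ht : t ∈ Set.Icc (-1 : ℝ) 1) :
      (strandPoint x r dir i t, strandPoint x r dir j t) ∉ R := fun hc =>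
    ((hR _).1 hc).2 (Set.mem_iUnion.2 ⟨i, h.strandPoint_mem i ht⟩)
  have hmem {i j : Fin 3} (hij : i ≠ j) (hh : height j < height i) :
      (strandPoint x r dir i (τ i j), strandPoint x r dir j (τ i j)) ∈ D.crossings :=
    h.mem_crossings hh (hIcc hij) (((hτ i j hij).2 _ (hIcc hij)).2 rfl)
  refine ⟨?_, ?_, ?_, hnR (hIcc neMB)⟩
  · ext c
    simp only [Finset.mem_insert]
    constructor
    · intro hc
      by_cases hK : c.1 ∈ ⋃ i, circleArc (x i) (r i)
      · obtain ⟨i, j, t, hji, ht, heq, rfl⟩ :=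
          h.exists_of_mem_crossings hc hK ((hloc.mem_iff hc).1 hK)
        have hij : i ≠ j := by rintro rfl; exact lt_irrefl _ hji
        have htτ := ((hτ i j hij).2 t ht).1 heq
        subst htτ
        have hall : ∀ T M B i : Fin 3, T ≠ M → M ≠ B → T ≠ B → i = T ∨ i = M ∨ i = B := by decide
        rcases hall T M B i neTM neMB neTB with rfl | rfl | rfl <;>
        rcases hall _ _ _ j neTM neMB neTB with rfl | rfl | rfl <;>
          first
            | exact absurd rfl hij
            | exact Or.inl rfl
            | exact Or.inr (Or.inl rfl)
            | exact Or.inr (Or.inr (Or.inl rfl))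
            | omega
      · exact Or.inr (Or.inr (Or.inr ((hR c).2 ⟨hc, hK⟩)))
    · rintro (rfl | rfl | rfl | hc)
      · exact hmem neTM hTM
      · exact hmem neTB (hMB.trans hTM)
      · exact hmem neMB hMB
      · exact ((hR c).1 hc).1
  · simp only [Finset.mem_insert, not_or]
    exact ⟨fun hc => hne neMB (hIcc neTM) (hIcc neTB) (congrArg Prod.snd hc),
      fun hc => hne neTM (hIcc neTM) (hIcc neMB) (congrArg Prod.fst hc), hnR (hIcc neTM)⟩
  · simp only [Finset.mem_insert, not_or]
    exact ⟨fun hc => hne neTM (hIcc neTB) (hIcc neMB) (congrArg Prod.fst hc), hnR (hIcc neTB)⟩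

end Strands

theorem exists_height_order {height : Fin 3 → ℕ} (h : Function.Injective height) :
    ∃ T M B : Fin 3, height M < height T ∧ height B < height M := by
  rcases lt_or_gt_of_ne (fun h' => absurd (h h') (by decide) : height 0 ≠ height 1) with h1 | h1 <;>
  rcases lt_or_gt_of_ne (fun h' => absurd (h h') (by decide) : height 0 ≠ height 2) with h2 | h2 <;>
  rcases lt_or_gt_of_ne (fun h' => absurd (h h') (by decide) : height 1 ≠ height 2) with h3 | h3
  · exact ⟨2, 1, 0, h3, h1⟩
  · exact ⟨1, 2, 0, h3, h2⟩
  · omega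
  · exact ⟨1, 0, 2, h1, h2⟩
  · exact ⟨2, 0, 1, h2, h1⟩
  · omega
  · exact ⟨0, 2, 1, h2, h3⟩
  · exact ⟨0, 1, 2, h1, h3⟩

/-- With strands `T`, `M`, `B` from top to bottom, the sum splits into the pairs inside the triangle
(`hcore`), the mixed pairs (`hterm`) and the pairs outside. Only the first kind uses the triangle
relations. -/
theorem phi_eq_of_r3Move [T2Space S] [IsManifold (𝓡 2) ∞ S] {D D' : KnotDiagram S}
    (hmove : R3Move D D') : D.phi = D'.phi := by
  classical
  obtain ⟨f, g, hf0, hg0, hb, hlip, hmove⟩ := hmove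
  generalize hφ : (![fun t => t, fun t => -t, f] : Fin 3 → ℝ → ℝ) = φ at hmove
  generalize hφ' : (![fun t => t, fun t => -t, g] : Fin 3 → ℝ → ℝ) = φ' at hmove
  obtain ⟨τ, hτ, hτo, hτs⟩ := exists_abscissas (fun t ht => (hb t ht).1)
    (fun s hs t ht hst => (hlip s hs t ht hst).1) hf0.ne hφ.symm
  obtain ⟨τ', hτ', hτo', hτs'⟩ := exists_abscissas (fun t ht => (hb t ht).2)
    (fun s hs t ht hst => (hlip s hs t ht hst).2) hg0.ne' hφ'.symm
  -- As `f 0 < 0 < g 0`, the orders of the two crossings on any strand are opposite in `D` and `D'`.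
  rw [sign_neg hf0, neg_neg] at hτo
  rw [sign_pos hg0] at hτo'
  simp only [one_mul] at hτo
  simp only [neg_mul, one_mul] at hτo'
  have hbound (u : ℝ → ℝ) (hu : ∀ t ∈ Set.Icc (-1 : ℝ) 1, |u t| < 1) (i : Fin 3) (t : ℝ)
      (ht : t ∈ Set.Icc (-1 : ℝ) 1) : |(![fun t => t, fun t => -t, u] : Fin 3 → ℝ → ℝ) i t| ≤ 1 := by
    fin_cases i
    · exact abs_le.2 ht
    · exact (abs_neg t).trans_le (abs_le.2 ht)
    · exact (hu t ht).le
  obtain ⟨e, x, r, dir, height, b, X, p, hD, hD', hloc, hX, hp, hp', hconst⟩ :=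
    hmove.exists_setup (i := 0) (j := 1) (by decide)
      (hφ ▸ hbound f fun t ht => (hb t ht).1) (hφ' ▸ hbound g fun t ht => (hb t ht).2)
  obtain ⟨T, M, B, hTM, hMB⟩ := exists_height_order hD.height_inj
  have hTB := hMB.trans hTM
  have neTM : T ≠ M := by rintro rfl; exact lt_irrefl _ hTM
  have neMB : M ≠ B := by rintro rfl; exact lt_irrefl _ hMB
  have neTB : T ≠ B := by rintro rfl; exact lt_irrefl _ hTB
  have hIcc {i j : Fin 3} (hij : i ≠ j) : τ i j ∈ Set.Icc (-1 : ℝ) 1 :=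
    ⟨(hτ i j hij).1.1.le, (hτ i j hij).1.2.le⟩
  have hIcc' {i j : Fin 3} (hij : i ≠ j) : τ' i j ∈ Set.Icc (-1 : ℝ) 1 :=
    ⟨(hτ' i j hij).1.1.le, (hτ' i j hij).1.2.le⟩
  have hφτ {i j : Fin 3} (hij : i ≠ j) : φ i (τ i j) = φ j (τ i j) :=
    ((hτ i j hij).2 _ (hIcc hij)).2 rfl
  have hφτ' {i j : Fin 3} (hij : i ≠ j) : φ' i (τ' i j) = φ' j (τ' i j) :=
    ((hτ' i j hij).2 _ (hIcc' hij)).2 rfl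
  have hsymm {i j : Fin 3} (hij : i ≠ j) : τ i j = τ j i :=
    ((hτ j i hij.symm).2 _ (hIcc hij)).1 (hφτ hij).symm
  have hsymm' {i j : Fin 3} (hij : i ≠ j) : τ' i j = τ' j i :=
    ((hτ' j i hij.symm).2 _ (hIcc' hij)).1 (hφτ' hij).symm
  let c (i j : Fin 3) := strandCrossing x r dir height i j (τ i j)
  let c' (i j : Fin 3) := strandCrossing x r dir height i j (τ' i j)
  have hcomm {i j : Fin 3} (hij : i ≠ j) : c i j = c j i := by
    simp only [c]
    rw [hD.strandCrossing_comm hij, hsymm hij]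
  have hcomm' {i j : Fin 3} (hij : i ≠ j) : c' i j = c' j i := by
    simp only [c']
    rw [hD.strandCrossing_comm hij, hsymm' hij]
  have hmem {i j : Fin 3} (hij : i ≠ j) : c i j ∈ D.crossings := by
    simp only [c, strandCrossing]
    split_ifs with hh
    · exact hD.mem_crossings hh (hIcc hij) (hφτ hij)
    · exact hD.mem_crossings (lt_of_le_of_ne (not_lt.1 hh) fun h => hij (hD.height_inj h))
        (hIcc hij) (hφτ hij).symm
  have hmem' {i j : Fin 3} (hij : i ≠ j) : c' i j ∈ D'.crossings := by
    simp only [c', strandCrossing]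
    split_ifs with hh
    · exact hD'.mem_crossings hh (hIcc' hij) (hφτ' hij)
    · exact hD'.mem_crossings (lt_of_le_of_ne (not_lt.1 hh) fun h => hij (hD.height_inj h))
        (hIcc' hij) (hφτ' hij).symm
  have hceq {i j : Fin 3} (hh : height j < height i) :
      c i j = (strandPoint x r dir i (τ i j), strandPoint x r dir j (τ i j)) := if_pos hh
  have hceq' {i j : Fin 3} (hh : height j < height i) :
      c' i j = (strandPoint x r dir i (τ' i j), strandPoint x r dir j (τ' i j)) := if_pos hh
  have hsign {i j : Fin 3} (hij : i ≠ j) (hh : height j < height i) : D.crossingSign (c i j) =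
      Strands.dirSign dir i * Strands.dirSign dir j * (slopeOrder i j : SignType) := by
    obtain ⟨mi, mj, hi, hj, hne, hs⟩ := hD.crossingSign_eq hh (hτ i j hij).1 (hφτ hij)
    rw [hceq hh, hs, hτs i j hij mi mj hi hj hne]
  have hsign' {i j : Fin 3} (hij : i ≠ j) (hh : height j < height i) : D'.crossingSign (c' i j) =
      Strands.dirSign dir i * Strands.dirSign dir j * (slopeOrder i j : SignType) := by
    obtain ⟨mi, mj, hi, hj, hne, hs⟩ := hD'.crossingSign_eq hh (hτ' i j hij).1 (hφτ' hij)
    rw [hceq' hh, hs, hτs' i j hij mi mj hi hj hne]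
  have hconst' := fun i => hconst i (X i) (hX.coe i)
  have hQ (i : Fin 3) (y : ℝ) (hy : (y : UnitAddCircle) = x i) :
      ∀ u ∈ Set.Icc (y - r i) (y + r i), p u = p y := fun u hu =>
    hconst i y hy u hu y ⟨by linarith [hX.pos i], by linarith [hX.pos i]⟩
  -- For strand `i`, followed by `j` and preceded by `l` on the knot: the pair of crossings on `i`
  -- changes by one signed diagram.
  have hsub {i j l : Fin 3} (hij : i ≠ j) (hil : i ≠ l) (hlj : l ≠ j)
      (hη : abscissaOrder i l j ≠ 0) {yi yj yl : ℝ} (hyi : (yi : UnitAddCircle) = x i)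
      (hyj : (yj : UnitAddCircle) = x j) (hyl : (yl : UnitAddCircle) = x l)
      (h1 : yi + r i < yj - r j) (h2 : yj + r j < yl - r l) (h3 : yl + r l < yi - r i + 1) :=
    hD.arrowTerm_sub hD' hp hp' hil hyi hyj hyl (hQ i yi hyi) (hQ j yj hyj) (hQ l yl hyl) h1 h2 h3
      (hIcc hil) (hIcc hij) (hIcc' hil) (hIcc' hij) hη (hτo i l j hij hil hlj)
      (hτo' i l j hij hil hlj) (hmem hil) (hmem hij) (hmem' hil) (hmem' hij)
  obtain ⟨id1, id2, idT, idM, idB, nzT, nzM, nzB⟩ :=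
    slopeOrder_mul_abscissaOrder T M B neTM neTB neMB
  have id1' : ((slopeOrder T B : SignType) : ℤ) * (slopeOrder M B : SignType) *
      (abscissaOrder B M T : SignType) = (slopeOrder T M : SignType) * (slopeOrder T B : SignType) *
      (abscissaOrder T B M : SignType) := by exact_mod_cast congrArg (SignType.cast (α := ℤ)) id1
  have id2' : ((slopeOrder T M : SignType) : ℤ) * (slopeOrder M B : SignType) *
      (abscissaOrder M T B : SignType) = -((slopeOrder T M : SignType) *
      (slopeOrder T B : SignType) * (abscissaOrder T B M : SignType)) := by
    exact_mod_cast congrArg (SignType.cast (α := ℤ)) id2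
  have hcore : D.signedTerm s(c T M, c T B) + D.signedTerm s(c T M, c M B) +
      D.signedTerm s(c T B, c M B) = D'.signedTerm s(c' T M, c' T B) +
      D'.signedTerm s(c' T M, c' M B) + D'.signedTerm s(c' T B, c' M B) := by
    change (D.crossingSign (c T M) * D.crossingSign (c T B)) • D.arrowTerm (c T M) (c T B) +
      (D.crossingSign (c T M) * D.crossingSign (c M B)) • D.arrowTerm (c T M) (c M B) +
      (D.crossingSign (c T B) * D.crossingSign (c M B)) • D.arrowTerm (c T B) (c M B) =
      (D'.crossingSign (c' T M) * D'.crossingSign (c' T B)) • D'.arrowTerm (c' T M) (c' T B) +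
      (D'.crossingSign (c' T M) * D'.crossingSign (c' M B)) • D'.arrowTerm (c' T M) (c' M B) +
      (D'.crossingSign (c' T B) * D'.crossingSign (c' M B)) • D'.arrowTerm (c' T B) (c' M B)
    rw [hsign neTM hTM, hsign neTB hTB, hsign neMB hMB, hsign' neTM hTM, hsign' neTB hTB,
      hsign' neMB hMB]
    -- The strands are lifted to the line in the cyclic order in which the knot visits them,
    -- starting from the top strand.
    obtain ⟨yM, yB, hyM, hyB, hcyc⟩ := exists_cyclic_lift ⟨hX.left T, hX.right T⟩
      ⟨hX.left M, hX.right M⟩ ⟨hX.left B, hX.right B⟩ (hX.disjoint_or (hD.disj T M neTM))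
      (hX.disjoint_or (hD.disj T B neTB)) (hX.disjoint_or (hD.disj M B neMB))
    have hcoe {i : Fin 3} {y : ℝ} (hy : y = X i ∨ y = X i + 1) : (y : UnitAddCircle) = x i := by
      rw [← hX.coe i]
      rcases hy with rfl | rfl
      · rfl
      · simp
    have hcoe1 {i : Fin 3} {y : ℝ} (hy : (y : UnitAddCircle) = x i) :
        ((y + 1 : ℝ) : UnitAddCircle) = x i := by
      rw [← hy]
      simp
    have cT := hX.coe T
    have cM := hcoe hyM
    have cB := hcoe hyB
    rcases hcyc with ⟨h1, h2, h3⟩ | ⟨h1, h2, h3⟩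
    -- The cyclic order is rotated so that each strand comes first once; strands already passed are
    -- lifted by one more turn, and the periods cancel in the labels.
    · have kT := hsub neTM neTB neMB.symm nzT cT cM cB h1 h2 h3
      have kM := hsub neMB neTM.symm neTB nzM cM cB (hcoe1 cT) h2 (by linarith) (by linarith)
      have kB := hsub neTB.symm neMB.symm neTM.symm nzB cB (hcoe1 cT) (hcoe1 cM) (by linarith)
        (by linarith) (by linarith)
      rw [hp.period, show p yM + (p 1 - p 0) - (p (X T) + (p 1 - p 0)) = p yM - p (X T) by abel]
        at kM
      rw [hp.period, hp.period, show p yM + (p 1 - p 0) - (p (X T) + (p 1 - p 0)) =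
        p yM - p (X T) by abel, show p yB + (p 1 - p 0) - (p yM + (p 1 - p 0)) = p yB - p yM by abel]
        at kB
      simp only [KnotDiagram.dirOf, hTM, hMB, hTB.not_gt, decide_true, decide_false, if_true,
        Bool.false_eq_true, if_false] at kT kM kB
      change D.arrowTerm (c T M) (c T B) - D'.arrowTerm (c' T M) (c' T B) = _ at kT
      change D.arrowTerm (c M B) (c M T) - D'.arrowTerm (c' M B) (c' M T) = _ at kM
      change D.arrowTerm (c B T) (c B M) - D'.arrowTerm (c' B T) (c' B M) = _ at kB
      rw [KnotDiagram.arrowTerm_comm, D'.arrowTerm_comm, hcomm neTM.symm, hcomm' neTM.symm] at kM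
      rw [hcomm neTB.symm, hcomm neMB.symm, hcomm' neTB.symm, hcomm' neMB.symm] at kB
      exact smul_add_smul_add_smul_eq kT kM kB (toGroup_triangle_left _ _ _)
        (hD.dirSign_mul_self T) (hD.dirSign_mul_self M) (hD.dirSign_mul_self B) id1' id2'
    · have kT := hsub neTB neTM neMB (by rw [idT]; simpa using nzT) cT cB cM h1 h2 h3
      have kB := hsub neMB.symm neTB.symm neTM (by rw [idB]; simpa using nzB) cB cM (hcoe1 cT) h2
        (by linarith) (by linarith)
      have kM := hsub neTM.symm neMB neTB.symm (by rw [idM]; simpa using nzM) cM (hcoe1 cT)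
        (hcoe1 cB) (by linarith) (by linarith) (by linarith)
      rw [hp.period, show p yB + (p 1 - p 0) - (p (X T) + (p 1 - p 0)) = p yB - p (X T) by abel]
        at kB
      rw [hp.period, hp.period, show p yB + (p 1 - p 0) - (p (X T) + (p 1 - p 0)) =
        p yB - p (X T) by abel, show p yM + (p 1 - p 0) - (p yB + (p 1 - p 0)) = p yM - p yB by abel]
        at kM
      simp only [KnotDiagram.dirOf, hTB, hTM.not_gt, hMB.not_gt, decide_true,
        decide_false, if_true, Bool.false_eq_true, if_false] at kT kM kB
      change D.arrowTerm (c T B) (c T M) - D'.arrowTerm (c' T B) (c' T M) = _ at kT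
      change D.arrowTerm (c B M) (c B T) - D'.arrowTerm (c' B M) (c' B T) = _ at kB
      change D.arrowTerm (c M T) (c M B) - D'.arrowTerm (c' M T) (c' M B) = _ at kM
      rw [KnotDiagram.arrowTerm_comm, D'.arrowTerm_comm] at kT
      rw [KnotDiagram.arrowTerm_comm, D'.arrowTerm_comm, hcomm neTB.symm, hcomm' neTB.symm,
        hcomm neMB.symm, hcomm' neMB.symm] at kB
      rw [hcomm neTM.symm, hcomm' neTM.symm] at kM
      -- In the other cyclic order all three abscissa orders change sign, so the sign identities
      -- persist.
      rw [idT, SignType.coe_neg] at kT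
      rw [idM, SignType.coe_neg] at kM
      rw [idB, SignType.coe_neg] at kB
      refine smul_add_smul_add_smul_eq kT kM kB (toGroup_triangle_right _ _ _)
        (hD.dirSign_mul_self T) (hD.dirSign_mul_self M) (hD.dirSign_mul_self B) ?_ ?_
      · rw [mul_neg, mul_neg, id1']
      · rw [mul_neg, mul_neg, id2']
  let R := D.crossings.filter fun d => d.1 ∉ ⋃ i, circleArc (x i) (r i)
  have hR (d) : d ∈ R ↔ d ∈ D.crossings ∧ d.1 ∉ ⋃ i, circleArc (x i) (r i) := Finset.mem_filter
  have hR' (d) : d ∈ R ↔ d ∈ D'.crossings ∧ d.1 ∉ ⋃ i, circleArc (x i) (r i) := by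
    rw [hR]
    exact ⟨fun h => ⟨hloc.mem_crossings h.1 h.2, h.2⟩,
      fun h => ⟨hloc.symm.mem_crossings h.1 h.2, h.2⟩⟩
  -- A crossing in the disc moves only along its two strands, which contain no end of an arrow
  -- outside; signs of slopes are the same in both diagrams.
  have hterm {i j : Fin 3} (hij : i ≠ j) (hh : height j < height i) {d} (hd : d ∈ R) :
      D.signedTerm s(c i j, d) = D'.signedTerm s(c' i j, d) := by
    obtain ⟨hd1, hdK⟩ := (hR d).1 hd
    have hd2 := ((hR' d).1 hd).1
    change (D.crossingSign (c i j) * D.crossingSign d) • D.arrowTerm (c i j) d =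
      (D'.crossingSign (c' i j) * D'.crossingSign d) • D'.arrowTerm (c' i j) d
    rw [hsign hij hh, hsign' hij hh, hloc.crossingSign_eq hd1 hdK]
    congr 1
    refine KnotDiagram.arrowTerm_congr hX hD.disj hp hp' hconst' hij (hmem hij) (hmem' hij) hd1 hd2
      ?_ ?_ ?_ ?_ hdK fun h => hdK ((hloc.mem_iff hd1).2 h)
    · rw [hceq hh]; exact hD.strandPoint_mem i (hIcc hij)
    · rw [hceq' hh]; exact hD.strandPoint_mem i (hIcc' hij)
    · rw [hceq hh]; exact hD.strandPoint_mem j (hIcc hij)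
    · rw [hceq' hh]; exact hD.strandPoint_mem j (hIcc' hij)
  obtain ⟨s0, s1, s2, s3⟩ := hD.crossings_eq_insert hloc hτ hR hTM hMB
  obtain ⟨s0', s1', s2', s3'⟩ := hD'.crossings_eq_insert hloc.symm hτ' hR' hTM hMB
  rw [← hceq hTM, ← hceq hTB, ← hceq hMB] at s0 s1
  rw [← hceq hTB, ← hceq hMB] at s2
  rw [← hceq hMB] at s3
  rw [← hceq' hTM, ← hceq' hTB, ← hceq' hMB] at s0' s1'
  rw [← hceq' hTB, ← hceq' hMB] at s2'
  rw [← hceq' hMB] at s3'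
  rw [KnotDiagram.phi_eq_of_insert s0 s1 s2 s3, KnotDiagram.phi_eq_of_insert s0' s1' s2' s3', hcore]
  congr 1
  · congr 1
    refine Finset.sum_congr rfl fun d hd => ?_
    rw [hterm neTM hTM hd, hterm neTB hTB hd, hterm neMB hMB hd]
  · refine Finset.sum_congr rfl fun q hq => ?_
    induction q using Sym2.ind with
    | _ d d' =>
      rw [Finset.mk_mem_sym2_iff] at hq
      obtain ⟨hd, hdK⟩ := (hR d).1 hq.1
      obtain ⟨hd', hdK'⟩ := (hR d').1 hq.2
      exact hloc.signedTerm_eq hp hp' hd hd' hdK hdK'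

theorem phi_eq_of_step [T2Space S] [IsManifold (𝓡 2) ∞ S] [OrientedAtlas S] {D D' : KnotDiagram S}
    (h : ReidemeisterStep D D') : D.phi = D'.phi := by
  cases h with
  | isotopy h => exact phi_eq_of_isotopyMove h
  | one h => exact phi_eq_of_r1Move h
  | two h => exact phi_eq_of_r2Move h
  | three h => exact phi_eq_of_r3Move h

end ThirdMove

end SurfaceKnot

end

/-! ### The invariant on the free abelian group of knots. -/

theorem mainTheorem11 (S : Type*) [TopologicalSpace S] [T2Space S] [CompactSpace S]
    [ChartedSpace SurfaceKnot.Plane S] [IsManifold (𝓡 2) ∞ S] [SurfaceKnot.OrientedAtlas S] :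
    ∃! Φ : FreeAbelianGroup (SurfaceKnot.Knots S) →+ SurfaceKnot.SurfaceGroup S,
      ∀ D : SurfaceKnot.KnotDiagram S, Φ (FreeAbelianGroup.of D.toKnot) = D.phi := by
  let φ : SurfaceKnot.Knots S → SurfaceKnot.SurfaceGroup S :=
    Quot.lift SurfaceKnot.KnotDiagram.phi fun _ _ h => SurfaceKnot.phi_eq_of_step h
  refine ⟨FreeAbelianGroup.lift φ, fun D => FreeAbelianGroup.lift_apply_of φ D.toKnot,
    fun Ψ hΨ => FreeAbelianGroup.lift_ext _ _ ?_⟩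
  intro K
  obtain ⟨D, rfl⟩ := Quot.exists_rep K
  exact (hΨ D).trans (FreeAbelianGroup.lift_apply_of φ D.toKnot).symm
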